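/- Let $n\ge 1$, $H_0=-\Delta$ on $L^2=L^2(\mathbb R^n;\mathbb C)$, $P=-i\nabla$, $\langle x\rangle=(1+|x|^2)^{1/2}$. A smooth cutoff is a $C^\infty$ function $F:\mathbb R\to[0,1]$ with $F(k)=1$ for $k\ge 1$ and $F(k)=0$ for $k\le 1/2$. For smooth cutoffs $\bar F_c, F_1$ put $F_c(\lambda\le 1)=1-\bar F_c(\lambda)$, $F_1(\lambda>1)=F_1(\lambda)$; $F_1(t^b|P|>1)$ is the Fourier multiplier, and $F_c\big(\frac{|x-2tP|}{t^\alpha}\le 1\big)=e^{-itH_0}F_c\big(\frac{|x|}{t^\alpha}\le 1\big)e^{itH_0}$. Let $\psi\in C(\mathbb R;L^2)$ be a global (mild) solution of $$i\partial_t\psi-H_0\psi=N(x,t,|\psi|)\,\psi ,$$ where $N$ may be complex valued, and suppose that $\|\psi(t)\|_{L^2}\le M$ for all $t\in\mathbb R$ and that $\langle x\rangle^{\delta}N(x,t,|\psi|)\in L^\infty_{t,x}(\mathbb R\times\mathbb R^n)$ for some $\delta>1$. Put $e=\frac12(1+\frac1\delta)$. (a) For all smooth cutoffs $\bar F_c,F_1$,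 all $b\in(0,1-e)$ and all $\alpha\in(b,1-b)$, the limit $$\Omega^*_{\alpha,b}\psi(0)=\lim_{t\to\infty}e^{itH_0}F_c\Big(\frac{|x-2tP|}{t^\alpha}\le 1\Big)F_1(t^b|P|>1)\,\psi(t)$$ exists in the norm of $L^2$, and $$e^{itH_0}\Big(1-F_c\Big(\frac{|x-2tP|}{t^\alpha}\le 1\Big)F_1(t^b|P|>1)\Big)\psi(t)\longrightarrow 0\quad\text{weakly in } L^2\text{ as }t\to\infty .$$ (b) If $\delta>2$, there is $\psi_+\in L^2$ such that for every $\varepsilon>0$ there is a family $\psi_{w,\varepsilon}(t)\in L^2$ with $$\lim_{t\to\infty}\|\psi(t)-e^{-itH_0}\psi_+-\psi_{w,\varepsilon}(t)\|_{L^2}=0$$ and $$(\psi_{w,\varepsilon}(t),|x|\,\psi_{w,\varepsilon}(t))_{L^2}\le C\,t^{1/2+\varepsilon}\,\|\psi(0)\|_{L^2}^2\qquad\text{for all }t\ge 1,$$ where $C$ depends only on $n$, $\varepsilon$ and the ratio $M/\|\psi(0)\|_{L^2}$ (for $\psi(0)=0$ the right-hand side is $0$). -/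

import Mathlib

open MeasureTheory Filter Topology FourierTransform

noncomputable section

namespace FreeChannel

/-- Euclidean space `ℝⁿ`. -/
abbrev Space (n : ℕ) : Type := EuclideanSpace ℝ (Fin n)

/-- The Hilbert space `L²(ℝⁿ; ℂ)`. -/
abbrev L2 (n : ℕ) : Type := Lp ℂ 2 (volume : Measure (Space n))

/-- Multiplication of `f ∈ L²(ℝⁿ)` by a function `m`, as an element of `L²(ℝⁿ)`
(the value is `0` if `m f` is not in `L²`, which does not happen for bounded measurable `m`). -/
def mulOp {n : ℕ} (m : Space n → ℂ) (f : L2 n) : L2 n :=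
  open Classical in
  if h : MemLp (fun x => m x * f x) 2 (volume : Measure (Space n)) then h.toLp _ else 0

/-- For essentially bounded measurable `m`, the operator `mulOp m` really is
multiplication by `m`. -/
theorem mulOp_coeFn {n : ℕ} {m : Space n → ℂ}
    (hm : MemLp m ⊤ (volume : Measure (Space n))) (f : L2 n) :
    mulOp m f =ᵐ[volume] fun x => m x * f x := by
  have h : MemLp (fun x => m x * f x) 2 (volume : Measure (Space n)) := (Lp.memLp f).mul hm
  rw [mulOp, dif_pos h]
  exact h.coeFn_toLp

/-- The Fourier multiplier `m(P)`, where `P = -i∇`. The Fourier transform `𝓕` uses the kernel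
`exp (-2πi ⟨x, ξ⟩)`, so that `P` corresponds to multiplication by `2πξ`. -/
def momentumOp {n : ℕ} (m : Space n → ℂ) (f : L2 n) : L2 n :=
  𝓕⁻ (mulOp (fun ξ => m ((2 * Real.pi) • ξ)) (𝓕 f))

/-- The free Schrödinger group `e^{-itH₀}`, `H₀ = -Δ = |P|²`. -/
def freeFlow {n : ℕ} (t : ℝ) (f : L2 n) : L2 n :=
  momentumOp (fun p => Complex.exp (-(Complex.I * (t : ℂ) * ((‖p‖ ^ 2 : ℝ) : ℂ)))) f

/-- A smooth characteristic function of the half line `[1, ∞)`: smooth, with values in `[0, 1]`,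
equal to `1` on `[1, ∞)` and to `0` on `(-∞, 1/2]`. -/
structure IsSmoothCutoff (F : ℝ → ℝ) : Prop where
  contDiff : ContDiff ℝ (⊤ : ℕ∞) F
  nonneg : ∀ k, 0 ≤ F k
  le_one : ∀ k, F k ≤ 1
  eq_one : ∀ k, 1 ≤ k → F k = 1
  eq_zero : ∀ k, k ≤ 1 / 2 → F k = 0

/-- The multiplication operator `F_c(|x| / r ≤ 1)`, where `F_c(λ ≤ 1) = 1 - F̄_c(λ)` and
`Fbar = F̄_c` is a smooth characteristic function of `[1, ∞)`. -/
def positionCutoff {n : ℕ} (Fbar : ℝ → ℝ) (r : ℝ) (f : L2 n) : L2 n :=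
  mulOp (fun x => ((1 - Fbar (‖x‖ / r) : ℝ) : ℂ)) f

/-- The operator `F_c(|x - 2tP| / r ≤ 1)`. As `x - 2tP = e^{-itH₀} x e^{itH₀}`, this function of
the commuting self-adjoint operators `x_j - 2tP_j` is `e^{-itH₀} F_c(|x| / r ≤ 1) e^{itH₀}`. -/
def propagationCutoff {n : ℕ} (Fbar : ℝ → ℝ) (t r : ℝ) (f : L2 n) : L2 n :=
  freeFlow t (positionCutoff Fbar r (freeFlow (-t) f))

/-- The operator `F₁(s |P| > 1)`, where `F₁(λ > 1) = F₁(λ)` and `F₁` is a smooth characteristic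
function of `[1, ∞)`. -/
def momentumCutoff {n : ℕ} (F₁ : ℝ → ℝ) (s : ℝ) (f : L2 n) : L2 n :=
  momentumOp (fun p => ((F₁ (s * ‖p‖) : ℝ) : ℂ)) f

/-- The operator `J(t) = F_c(|x - 2tP| / t^α ≤ 1) F₁(t^b |P| > 1)`. -/
def channelCutoff {n : ℕ} (Fbar F₁ : ℝ → ℝ) (α b t : ℝ) (f : L2 n) : L2 n :=
  propagationCutoff Fbar t (t ^ α) (momentumCutoff F₁ (t ^ b) f)

/-- The modulus `|f| ∈ L²(ℝⁿ; ℝ)` of `f ∈ L²(ℝⁿ; ℂ)`. -/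
def modulus {n : ℕ} (f : L2 n) : Lp ℝ 2 (volume : Measure (Space n)) :=
  (Lp.memLp f).norm.toLp _

/-- An interaction `N(x, t, |ψ|)`, possibly complex valued. It may be a function of the value
`|ψ(x, t)|` or, more generally, a nonlocal functional of `|ψ(·, t)|`. -/
abbrev Interaction (n : ℕ) : Type :=
  Space n → ℝ → Lp ℝ 2 (volume : Measure (Space n)) → ℂ

/-- The potential `V(x, t) = N(x, t, |ψ(t)|)` along `ψ`. -/
def potential {n : ℕ} (N : Interaction n) (ψ : ℝ → L2 n) (t : ℝ) (x : Space n) : ℂ :=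
  N x t (modulus (ψ t))

/-- `ψ ∈ C(ℝ; L²)` is a global (mild) solution of `i ∂ₜψ - H₀ψ = N(x, t, |ψ|) ψ`: for all `t`,
`ψ(t) = e^{-itH₀} ψ(0) - i ∫₀ᵗ e^{-i(t-s)H₀} N(·, s, |ψ(s)|) ψ(s) ds`, where the integrand is
Bochner integrable in `L²`. -/
structure IsGlobalSolution {n : ℕ} (N : Interaction n) (ψ : ℝ → L2 n) : Prop where
  continuous : Continuous ψ
  integrable : ∀ t : ℝ, IntervalIntegrable
    (fun s => freeFlow (t - s) (mulOp (potential N ψ s) (ψ s))) volume 0 t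
  duhamel : ∀ t : ℝ, ψ t = freeFlow t (ψ 0) -
    Complex.I • ∫ s in (0 : ℝ)..t, freeFlow (t - s) (mulOp (potential N ψ s) (ψ s))

/-- Spatial localization: `⟨x⟩^δ N(x, t, |ψ|) ∈ L^∞_{t,x}(ℝ × ℝⁿ)`, `⟨x⟩ = (1 + |x|²)^{1/2}`. -/
def IsLocalized {n : ℕ} (N : Interaction n) (ψ : ℝ → L2 n) (δ : ℝ) : Prop :=
  MemLp (fun p : ℝ × Space n =>
    ((Real.sqrt (1 + ‖p.2‖ ^ 2) ^ δ : ℝ) : ℂ) * potential N ψ p.1 p.2) ⊤ volume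

/-- The expectation `(f, |x| f) = ∫ |x| |f(x)|² dx ∈ [0, ∞]`. -/
def positionMoment {n : ℕ} (f : L2 n) : ENNReal :=
  ∫⁻ x, ENNReal.ofReal (‖x‖ * ‖f x‖ ^ 2)

end FreeChannel

end

/-!
Write `φ(t) = e^{itH₀} ψ(t)` for the solution in the interaction picture. Then
`φ(t) - φ(s) = -i ∫ₛᵗ e^{iuH₀} h(u) du` with sources `h(u) = N ψ(u)` that are bounded in `L²` and
have tails of order `R^{-δ}` outside the ball of radius `R` (`IsDuhamel`). Everything follows from
this representation and three propagation estimates for the free flow, which hold with errors of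
arbitrarily high order:

* minimal velocity (`exists_minimal_velocity_bound`): waves with `|P| ≥ 1/s` leave bounded
  regions;
* maximal velocity (`exists_maximal_velocity_bound`): waves with `|P| ≤ 1/s` do not go further
  than their momenta allow;
* crossing (`exists_crossing_bound`): a free wave cannot be near the origin at two times and far
  away in between.

They are proved on Schwartz functions, by iterating exact operator identities which come from
`e^{-itH₀} x e^{itH₀} = x - 2tP`. The symbols are homogeneous outside the unit ball (`IsSymbol`),
a class which is stable under the operations that occur in the iteration.

*Channels.* In the interaction picture the channel cutoff is `F_c(|x|/t^α ≤ 1) F₁(t^b |P| > 1)`, a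
bounded operator `A t` tending strongly to the identity with its adjoint. If the sources at time
`u` are cut off at radius `u^ρ` with `1/δ < ρ < 1 - b`, the minimal velocity bound and the decay
of the tails show by Cook's method that `A s (φ t - φ s)` is small uniformly in `t ≥ s`
(`IsDuhamel.exists_channel_bound`). Hence `φ` has a weak limit `Ω`, and `A s (φ s)` converges to
`Ω` in norm (`exists_weak_limit`, `tendsto_of_weak_limit`).

*Weakly localized part.* Let `w(t) = e^{-itH₀} (φ t - Ω)`. It is enough that the restriction of
`w(t)` to `|x| > t^{1/2+ε}` tends to zero (`IsDuhamel.tendsto_norm_cutOff`), since the rest of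
`w(t)` obviously has the required moment. Momenta below `t^{-1/2}` do not reach this region up to
time `t`, by the maximal velocity bound. For the momenta above `t^{-1/2}`, one of the two factors
of `⟨w, F(|x| > t^{1/2+ε}) F₁(t^{1/2} |P| > 1) w⟩` is expressed through the initial data and the
sources before time `t`, and the other one through the sources after time `t`, as `Ω` is the weak
limit of `φ`. The result is a double integral whose kernel is estimated by the crossing bound
(`exists_double_duhamel_bound`). The condition `δ > 2` allows cutting off the sources at radius
`t^ν` with `1/δ < ν < 1/2`.
-/

noncomputable section

namespace FreeChannel

open SchwartzMap LineDeriv Metric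

variable {n : ℕ}

/-! ### Multipliers on Schwartz functions -/

/-- The `j`-th coordinate, as a complex valued function. -/
def coord (j : Fin n) (x : Space n) : ℂ := ((x j : ℝ) : ℂ)

/-- The partial derivative `∂ⱼ m`. -/
def partialDeriv (j : Fin n) (m : Space n → ℂ) (x : Space n) : ℂ :=
  fderiv ℝ m x (EuclideanSpace.single j 1)

/-- The dilated function `x ↦ m (s x)`. -/
def dilate (s : ℝ) (m : Space n → ℂ) (x : Space n) : ℂ := m (s • x)

/-- The free phase `exp (-i t |p|²)`. -/
def freePhase (t : ℝ) (p : Space n) : ℂ :=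
  Complex.exp (-(Complex.I * (t : ℂ) * ((‖p‖ ^ 2 : ℝ) : ℂ)))

theorem coord_eq_inner (j : Fin n) :
    coord j = fun x : Space n => ((inner ℝ x (EuclideanSpace.single j 1) : ℝ) : ℂ) := by
  ext x
  simp [coord, EuclideanSpace.inner_single_right]

theorem coord_hasTemperateGrowth (j : Fin n) :
    (coord j : Space n → ℂ).HasTemperateGrowth := by
  rw [coord_eq_inner]
  fun_prop

theorem smul_hasTemperateGrowth (s : ℝ) :
    (fun x : Space n => s • x).HasTemperateGrowth := by
  fun_prop

theorem dilate_hasTemperateGrowth {m : Space n → ℂ} (hm : m.HasTemperateGrowth) (s : ℝ) :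
    (dilate s m).HasTemperateGrowth :=
  hm.comp (smul_hasTemperateGrowth s)

theorem partialDeriv_hasTemperateGrowth {m : Space n → ℂ} (hm : m.HasTemperateGrowth)
    (j : Fin n) : (partialDeriv j m).HasTemperateGrowth := by
  have h : (fderiv ℝ m).HasTemperateGrowth := by
    refine ⟨hm.1.fderiv_right (by simp), fun k => ?_⟩
    obtain ⟨l, C, h⟩ := hm.2 (k + 1)
    exact ⟨l, C, fun x => by rw [norm_iteratedFDeriv_fderiv]; exact h x⟩
  exact (ContinuousLinearMap.hasTemperateGrowth
    (ContinuousLinearMap.apply ℝ ℂ (EuclideanSpace.single j (1 : ℝ) : Space n))).comp h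

theorem exp_I_hasTemperateGrowth :
    (fun s : ℝ => Complex.exp (s * Complex.I)).HasTemperateGrowth := by
  have key : ∀ k : ℕ, iteratedDeriv k (fun s : ℝ => Complex.exp (s * Complex.I)) =
      fun s : ℝ => Complex.I ^ k * Complex.exp (s * Complex.I) := by
    intro k
    induction k with
    | zero => simp
    | succ k ih =>
      rw [iteratedDeriv_succ, ih]
      ext s
      have h : HasDerivAt (fun s : ℝ => Complex.exp (s * Complex.I))
          (Complex.exp (s * Complex.I) * (1 * Complex.I)) s :=
        (((hasDerivAt_id (s : ℂ)).comp_ofReal.mul_const Complex.I)).cexp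
      rw [(h.const_mul _).deriv]
      ring
  refine ⟨(Complex.ofRealCLM.contDiff.mul contDiff_const).cexp, fun k => ⟨0, 1, fun s => ?_⟩⟩
  rw [norm_iteratedFDeriv_eq_norm_iteratedDeriv, key]
  simp [Complex.norm_exp_ofReal_mul_I]

theorem freePhase_hasTemperateGrowth (t : ℝ) :
    (freePhase t : Space n → ℂ).HasTemperateGrowth := by
  have h : (fun p : Space n => -t * ‖p‖ ^ 2).HasTemperateGrowth :=
    (Function.HasTemperateGrowth.const (-t)).mul (Function.hasTemperateGrowth_norm_sq _)
  have := exp_I_hasTemperateGrowth.comp h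
  convert this using 1
  ext p
  simp only [freePhase, Function.comp]
  congr 1
  push_cast
  ring

theorem partialDeriv_freePhase (t : ℝ) (j : Fin n) :
    partialDeriv j (freePhase t : Space n → ℂ) =
      fun p => -(2 * Complex.I * t) * (coord j p * freePhase t p) := by
  ext p
  have h1 : HasFDerivAt (fun p : Space n => ‖p‖ ^ 2) (2 • (innerSL ℝ p)) p :=
    (hasStrictFDerivAt_norm_sq p).hasFDerivAt
  have h2 : HasFDerivAt (fun p : Space n => ((‖p‖ ^ 2 : ℝ) : ℂ))
      (Complex.ofRealCLM.comp (2 • (innerSL ℝ p))) p := Complex.ofRealCLM.hasFDerivAt.comp p h1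
  have h3 := ((h2.const_mul (Complex.I * t)).neg).cexp
  rw [partialDeriv]
  have e : (freePhase t : Space n → ℂ) = fun p =>
    Complex.exp ((-fun y : Space n => Complex.I * ↑t * ((‖y‖ ^ 2 : ℝ) : ℂ)) p) := rfl
  rw [e, h3.fderiv]
  simp [coord, EuclideanSpace.inner_single_right]
  ring

theorem partialDeriv_dilate {m : Space n → ℂ} (hm : Differentiable ℝ m) (s : ℝ) (j : Fin n) :
    partialDeriv j (dilate s m) = fun x => (s : ℂ) * dilate s (partialDeriv j m) x := by
  ext x
  have h : HasFDerivAt (fun x : Space n => s • x) (s • ContinuousLinearMap.id ℝ (Space n)) x :=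
    (hasFDerivAt_id x).const_smul s
  have h2 := (hm (s • x)).hasFDerivAt.comp x h
  rw [partialDeriv]
  have e : (dilate s m) = m ∘ fun x => s • x := rfl
  rw [e, h2.fderiv]
  simp [dilate, partialDeriv]

/-- Multiplication by a function of temperate growth on Schwartz functions. -/
def mulS (f : Space n → ℂ) : 𝓢(Space n, ℂ) →L[ℂ] 𝓢(Space n, ℂ) := smulLeftCLM ℂ f

/-- The multiplier `m(P)` on Schwartz functions, with `P = -i∇`. -/
def momS (m : Space n → ℂ) : 𝓢(Space n, ℂ) →L[ℂ] 𝓢(Space n, ℂ) :=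
  fourierMultiplierCLM ℂ (dilate (2 * Real.pi) m)

theorem mulS_apply {f : Space n → ℂ} (hf : f.HasTemperateGrowth) (g : 𝓢(Space n, ℂ))
    (x : Space n) : mulS f g x = f x * g x := by
  simp [mulS, smulLeftCLM_apply_apply hf]

theorem mulS_mulS {f g : Space n → ℂ} (hf : f.HasTemperateGrowth) (hg : g.HasTemperateGrowth)
    (h : 𝓢(Space n, ℂ)) : mulS f (mulS g h) = mulS (f * g) h :=
  smulLeftCLM_smulLeftCLM_apply hf hg h

theorem momS_momS {f g : Space n → ℂ} (hf : f.HasTemperateGrowth) (hg : g.HasTemperateGrowth)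
    (h : 𝓢(Space n, ℂ)) : momS f (momS g h) = momS (f * g) h :=
  fourierMultiplierCLM_fourierMultiplierCLM_apply (dilate_hasTemperateGrowth hf _)
    (dilate_hasTemperateGrowth hg _) h

theorem momS_comm {f g : Space n → ℂ} (hf : f.HasTemperateGrowth) (hg : g.HasTemperateGrowth)
    (h : 𝓢(Space n, ℂ)) : momS f (momS g h) = momS g (momS f h) := by
  rw [momS_momS hf hg, momS_momS hg hf, mul_comm]

theorem momS_const_mul {f : Space n → ℂ} (hf : f.HasTemperateGrowth) (c : ℂ)
    (h : 𝓢(Space n, ℂ)) : momS (fun x => c * f x) h = c • momS f h := by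
  have := fourierMultiplierCLM_smul (F := ℂ) (dilate_hasTemperateGrowth hf (2 * Real.pi)) c
  exact congrArg (fun T => T h) this

theorem mulS_const_mul {f : Space n → ℂ} (hf : f.HasTemperateGrowth) (c : ℂ)
    (h : 𝓢(Space n, ℂ)) : mulS (fun x => c * f x) h = c • mulS f h := by
  have := smulLeftCLM_smul (F := ℂ) hf c
  exact congrArg (fun T => T h) this

theorem mulS_sum {ι : Type*} {f : ι → Space n → ℂ} {s : Finset ι}
    (hf : ∀ i ∈ s, (f i).HasTemperateGrowth) (h : 𝓢(Space n, ℂ)) :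
    mulS (fun x => ∑ i ∈ s, f i x) h = ∑ i ∈ s, mulS (f i) h := by
  have := congrArg (fun T => T h) (smulLeftCLM_sum (F := ℂ) hf)
  simpa [mulS] using this

theorem momS_sum {ι : Type*} {f : ι → Space n → ℂ} {s : Finset ι}
    (hf : ∀ i ∈ s, (f i).HasTemperateGrowth) (h : 𝓢(Space n, ℂ)) :
    momS (fun x => ∑ i ∈ s, f i x) h = ∑ i ∈ s, momS (f i) h := by
  have := congrArg (fun T => T h) (fourierMultiplierCLM_sum ℂ
    (fun i hi => dilate_hasTemperateGrowth (hf i hi) (2 * Real.pi)))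
  simp only [sum_apply] at this
  exact this

/-- The momentum `Pⱼ` is `-i ∂ⱼ`. -/
theorem momS_coord (j : Fin n) (g : 𝓢(Space n, ℂ)) :
    momS (coord j) g = (-Complex.I) • ∂_{(EuclideanSpace.single j 1 : Space n)} g := by
  rw [lineDeriv_eq_fourierMultiplierCLM, smul_smul]
  have e : dilate (2 * Real.pi) (coord j) =
      fun x : Space n => ((2 * Real.pi : ℝ) : ℂ) * coord j x := by
    ext x; simp [dilate, coord]
  rw [momS, e]
  have := fourierMultiplierCLM_smul (F := ℂ) (coord_hasTemperateGrowth (n := n) j)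
    ((2 * Real.pi : ℝ) : ℂ)
  rw [show (fun x : Space n => ((2 * Real.pi : ℝ) : ℂ) * coord j x) =
    ((2 * Real.pi : ℝ) : ℂ) • (coord j : Space n → ℂ) from rfl, this, coord_eq_inner]
  have h2 := fourierMultiplierCLM_ofReal (F := ℂ) ℂ
    (g := fun x : Space n => inner ℝ x (EuclideanSpace.single j (1 : ℝ))) (by fun_prop) g
  simp only [smul_apply]
  erw [h2]
  congr 1
  push_cast
  linear_combination (2 * (Real.pi : ℂ)) * Complex.I_mul_I

theorem lineDeriv_mulS {f : Space n → ℂ} (hf : f.HasTemperateGrowth) (j : Fin n)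
    (g : 𝓢(Space n, ℂ)) :
    ∂_{(EuclideanSpace.single j 1 : Space n)} (mulS f g) =
      mulS f (∂_{(EuclideanSpace.single j 1 : Space n)} g) + mulS (partialDeriv j f) g := by
  ext x
  have hp := partialDeriv_hasTemperateGrowth hf j
  rw [lineDerivOp_apply_eq_fderiv, add_apply, mulS_apply hf, mulS_apply hp,
    lineDerivOp_apply_eq_fderiv]
  have e : (mulS f g : Space n → ℂ) = f * g := by
    ext x; exact mulS_apply hf g x
  rw [e, ((hf.1.differentiable (by simp) x).hasFDerivAt.mul (g.hasFDerivAt x)).fderiv]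
  simp [partialDeriv]
  ring

theorem momS_coord_mulS {f : Space n → ℂ} (hf : f.HasTemperateGrowth) (j : Fin n)
    (g : 𝓢(Space n, ℂ)) :
    momS (coord j) (mulS f g) =
      mulS f (momS (coord j) g) - Complex.I • mulS (partialDeriv j f) g := by
  rw [momS_coord, momS_coord, lineDeriv_mulS hf, map_smul]
  module

theorem lineDeriv_fourier (j : Fin n) (g : 𝓢(Space n, ℂ)) :
    ∂_{(EuclideanSpace.single j 1 : Space n)} (𝓕 g) =
      (-(2 * Real.pi * Complex.I)) • 𝓕 (mulS (coord j) g) := by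
  rw [lineDerivOp_fourier_eq, FourierTransform.fourier_smul, mulS, coord_eq_inner]
  have h2 := smulLeftCLM_ofReal (F := ℂ) ℂ
    (g := fun x : Space n => inner ℝ x (EuclideanSpace.single j (1 : ℝ))) (by fun_prop) g
  erw [h2]

theorem fourier_momS (m : Space n → ℂ) (g : 𝓢(Space n, ℂ)) :
    𝓕 (momS m g) = mulS (dilate (2 * Real.pi) m) (𝓕 g) := by
  rw [momS, fourierMultiplierCLM_apply, FourierTransform.fourier_fourierInv_eq, mulS]

theorem momS_mulS_coord {m : Space n → ℂ} (hm : m.HasTemperateGrowth) (j : Fin n)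
    (g : 𝓢(Space n, ℂ)) :
    momS m (mulS (coord j) g) =
      mulS (coord j) (momS m g) - Complex.I • momS (partialDeriv j m) g := by
  have hd := dilate_hasTemperateGrowth hm (2 * Real.pi)
  have hp := dilate_hasTemperateGrowth (partialDeriv_hasTemperateGrowth hm j) (2 * Real.pi)
  have h := lineDeriv_mulS hd j (𝓕 g)
  rw [← fourier_momS, lineDeriv_fourier, lineDeriv_fourier, map_smul, ← fourier_momS,
    partialDeriv_dilate (hm.1.differentiable (by simp)), mulS_const_mul hp, ← fourier_momS,
    ← FourierTransform.fourier_smul, ← FourierTransform.fourier_smul,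
    ← FourierTransform.fourier_smul, ← FourierTransform.fourier_add] at h
  have h' := congrArg (fun G => 𝓕⁻ G) h
  simp only [FourierTransform.fourierInv_fourier_eq] at h'
  have hc : -(2 * (Real.pi : ℂ) * Complex.I) ≠ 0 := by
    simp [Real.pi_ne_zero]
  have hI : (((2 * Real.pi : ℝ)) : ℂ) = -(2 * (Real.pi : ℂ) * Complex.I) * Complex.I := by
    push_cast
    linear_combination (2 * (Real.pi : ℂ)) * Complex.I_mul_I
  rw [hI, mul_smul, ← smul_add] at h'
  rw [smul_right_injective _ hc h']
  abel

/-- The free Schrödinger group on Schwartz functions. -/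
def flowS (t : ℝ) : 𝓢(Space n, ℂ) →L[ℂ] 𝓢(Space n, ℂ) := momS (freePhase t)

/-- The Heisenberg evolution of the position, `e^{-itH₀} xⱼ = (xⱼ - 2tPⱼ) e^{-itH₀}`. -/
theorem flowS_mulS_coord (t : ℝ) (j : Fin n) (g : 𝓢(Space n, ℂ)) :
    flowS t (mulS (coord j) g) =
      mulS (coord j) (flowS t g) - (2 * t : ℂ) • momS (coord j) (flowS t g) := by
  have hf := freePhase_hasTemperateGrowth (n := n) t
  have hc := coord_hasTemperateGrowth (n := n) j
  rw [flowS, momS_mulS_coord hf, partialDeriv_freePhase]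
  have := momS_const_mul (hc.mul hf) (-(2 * Complex.I * t)) g
  simp only [Pi.mul_apply] at this
  rw [this, momS_momS hc hf, smul_smul]
  congr 2
  linear_combination (-2 * (t : ℂ)) * Complex.I_mul_I

/-! ### Symbols of smooth cutoffs -/

/-- A smooth symbol which vanishes on the ball of radius `1/2` and is positively homogeneous of
some degree `-d ≤ 0` outside the unit ball. This class is closed under partial derivatives and
under multiplication by `pⱼ / |p|²`, and homogeneity makes all derivatives bounded. -/
structure IsSymbol (m : Space n → ℂ) : Prop where
  contDiff : ContDiff ℝ (⊤ : ℕ∞) m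
  eq_zero : ∀ p, ‖p‖ < 1 / 2 → m p = 0
  homogeneous : ∃ d : ℕ, ∀ c : ℝ, 1 ≤ c → ∀ p, 1 < ‖p‖ → (c : ℂ) ^ d * m (c • p) = m p

/-- By homogeneity, a derivative is controlled everywhere by its values on the compact ball of
radius `2`. -/
theorem IsSymbol.iteratedFDeriv_bounded {m : Space n → ℂ} (hm : IsSymbol m) (k : ℕ) :
    ∃ C : ℝ, ∀ p, ‖iteratedFDeriv ℝ k m p‖ ≤ C := by
  obtain ⟨d, hd⟩ := hm.homogeneous
  have hcont : Continuous fun p => iteratedFDeriv ℝ k m p :=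
    hm.contDiff.continuous_iteratedFDeriv (by exact_mod_cast le_top)
  obtain ⟨C, hC⟩ := (isCompact_closedBall (0 : Space n) 2).exists_bound_of_continuousOn
    hcont.continuousOn
  refine ⟨C, fun p => ?_⟩
  rcases le_or_gt ‖p‖ 2 with hp | hp
  · exact hC p (by simpa using hp)
  -- outside the ball of radius `2`, compare with the point `q = (2 / |p|) p` of its boundary
  set c : ℝ := ‖p‖ / 2 with hc
  have hc1 : 1 ≤ c := by rw [hc]; linarith
  have hc0 : 0 < c := by linarith
  set q : Space n := c⁻¹ • p with hq
  have hqn : ‖q‖ = 2 := by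
    rw [hq, norm_smul, norm_inv, Real.norm_of_nonneg hc0.le, hc]
    field_simp
  have hpq : c • q = p := by rw [hq, smul_inv_smul₀ hc0.ne']
  have hev : (fun x => ((c : ℂ) ^ d) • m (c • x)) =ᶠ[𝓝 q] m := by
    have : {x : Space n | 1 < ‖x‖} ∈ 𝓝 q :=
      (isOpen_lt continuous_const continuous_norm).mem_nhds (by simp [hqn])
    filter_upwards [this] with x hx
    simpa using hd c hc1 x hx
  have hsm : ContDiff ℝ k m := hm.contDiff.of_le (by exact_mod_cast le_top)
  have h1 := (hev.iteratedFDeriv ℝ k).eq_of_nhds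
  have hcomp : ContDiff ℝ k fun x : Space n => m (c • x) :=
    hsm.comp (contDiff_const_smul c)
  rw [show (fun x => ((c : ℂ) ^ d) • m (c • x)) = ((c : ℂ) ^ d) • fun x => m (c • x) from rfl,
    iteratedFDeriv_const_smul_apply hcomp.contDiffAt, iteratedFDeriv_comp_const_smul c hsm] at h1
  simp only [hpq] at h1
  have h2 : c ^ d * (c ^ k * ‖iteratedFDeriv ℝ k m p‖) = ‖iteratedFDeriv ℝ k m q‖ := by
    rw [← h1, norm_smul, norm_smul]
    simp [abs_of_pos hc0]
  have h3 := hC q (by simp [hqn])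
  rw [← h2] at h3
  refine le_trans ?_ h3
  have h4 : 1 ≤ c ^ d * c ^ k := one_le_mul_of_one_le_of_one_le (one_le_pow₀ hc1) (one_le_pow₀ hc1)
  nlinarith [norm_nonneg (iteratedFDeriv ℝ k m p)]

theorem IsSymbol.hasTemperateGrowth {m : Space n → ℂ} (hm : IsSymbol m) :
    m.HasTemperateGrowth := by
  refine ⟨hm.contDiff, fun k => ?_⟩
  obtain ⟨C, hC⟩ := hm.iteratedFDeriv_bounded k
  exact ⟨0, C, fun x => by simpa using hC x⟩

theorem IsSymbol.bounded {m : Space n → ℂ} (hm : IsSymbol m) :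
    ∃ C : ℝ, 0 ≤ C ∧ ∀ p, ‖m p‖ ≤ C := by
  obtain ⟨C, hC⟩ := hm.iteratedFDeriv_bounded 0
  exact ⟨C, (norm_nonneg _).trans (hC 0), fun p => by simpa using hC p⟩

theorem IsSymbol.partialDeriv {m : Space n → ℂ} (hm : IsSymbol m) (j : Fin n) :
    IsSymbol (partialDeriv j m) := by
  refine ⟨(partialDeriv_hasTemperateGrowth hm.hasTemperateGrowth j).1, fun p hp => ?_, ?_⟩
  · have : m =ᶠ[𝓝 p] fun _ => 0 := by
      filter_upwards [(isOpen_lt continuous_norm continuous_const).mem_nhds hp] with x hx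
      exact hm.eq_zero x hx
    rw [FreeChannel.partialDeriv, this.fderiv_eq]
    simp
  · obtain ⟨d, hd⟩ := hm.homogeneous
    refine ⟨d + 1, fun c hc p hp => ?_⟩
    have hev : (fun x => (c : ℂ) ^ d * dilate c m x) =ᶠ[𝓝 p] m := by
      filter_upwards [(isOpen_lt continuous_const continuous_norm).mem_nhds hp] with x hx
      exact hd c hc x hx
    have hdiff : Differentiable ℝ m := hm.contDiff.differentiable (by simp)
    have h1 : FreeChannel.partialDeriv j (fun x => (c : ℂ) ^ d * dilate c m x) p =
        FreeChannel.partialDeriv j m p := by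
      rw [FreeChannel.partialDeriv, hev.fderiv_eq, FreeChannel.partialDeriv]
    have h2 : DifferentiableAt ℝ (dilate c m) p :=
      (dilate_hasTemperateGrowth hm.hasTemperateGrowth c).1.differentiable (by simp) p
    rw [← h1]
    change _ = fderiv ℝ (fun x => (c : ℂ) ^ d * dilate c m x) p _
    rw [fderiv_const_mul h2]
    have h3 := congrFun (partialDeriv_dilate hdiff c j) p
    rw [FreeChannel.partialDeriv] at h3
    simp only [smul_apply, h3, smul_eq_mul, dilate]
    ring

/-- The function `(pⱼ / |p|²) m(p)`. -/
def divCoord (j : Fin n) (m : Space n → ℂ) (p : Space n) : ℂ :=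
  coord j p * ((((‖p‖ ^ 2)⁻¹ : ℝ) : ℂ) * m p)

theorem IsSymbol.divCoord {m : Space n → ℂ} (hm : IsSymbol m) (j : Fin n) :
    IsSymbol (divCoord j m) := by
  refine ⟨?_, fun p hp => by simp [FreeChannel.divCoord, hm.eq_zero p hp], ?_⟩
  · rw [contDiff_iff_contDiffAt]
    intro p
    rcases eq_or_ne p 0 with rfl | hp
    · have : FreeChannel.divCoord j m =ᶠ[𝓝 0] fun _ => 0 := by
        filter_upwards [(isOpen_lt continuous_norm continuous_const).mem_nhds
          (show ‖(0 : Space n)‖ < 1 / 2 by simp)] with x hx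
        simp [FreeChannel.divCoord, hm.eq_zero x hx]
      exact contDiffAt_const.congr_of_eventuallyEq this
    · have h1 : ContDiffAt ℝ (⊤ : ℕ∞) (fun p : Space n => (‖p‖ ^ 2)⁻¹) p :=
        ((contDiff_norm_sq ℝ).contDiffAt).inv (by simpa using hp)
      exact (coord_hasTemperateGrowth j).1.contDiffAt.mul
        ((Complex.ofRealCLM.contDiff.contDiffAt.comp p h1).mul hm.contDiff.contDiffAt)
  · obtain ⟨d, hd⟩ := hm.homogeneous
    refine ⟨d + 1, fun c hc p hp => ?_⟩
    have hc0 : (c : ℂ) ≠ 0 := by exact_mod_cast (by linarith : c ≠ 0)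
    have hp0 : (‖p‖ : ℂ) ≠ 0 := by exact_mod_cast (by linarith : ‖p‖ ≠ 0)
    simp only [FreeChannel.divCoord, coord]
    rw [← hd c hc p hp, norm_smul, Real.norm_of_nonneg (by linarith : 0 ≤ c)]
    simp only [PiLp.smul_apply, smul_eq_mul]
    push_cast
    field_simp
    ring

theorem IsSymbol.sum_coord_mul_divCoord {m : Space n → ℂ} (hm : IsSymbol m) (p : Space n) :
    ∑ j, coord j p * FreeChannel.divCoord j m p = m p := by
  rcases eq_or_ne p 0 with rfl | hp
  · simp [coord, hm.eq_zero 0 (by simp)]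
  have h1 : ∑ j, coord j p * coord j p = ((‖p‖ ^ 2 : ℝ) : ℂ) := by
    rw [EuclideanSpace.real_norm_sq_eq]
    simp [coord, sq]
  have h2 : ((‖p‖ ^ 2 : ℝ) : ℂ) ≠ 0 := by
    exact_mod_cast (by simpa using hp)
  simp only [FreeChannel.divCoord, ← mul_assoc]
  rw [← Finset.sum_mul, ← Finset.sum_mul, h1, Complex.ofReal_inv, mul_inv_cancel₀ h2, one_mul]

/-- The function `F(|p|)` is homogeneous of degree `0` outside the unit ball, where it is `1`. -/
theorem IsSmoothCutoff.isSymbol {F : ℝ → ℝ} (hF : IsSmoothCutoff F) :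
    IsSymbol (fun p : Space n => ((F ‖p‖ : ℝ) : ℂ)) := by
  refine ⟨?_, fun p hp => by simp [hF.eq_zero _ hp.le], 0, fun c hc p hp => ?_⟩
  · rw [contDiff_iff_contDiffAt]
    intro p
    rcases eq_or_ne p 0 with rfl | hp
    · have : (fun p : Space n => ((F ‖p‖ : ℝ) : ℂ)) =ᶠ[𝓝 0] fun _ => 0 := by
        filter_upwards [(isOpen_lt continuous_norm continuous_const).mem_nhds
          (show ‖(0 : Space n)‖ < 1 / 2 by simp)] with x hx
        simp [hF.eq_zero _ (le_of_lt hx)]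
      exact contDiffAt_const.congr_of_eventuallyEq this
    · exact Complex.ofRealCLM.contDiff.contDiffAt.comp p
        (hF.contDiff.contDiffAt.comp p (contDiffAt_norm ℝ hp))
  · have : 1 ≤ ‖c • p‖ := by
      rw [norm_smul, Real.norm_of_nonneg (by linarith : 0 ≤ c)]
      nlinarith
    simp [hF.eq_one _ hp.le, hF.eq_one _ this]

theorem exists_isSmoothCutoff : ∃ F : ℝ → ℝ, IsSmoothCutoff F :=
  ⟨fun k => Real.smoothTransition (2 * k - 1),
    { contDiff := Real.smoothTransition.contDiff.comp
        ((contDiff_const.mul contDiff_id).sub contDiff_const)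
      nonneg := fun k => Real.smoothTransition.nonneg _
      le_one := fun k => Real.smoothTransition.le_one _
      eq_one := fun k hk => Real.smoothTransition.one_of_one_le (by linarith)
      eq_zero := fun k hk => Real.smoothTransition.zero_of_nonpos (by linarith) }⟩

/-! ### Multipliers on `L²` -/

/-- A measurable function with a uniform bound. -/
structure BddMeasurable (m : Space n → ℂ) : Prop where
  measurable : Measurable m
  bounded : ∃ C : ℝ, ∀ x, ‖m x‖ ≤ C

theorem BddMeasurable.memLp {m : Space n → ℂ} (hm : BddMeasurable m) :
    MemLp m ⊤ (volume : Measure (Space n)) := by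
  obtain ⟨C, hC⟩ := hm.bounded
  exact memLp_top_of_bound hm.measurable.aestronglyMeasurable C (ae_of_all _ hC)

theorem BddMeasurable.dilate {m : Space n → ℂ} (hm : BddMeasurable m) (s : ℝ) :
    BddMeasurable (dilate s m) := by
  obtain ⟨C, hC⟩ := hm.bounded
  exact ⟨hm.measurable.comp (measurable_const_smul s), C, fun x => hC _⟩

theorem BddMeasurable.mul {f g : Space n → ℂ} (hf : BddMeasurable f) (hg : BddMeasurable g) :
    BddMeasurable (f * g) := by
  obtain ⟨C, hC⟩ := hf.bounded
  obtain ⟨D, hD⟩ := hg.bounded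
  refine ⟨hf.measurable.mul hg.measurable, C * D, fun x => ?_⟩
  rw [Pi.mul_apply, norm_mul]
  exact mul_le_mul (hC x) (hD x) (norm_nonneg _) ((norm_nonneg _).trans (hC x))

theorem BddMeasurable.sub {f g : Space n → ℂ} (hf : BddMeasurable f) (hg : BddMeasurable g) :
    BddMeasurable (f - g) := by
  obtain ⟨C, hC⟩ := hf.bounded
  obtain ⟨D, hD⟩ := hg.bounded
  refine ⟨hf.measurable.sub hg.measurable, C + D, fun x => ?_⟩
  exact (norm_sub_le _ _).trans (add_le_add (hC x) (hD x))

theorem BddMeasurable.indicator {s : Set (Space n)} (hs : MeasurableSet s) :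
    BddMeasurable (s.indicator fun _ => (1 : ℂ)) := by
  refine ⟨measurable_const.indicator hs, 1, fun x => ?_⟩
  by_cases hx : x ∈ s <;> simp [hx]

theorem IsSymbol.bddMeasurable {m : Space n → ℂ} (hm : IsSymbol m) : BddMeasurable m :=
  ⟨hm.contDiff.continuous.measurable, hm.bounded.imp fun _ h => h.2⟩

theorem norm_freePhase (t : ℝ) (p : Space n) : ‖freePhase t p‖ = 1 := by
  rw [freePhase, show -(Complex.I * (t : ℂ) * ((‖p‖ ^ 2 : ℝ) : ℂ)) =
    ((-(t * ‖p‖ ^ 2) : ℝ) : ℂ) * Complex.I by push_cast; ring, Complex.norm_exp_ofReal_mul_I]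

theorem freePhase_bddMeasurable (t : ℝ) : BddMeasurable (freePhase t : Space n → ℂ) :=
  ⟨(freePhase_hasTemperateGrowth t).1.continuous.measurable, 1, fun p => (norm_freePhase t p).le⟩

theorem mulOp_eq_of_ae {m : Space n → ℂ} {f g : L2 n}
    (h : (g : Space n → ℂ) =ᵐ[volume] fun x => m x * f x) : mulOp m f = g := by
  have hm : MemLp (fun x => m x * f x) 2 (volume : Measure (Space n)) :=
    (memLp_congr_ae h).1 (Lp.memLp g)
  rw [mulOp, dif_pos hm]
  exact Lp.ext (hm.coeFn_toLp.trans h.symm)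

/-- Multiplication by an essentially bounded function, as a linear map on `L²`. -/
def mulLin (m : Space n → ℂ) (hm : MemLp m ⊤ (volume : Measure (Space n))) : L2 n →ₗ[ℂ] L2 n where
  toFun := mulOp m
  map_add' f g := by
    apply mulOp_eq_of_ae
    filter_upwards [mulOp_coeFn hm f, mulOp_coeFn hm g, Lp.coeFn_add f g,
      Lp.coeFn_add (mulOp m f) (mulOp m g)] with x h1 h2 h3 h4
    rw [h4, Pi.add_apply, h1, h2, h3, Pi.add_apply, mul_add]
  map_smul' c f := by
    apply mulOp_eq_of_ae
    filter_upwards [mulOp_coeFn hm f, Lp.coeFn_smul c f,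
      Lp.coeFn_smul c (mulOp m f)] with x h1 h3 h4
    rw [RingHom.id_apply, h4, Pi.smul_apply, h1, h3, Pi.smul_apply, smul_eq_mul, smul_eq_mul]
    ring

theorem norm_mulOp_le {m : Space n → ℂ} (hm : MemLp m ⊤ (volume : Measure (Space n))) {C : ℝ}
    (hC : ∀ᵐ x, ‖m x‖ ≤ C) (f : L2 n) : ‖mulOp m f‖ ≤ C * ‖f‖ := by
  apply Lp.norm_le_mul_norm_of_ae_le_mul
  filter_upwards [mulOp_coeFn hm f, hC] with x h1 h2
  rw [h1, norm_mul]
  exact mul_le_mul_of_nonneg_right h2 (norm_nonneg _)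

/-- Multiplication by a bounded measurable function, as a bounded operator on `L²`. -/
def mulCLM (m : Space n → ℂ) (hm : BddMeasurable m) : L2 n →L[ℂ] L2 n :=
  (mulLin m hm.memLp).mkContinuous hm.bounded.choose
    fun f => norm_mulOp_le hm.memLp (ae_of_all _ hm.bounded.choose_spec) f

theorem mulCLM_apply {m : Space n → ℂ} (hm : BddMeasurable m) (f : L2 n) :
    mulCLM m hm f = mulOp m f := rfl

theorem mulOp_mulOp {m m' : Space n → ℂ} (hm : BddMeasurable m) (hm' : BddMeasurable m')
    (f : L2 n) : mulOp m (mulOp m' f) = mulOp (m * m') f := by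
  apply mulOp_eq_of_ae
  filter_upwards [mulOp_coeFn hm'.memLp f, mulOp_coeFn (hm.mul hm').memLp f] with x h1 h2
  rw [h2, h1, Pi.mul_apply, mul_assoc]

theorem mulOp_one (f : L2 n) : mulOp (fun _ => 1) f = f := by
  apply mulOp_eq_of_ae
  simp

theorem mulOp_sub_left {m m' : Space n → ℂ} (hm : BddMeasurable m) (hm' : BddMeasurable m')
    (f : L2 n) : mulOp (m - m') f = mulOp m f - mulOp m' f := by
  apply mulOp_eq_of_ae
  filter_upwards [mulOp_coeFn hm.memLp f, mulOp_coeFn hm'.memLp f,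
    Lp.coeFn_sub (mulOp m f) (mulOp m' f)] with x h1 h2 h3
  rw [h3, Pi.sub_apply, h1, h2, Pi.sub_apply, sub_mul]

theorem inner_mulOp {m : Space n → ℂ} (hm : BddMeasurable m)
    (hc : BddMeasurable fun x => star (m x)) (f g : L2 n) :
    inner ℂ f (mulOp m g) = inner ℂ (mulOp (fun x => star (m x)) f) g := by
  rw [L2.inner_def, L2.inner_def]
  apply integral_congr_ae
  filter_upwards [mulOp_coeFn hm.memLp g, mulOp_coeFn hc.memLp f] with x h1 h2
  rw [h1, h2]
  simp only [RCLike.inner_apply', Complex.star_def, map_mul, Complex.conj_conj]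
  ring

theorem mulOp_toLp {m : Space n → ℂ} (hm : m.HasTemperateGrowth) (g : 𝓢(Space n, ℂ)) :
    mulOp m (g.toLp 2) = (mulS m g).toLp 2 := by
  apply mulOp_eq_of_ae
  filter_upwards [(mulS m g).coeFn_toLp 2, g.coeFn_toLp 2] with x h1 h2
  rw [h1, h2, mulS_apply hm]

theorem momentumOp_eq (m : Space n → ℂ) (f : L2 n) :
    momentumOp m f = 𝓕⁻ (mulOp (dilate (2 * Real.pi) m) (𝓕 f)) := rfl

theorem momentumOp_toLp {m : Space n → ℂ} (hm : m.HasTemperateGrowth) (g : 𝓢(Space n, ℂ)) :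
    momentumOp m (g.toLp 2) = (momS m g).toLp 2 := by
  rw [momentumOp_eq, SchwartzMap.toLp_fourier_eq, mulOp_toLp (dilate_hasTemperateGrowth hm _),
    SchwartzMap.toLp_fourierInv_eq]
  rfl

/-- The multiplier `m(P)`, as a bounded operator on `L²`. -/
def momCLM (m : Space n → ℂ) (hm : BddMeasurable m) : L2 n →L[ℂ] L2 n :=
  ((Lp.fourierTransformₗᵢ (Space n) ℂ).symm.toContinuousLinearEquiv : L2 n →L[ℂ] L2 n) ∘L
    mulCLM _ (hm.dilate (2 * Real.pi)) ∘L
    ((Lp.fourierTransformₗᵢ (Space n) ℂ).toContinuousLinearEquiv : L2 n →L[ℂ] L2 n)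

theorem momCLM_apply {m : Space n → ℂ} (hm : BddMeasurable m) (f : L2 n) :
    momCLM m hm f = momentumOp m f := rfl

theorem fourier_momentumOp (m : Space n → ℂ) (f : L2 n) :
    𝓕 (momentumOp m f) = mulOp (dilate (2 * Real.pi) m) (𝓕 f) := by
  rw [momentumOp_eq, FourierTransform.fourier_fourierInv_eq]

theorem norm_momentumOp_le {m : Space n → ℂ} (hm : BddMeasurable m) {C : ℝ}
    (hC : ∀ x, ‖m x‖ ≤ C) (f : L2 n) : ‖momentumOp m f‖ ≤ C * ‖f‖ := by
  rw [← Lp.norm_fourier_eq (momentumOp m f), fourier_momentumOp, ← Lp.norm_fourier_eq f]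
  exact norm_mulOp_le (hm.dilate _).memLp (ae_of_all _ fun x => hC _) _

theorem momentumOp_momentumOp {m m' : Space n → ℂ} (hm : BddMeasurable m)
    (hm' : BddMeasurable m') (f : L2 n) :
    momentumOp m (momentumOp m' f) = momentumOp (m * m') f := by
  rw [momentumOp_eq m, fourier_momentumOp, mulOp_mulOp (hm.dilate _) (hm'.dilate _)]
  rfl

theorem momentumOp_one (f : L2 n) : momentumOp (fun _ => 1) f = f := by
  rw [momentumOp_eq]
  change 𝓕⁻ (mulOp (fun _ => 1) (𝓕 f)) = f
  rw [mulOp_one, FourierTransform.fourierInv_fourier_eq]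

theorem momentumOp_sub_left {m m' : Space n → ℂ} (hm : BddMeasurable m)
    (hm' : BddMeasurable m') (f : L2 n) :
    momentumOp (m - m') f = momentumOp m f - momentumOp m' f := by
  have h := mulOp_sub_left (hm.dilate (2 * Real.pi)) (hm'.dilate (2 * Real.pi)) (𝓕 f)
  apply (Lp.fourierTransformₗᵢ (Space n) ℂ).injective
  rw [map_sub]
  change 𝓕 (momentumOp (m - m') f) = 𝓕 (momentumOp m f) - 𝓕 (momentumOp m' f)
  rw [fourier_momentumOp, fourier_momentumOp, fourier_momentumOp, ← h]
  rfl

theorem inner_momentumOp {m : Space n → ℂ} (hm : BddMeasurable m)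
    (hc : BddMeasurable fun x => star (m x)) (f g : L2 n) :
    inner ℂ f (momentumOp m g) = inner ℂ (momentumOp (fun x => star (m x)) f) g := by
  rw [← Lp.inner_fourier_eq, fourier_momentumOp, inner_mulOp (hm.dilate _) (hc.dilate _),
    ← Lp.inner_fourier_eq (momentumOp _ f), fourier_momentumOp]
  rfl

theorem freeFlow_eq (t : ℝ) (f : L2 n) : freeFlow t f = momentumOp (freePhase t) f := rfl

theorem freePhase_mul (s t : ℝ) :
    (freePhase s * freePhase t : Space n → ℂ) = freePhase (s + t) := by
  ext p
  simp only [freePhase, Pi.mul_apply, ← Complex.exp_add]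
  congr 1
  push_cast
  ring

theorem freeFlow_freeFlow (s t : ℝ) (f : L2 n) :
    freeFlow s (freeFlow t f) = freeFlow (s + t) f := by
  rw [freeFlow_eq, freeFlow_eq, momentumOp_momentumOp (freePhase_bddMeasurable s)
    (freePhase_bddMeasurable t), freePhase_mul, freeFlow_eq]

theorem freeFlow_zero (f : L2 n) : freeFlow 0 f = f := by
  rw [freeFlow_eq]
  convert momentumOp_one f using 2
  ext p
  simp [freePhase]

theorem freeFlow_toLp (t : ℝ) (g : 𝓢(Space n, ℂ)) :
    freeFlow t (g.toLp 2) = (flowS t g).toLp 2 :=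
  momentumOp_toLp (freePhase_hasTemperateGrowth t) g

/-- The free Schrödinger group, as bounded operators. -/
def flowCLM (t : ℝ) : L2 n →L[ℂ] L2 n := momCLM (freePhase t) (freePhase_bddMeasurable t)

theorem flowCLM_apply (t : ℝ) (f : L2 n) : flowCLM t f = freeFlow t f := rfl

theorem norm_freeFlow (t : ℝ) (f : L2 n) : ‖freeFlow t f‖ = ‖f‖ := by
  have h : ∀ (t : ℝ) (f : L2 n), ‖freeFlow t f‖ ≤ ‖f‖ := fun t f => by
    simpa [freeFlow_eq] using
      norm_momentumOp_le (freePhase_bddMeasurable t) (fun p => (norm_freePhase t p).le) f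
  refine le_antisymm (h t f) ?_
  have := h (-t) (freeFlow t f)
  rwa [freeFlow_freeFlow, neg_add_cancel, freeFlow_zero] at this

theorem star_freePhase (t : ℝ) :
    (fun p : Space n => star (freePhase t p)) = freePhase (-t) := by
  ext p
  simp only [freePhase, Complex.star_def, ← Complex.exp_conj]
  congr 1
  simp

theorem inner_freeFlow (t : ℝ) (f g : L2 n) :
    inner ℂ f (freeFlow t g) = inner ℂ (freeFlow (-t) f) g := by
  rw [freeFlow_eq, inner_momentumOp (freePhase_bddMeasurable t), star_freePhase, freeFlow_eq]
  rw [star_freePhase]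
  exact freePhase_bddMeasurable _

theorem momentumOp_freeFlow_comm {m : Space n → ℂ} (hm : BddMeasurable m) (t : ℝ) (f : L2 n) :
    momentumOp m (freeFlow t f) = freeFlow t (momentumOp m f) := by
  rw [freeFlow_eq, freeFlow_eq, momentumOp_momentumOp hm (freePhase_bddMeasurable t),
    momentumOp_momentumOp (freePhase_bddMeasurable t) hm, mul_comm]

/-- Restriction of `f ∈ L²` to a set. -/
def cutOff (s : Set (Space n)) (f : L2 n) : L2 n := mulOp (s.indicator fun _ => (1 : ℂ)) f

/-- Restriction to a measurable set, as a bounded operator. -/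
def cutCLM (s : Set (Space n)) (hs : MeasurableSet s) : L2 n →L[ℂ] L2 n :=
  mulCLM _ (BddMeasurable.indicator hs)

theorem cutCLM_apply {s : Set (Space n)} (hs : MeasurableSet s) (f : L2 n) :
    cutCLM s hs f = cutOff s f := rfl

theorem cutOff_coeFn {s : Set (Space n)} (hs : MeasurableSet s) (f : L2 n) :
    cutOff s f =ᵐ[volume] s.indicator f := by
  filter_upwards [mulOp_coeFn (BddMeasurable.indicator hs).memLp f] with x hx
  rw [cutOff, hx]
  by_cases h : x ∈ s <;> simp [h]

theorem norm_cutOff_le {s : Set (Space n)} (hs : MeasurableSet s) (f : L2 n) :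
    ‖cutOff s f‖ ≤ ‖f‖ := by
  have := norm_mulOp_le (BddMeasurable.indicator hs).memLp (C := 1) (ae_of_all _ fun x => by
    by_cases h : x ∈ s <;> simp [h]) f
  simpa [cutOff] using this

theorem mulOp_eq_cutOff {m : Space n → ℂ} (hm : BddMeasurable m) {s : Set (Space n)}
    (hs : MeasurableSet s) (h : ∀ x, x ∉ s → m x = 0) (f : L2 n) :
    mulOp m (cutOff s f) = mulOp m f := by
  rw [cutOff, mulOp_mulOp hm (BddMeasurable.indicator hs)]
  congr 1
  ext x
  by_cases hx : x ∈ s <;> simp [hx, h]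

/-! ### Restrictions of Schwartz functions to measurable sets -/

/-- The restriction of a Schwartz function to a measurable set, as an element of `L²`. -/
def cutS (s : Set (Space n)) (hs : MeasurableSet s) : 𝓢(Space n, ℂ) →L[ℂ] L2 n :=
  cutCLM s hs ∘L toLpCLM ℂ ℂ 2 volume

theorem cutS_apply {s : Set (Space n)} (hs : MeasurableSet s) (g : 𝓢(Space n, ℂ)) :
    cutS s hs g = cutOff s (g.toLp 2) := rfl

theorem norm_cutS_le {s : Set (Space n)} (hs : MeasurableSet s) (g : 𝓢(Space n, ℂ)) :
    ‖cutS s hs g‖ ≤ ‖g.toLp 2 (volume : Measure (Space n))‖ :=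
  norm_cutOff_le hs _

theorem norm_toLp_mulS_le {f : Space n → ℂ} (hf : f.HasTemperateGrowth) {R : ℝ}
    {g : 𝓢(Space n, ℂ)} (h : ∀ x, g x ≠ 0 → ‖f x‖ ≤ R) :
    ‖(mulS f g).toLp 2 (volume : Measure (Space n))‖ ≤
      R * ‖g.toLp 2 (volume : Measure (Space n))‖ := by
  apply Lp.norm_le_mul_norm_of_ae_le_mul
  filter_upwards [(mulS f g).coeFn_toLp 2, g.coeFn_toLp 2] with x h1 h2
  rw [h1, h2, mulS_apply hf, norm_mul]
  by_cases hx : g x = 0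
  · simp [hx]
  · exact mul_le_mul_of_nonneg_right (h x hx) (norm_nonneg _)

theorem norm_cutS_mulS_le {s : Set (Space n)} (hs : MeasurableSet s) {f : Space n → ℂ}
    (hf : f.HasTemperateGrowth) {R : ℝ} (h : ∀ x ∈ s, ‖f x‖ ≤ R) (g : 𝓢(Space n, ℂ)) :
    ‖cutS s hs (mulS f g)‖ ≤ R * ‖cutS s hs g‖ := by
  apply Lp.norm_le_mul_norm_of_ae_le_mul
  rw [cutS_apply, cutS_apply]
  filter_upwards [cutOff_coeFn hs ((mulS f g).toLp 2), cutOff_coeFn hs (g.toLp 2),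
    (mulS f g).coeFn_toLp 2, g.coeFn_toLp 2] with x h1 h2 h3 h4
  rw [h1, h2]
  by_cases hx : x ∈ s
  · simp only [hx, Set.indicator_of_mem]
    rw [h3, h4, mulS_apply hf, norm_mul]
    exact mul_le_mul_of_nonneg_right (h x hx) (norm_nonneg _)
  · simp [hx]

theorem norm_toLp_momS_le {m : Space n → ℂ} (hm : m.HasTemperateGrowth) {C : ℝ}
    (hC : ∀ x, ‖m x‖ ≤ C) (g : 𝓢(Space n, ℂ)) :
    ‖(momS m g).toLp 2 (volume : Measure (Space n))‖ ≤
      C * ‖g.toLp 2 (volume : Measure (Space n))‖ := by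
  rw [← momentumOp_toLp hm]
  exact norm_momentumOp_le ⟨hm.1.continuous.measurable, C, hC⟩ hC _

theorem norm_toLp_flowS (t : ℝ) (g : 𝓢(Space n, ℂ)) :
    ‖(flowS t g).toLp 2 (volume : Measure (Space n))‖ =
      ‖g.toLp 2 (volume : Measure (Space n))‖ := by
  rw [← freeFlow_toLp, norm_freeFlow]

theorem norm_coord_le (j : Fin n) (x : Space n) : ‖coord j x‖ ≤ ‖x‖ := by
  simpa [coord] using PiLp.norm_apply_le x j

theorem norm_toLp_mulS_coord_le {R : ℝ} {g : 𝓢(Space n, ℂ)} (hg : ∀ x, R < ‖x‖ → g x = 0)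
    (j : Fin n) :
    ‖(mulS (coord j) g).toLp 2 (volume : Measure (Space n))‖ ≤
      R * ‖g.toLp 2 (volume : Measure (Space n))‖ :=
  norm_toLp_mulS_le (coord_hasTemperateGrowth j) fun x hx =>
    (norm_coord_le j x).trans (not_lt.1 fun h => hx (hg x h))

theorem mulS_coord_support {R : ℝ} {g : 𝓢(Space n, ℂ)} (hg : ∀ x, R < ‖x‖ → g x = 0)
    (j : Fin n) (x : Space n) (hx : R < ‖x‖) : mulS (coord j) g x = 0 := by
  rw [mulS_apply (coord_hasTemperateGrowth j), hg x hx, mul_zero]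

/-- The decomposition `m(sp) = ∑ⱼ s pⱼ (divCoord j m)(sp)`, which extracts one factor of `sp`. -/
theorem IsSymbol.dilate_eq_sum {m : Space n → ℂ} (hm : IsSymbol m) (s : ℝ) :
    dilate s m = fun p => ∑ j, (s : ℂ) * (coord j * dilate s (FreeChannel.divCoord j m)) p := by
  ext p
  rw [dilate, ← hm.sum_coord_mul_divCoord]
  refine Finset.sum_congr rfl fun j _ => ?_
  simp [coord, dilate]
  ring

theorem momS_dilate_mulS_coord {m : Space n → ℂ} (hm : m.HasTemperateGrowth) (s : ℝ)
    (j : Fin n) (g : 𝓢(Space n, ℂ)) :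
    momS (dilate s m) (mulS (coord j) g) = mulS (coord j) (momS (dilate s m) g) -
      (Complex.I * s) • momS (dilate s (partialDeriv j m)) g := by
  rw [momS_mulS_coord (dilate_hasTemperateGrowth hm s),
    partialDeriv_dilate (hm.1.differentiable (by simp)),
    momS_const_mul (dilate_hasTemperateGrowth (partialDeriv_hasTemperateGrowth hm j) s), smul_smul]

/-! ### Waves of minimal velocity leave bounded regions -/

/-- One step of non-stationary phase in operator form: on `e^{iuH₀} g`, the factor `2u Pⱼ` extracted
from `m(sP)` is the difference of `e^{iuH₀} xⱼ` and `xⱼ e^{iuH₀}`, up to a commutator of `xⱼ` with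
the remaining multiplier. -/
theorem momS_flowS_identity {m : Space n → ℂ} (hm : IsSymbol m) (s u : ℝ) (g : 𝓢(Space n, ℂ)) :
    (2 * u : ℂ) • momS (dilate s m) (flowS (-u) g) = ∑ j, (s : ℂ) •
      (momS (dilate s (divCoord j m)) (flowS (-u) (mulS (coord j) g)) -
        mulS (coord j) (momS (dilate s (divCoord j m)) (flowS (-u) g)) +
        (Complex.I * s) • momS (dilate s (partialDeriv j (divCoord j m))) (flowS (-u) g)) := by
  have hd := fun j : Fin n => dilate_hasTemperateGrowth (hm.divCoord j).hasTemperateGrowth s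
  have hc := fun j : Fin n => coord_hasTemperateGrowth (n := n) j
  rw [hm.dilate_eq_sum, momS_sum (f := fun j p => (s : ℂ) * (coord j * dilate s (divCoord j m)) p)
    (fun j _ => (Function.HasTemperateGrowth.const (s : ℂ)).mul ((hc j).mul (hd j))),
    Finset.smul_sum]
  refine Finset.sum_congr rfl fun j _ => ?_
  rw [momS_const_mul ((hc j).mul (hd j)), mul_comm (coord j), ← momS_momS (hd j) (hc j),
    flowS_mulS_coord, map_sub, map_smul,
    momS_dilate_mulS_coord (hm.divCoord j).hasTemperateGrowth]
  push_cast
  module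

/-- Iterating `momS_flowS_identity`, each step gains a factor `s (r + R + s) / u`. -/
theorem norm_cutS_momS_flowS_le (N : ℕ) : ∀ m : Space n → ℂ, IsSymbol m →
    ∃ C : ℝ, 0 ≤ C ∧ ∀ s u r R : ℝ, 0 ≤ s → 0 < u → 0 ≤ r → 0 ≤ R → ∀ g : 𝓢(Space n, ℂ),
      (∀ x, R < ‖x‖ → g x = 0) →
      ‖cutS (closedBall 0 r) measurableSet_closedBall (momS (dilate s m) (flowS (-u) g))‖ ≤
        C * (s * (r + R + s) / u) ^ N * ‖g.toLp 2 (volume : Measure (Space n))‖ := by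
  induction N with
  | zero =>
    intro m hm
    obtain ⟨C, hC0, hC⟩ := hm.bounded
    refine ⟨C, hC0, fun s u r R hs hu hr hR g hg => ?_⟩
    refine (norm_cutS_le _ _).trans ?_
    rw [pow_zero, mul_one, ← norm_toLp_flowS (-u) g]
    exact norm_toLp_momS_le (dilate_hasTemperateGrowth hm.hasTemperateGrowth s) (fun x => hC _) _
  | succ N ih =>
    intro m hm
    choose C hC0 hC using fun j => ih _ (hm.divCoord j)
    choose D hD0 hD using fun j => ih _ ((hm.divCoord j).partialDeriv j)
    refine ⟨∑ j, (C j + D j), Finset.sum_nonneg fun j _ => add_nonneg (hC0 j) (hD0 j),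
      fun s u r R hs hu hr hR g hg => ?_⟩
    set S := cutS (closedBall (0 : Space n) r) measurableSet_closedBall
    set G := ‖g.toLp 2 (volume : Measure (Space n))‖
    have hG : 0 ≤ G := norm_nonneg _
    set Γ := s * (r + R + s) / u with hΓ
    have hΓ0 : 0 ≤ Γ := by positivity
    have hterm : ∀ j, ‖S ((s : ℂ) •
      (momS (dilate s (divCoord j m)) (flowS (-u) (mulS (coord j) g)) -
        mulS (coord j) (momS (dilate s (divCoord j m)) (flowS (-u) g)) +
        (Complex.I * s) • momS (dilate s (partialDeriv j (divCoord j m))) (flowS (-u) g)))‖ ≤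
        (C j + D j) * (u * Γ) * (Γ ^ N * G) := by
      intro j
      have h1 := (hC j s u r R hs hu hr hR _ (mulS_coord_support hg j)).trans
        (mul_le_mul_of_nonneg_left (norm_toLp_mulS_coord_le hg j)
          (mul_nonneg (hC0 j) (pow_nonneg hΓ0 N)))
      have h2 := (norm_cutS_mulS_le (s := closedBall (0 : Space n) r) measurableSet_closedBall
        (coord_hasTemperateGrowth j) (R := r)
        (fun x hx => (norm_coord_le j x).trans (by simpa using hx))
        (momS (dilate s (divCoord j m)) (flowS (-u) g))).trans
        (mul_le_mul_of_nonneg_left (hC j s u r R hs hu hr hR _ hg) hr)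
      have h3 := hD j s u r R hs hu hr hR _ hg
      rw [map_smul, map_add, map_sub, map_smul, norm_smul, Complex.norm_real,
        Real.norm_of_nonneg hs]
      have h4 := norm_add₃_le
        (a := S (momS (dilate s (divCoord j m)) (flowS (-u) (mulS (coord j) g))))
        (b := -S (mulS (coord j) (momS (dilate s (divCoord j m)) (flowS (-u) g))))
        (c := (Complex.I * s) •
          S (momS (dilate s (partialDeriv j (divCoord j m))) (flowS (-u) g)))
      rw [norm_neg, norm_smul, norm_mul, Complex.norm_I, one_mul, Complex.norm_real,
        Real.norm_of_nonneg hs, ← sub_eq_add_neg] at h4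
      have h5 := mul_le_mul_of_nonneg_left h3 hs
      have huΓ : u * Γ = s * (r + R + s) := by rw [hΓ]; field_simp
      rw [huΓ]
      have hE : 0 ≤ Γ ^ N * G := by positivity
      calc s * _ ≤ s * (C j * Γ ^ N * (R * G) + r * (C j * Γ ^ N * G) + s * (D j * Γ ^ N * G)) := by
            gcongr
            exact h4.trans (add_le_add (add_le_add h1 h2) h5)
        _ = (s * ((R + r) * C j + s * D j)) * (Γ ^ N * G) := by ring
        _ ≤ ((C j + D j) * (s * (r + R + s))) * (Γ ^ N * G) := by
            refine mul_le_mul_of_nonneg_right ?_ hE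
            have := mul_nonneg hs (mul_nonneg hs (hC0 j))
            have := mul_nonneg hs (mul_nonneg (add_nonneg hr hR) (hD0 j))
            nlinarith
    have key := congrArg S (momS_flowS_identity hm s u g)
    rw [map_smul, map_sum] at key
    have h6 : (2 * u) * ‖S (momS (dilate s m) (flowS (-u) g))‖ ≤
        ∑ j, (C j + D j) * (u * Γ) * (Γ ^ N * G) := by
      have : ‖(2 * u : ℂ)‖ = 2 * u := by simp [abs_of_pos hu]
      rw [← this, ← norm_smul, key]
      exact norm_sum_le_of_le _ fun j _ => hterm j
    rw [← Finset.sum_mul, ← Finset.sum_mul] at h6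
    have h7 : 0 ≤ u * ‖S (momS (dilate s m) (flowS (-u) g))‖ := by positivity
    refine le_of_mul_le_mul_left ?_ hu
    calc u * ‖S (momS (dilate s m) (flowS (-u) g))‖
        ≤ (2 * u) * ‖S (momS (dilate s m) (flowS (-u) g))‖ := by linarith
      _ ≤ _ := h6
      _ = _ := by ring

/-! ### Waves of maximal velocity stay in bounded regions -/

/-- A smooth compactly supported symbol. -/
structure IsCompactSymbol (m : Space n → ℂ) : Prop where
  contDiff : ContDiff ℝ (⊤ : ℕ∞) m
  compact : HasCompactSupport m

theorem IsCompactSymbol.hasTemperateGrowth {m : Space n → ℂ} (hm : IsCompactSymbol m) :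
    m.HasTemperateGrowth :=
  hm.compact.hasTemperateGrowth hm.contDiff

theorem IsCompactSymbol.bounded {m : Space n → ℂ} (hm : IsCompactSymbol m) :
    ∃ C : ℝ, 0 ≤ C ∧ ∀ p, ‖m p‖ ≤ C := by
  obtain ⟨C, hC⟩ := hm.contDiff.continuous.bounded_above_of_compact_support hm.compact
  exact ⟨C, (norm_nonneg _).trans (hC 0), hC⟩

theorem IsCompactSymbol.partialDeriv {m : Space n → ℂ} (hm : IsCompactSymbol m) (j : Fin n) :
    IsCompactSymbol (partialDeriv j m) :=
  ⟨(partialDeriv_hasTemperateGrowth hm.hasTemperateGrowth j).1, hm.compact.fderiv_apply ℝ _⟩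

theorem IsCompactSymbol.coord_mul {m : Space n → ℂ} (hm : IsCompactSymbol m) (j : Fin n) :
    IsCompactSymbol (coord j * m) :=
  ⟨(coord_hasTemperateGrowth j).1.mul hm.contDiff, hm.compact.mul_left⟩

theorem measurableSet_lt_norm (r : ℝ) : MeasurableSet {x : Space n | r < ‖x‖} :=
  measurableSet_lt measurable_const measurable_norm

/-- Outside the ball of radius `r`, the norm of `g` is controlled by the norms of the `xⱼ g / r`. -/
theorem mul_norm_cutS_le_sum {r : ℝ} (hr : 0 < r) (g : 𝓢(Space n, ℂ)) :
    r * ‖cutS {x : Space n | r < ‖x‖} (measurableSet_lt_norm r) g‖ ≤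
      ∑ j, ‖cutS {x : Space n | r < ‖x‖} (measurableSet_lt_norm r) (mulS (coord j) g)‖ := by
  set s := {x : Space n | r < ‖x‖} with hs
  have hsm : MeasurableSet s := measurableSet_lt_norm r
  -- on this set `1 = ∑ⱼ bⱼ xⱼ` with `bⱼ = xⱼ / |x|²` bounded by `1 / r`
  set b : Fin n → Space n → ℂ := fun j => s.indicator fun x =>
    coord j x * (((‖x‖ ^ 2)⁻¹ : ℝ) : ℂ) with hb
  have hbb : ∀ j x, ‖b j x‖ ≤ r⁻¹ := by
    intro j x
    by_cases hx : x ∈ s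
    · have hx' : r < ‖x‖ := hx
      have hx0 : 0 < ‖x‖ := hr.trans hx'
      simp only [hb, hx, Set.indicator_of_mem, norm_mul, Complex.norm_real, norm_inv, norm_pow,
        norm_norm]
      calc ‖coord j x‖ * (‖x‖ ^ 2)⁻¹ ≤ ‖x‖ * (‖x‖ ^ 2)⁻¹ := by gcongr; exact norm_coord_le j x
        _ = ‖x‖⁻¹ := by field_simp
        _ ≤ r⁻¹ := by gcongr
    · simp [hb, hx, hr.le]
  have hbm : ∀ j, BddMeasurable (b j) := fun j =>
    ⟨((coord_hasTemperateGrowth j).1.continuous.measurable.mul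
      (Complex.measurable_ofReal.comp ((measurable_norm.pow_const 2).inv))).indicator hsm,
      r⁻¹, hbb j⟩
  have hsum : cutS s hsm g = ∑ j, mulCLM (b j) (hbm j) (cutS s hsm (mulS (coord j) g)) := by
    have hterm : ∀ j, mulCLM (b j) (hbm j) (cutS s hsm (mulS (coord j) g)) =
        mulOp (b j) ((mulS (coord j) g).toLp 2) := fun j => by
      rw [mulCLM_apply, cutS_apply]
      exact mulOp_eq_cutOff (hbm j) hsm (fun x hx => by simp [hb, hx]) _
    simp only [hterm]
    apply Lp.ext
    have h1 : ∀ᵐ x ∂(volume : Measure (Space n)), ∀ j,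
        mulOp (b j) ((mulS (coord j) g).toLp 2) x = b j x * (coord j x * g x) := by
      rw [ae_all_iff]
      intro j
      filter_upwards [mulOp_coeFn (hbm j).memLp ((mulS (coord j) g).toLp 2),
        (mulS (coord j) g).coeFn_toLp 2] with x h1 h2
      rw [h1, h2, mulS_apply (coord_hasTemperateGrowth j)]
    rw [cutS_apply]
    filter_upwards [h1, cutOff_coeFn hsm (g.toLp 2), g.coeFn_toLp 2,
      Lp.coeFn_finsetSum Finset.univ (fun j => mulOp (b j) ((mulS (coord j) g).toLp 2))]
      with x h1 h2 h3 h4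
    rw [h4, h2, Finset.sum_apply]
    simp only [h1]
    by_cases hx : x ∈ s
    · have hx0 : 0 < ‖x‖ := hr.trans hx
      simp only [hb, hx, Set.indicator_of_mem]
      have h5 : ∑ j, coord j x * coord j x = ((‖x‖ ^ 2 : ℝ) : ℂ) := by
        rw [EuclideanSpace.real_norm_sq_eq]
        simp [coord, sq]
      have h6 : ((‖x‖ ^ 2 : ℝ) : ℂ) ≠ 0 := by
        exact_mod_cast (pow_pos hx0 2).ne'
      rw [h3]
      calc g x = (∑ j, coord j x * coord j x) * ((((‖x‖ ^ 2)⁻¹ : ℝ) : ℂ) * g x) := by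
            rw [h5, Complex.ofReal_inv, ← mul_assoc, mul_inv_cancel₀ h6, one_mul]
        _ = _ := by
          rw [Finset.sum_mul]
          exact Finset.sum_congr rfl fun j _ => by ring
    · simp [hb, hx]
  calc r * ‖cutS s hsm g‖ ≤ r * ∑ j, r⁻¹ * ‖cutS s hsm (mulS (coord j) g)‖ := by
        refine mul_le_mul_of_nonneg_left ?_ hr.le
        conv_lhs => rw [hsum]
        exact norm_sum_le_of_le _ fun j _ =>
          norm_mulOp_le (hbm j).memLp (ae_of_all _ (hbb j)) _
    _ = _ := by
        rw [← Finset.mul_sum, ← mul_assoc, mul_inv_cancel₀ hr.ne', one_mul]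

/-- The position `xⱼ` passes through `m(sP) e^{-iaH₀}` up to the displacement `2aPⱼ`, bounded on the
compact momentum support, and a commutator of order `s`. -/
theorem mulS_coord_momS_flowS {m : Space n → ℂ} (hm : IsCompactSymbol m) {s : ℝ} (hs : s ≠ 0)
    (a : ℝ) (j : Fin n) (g : 𝓢(Space n, ℂ)) :
    mulS (coord j) (momS (dilate s m) (flowS a g)) =
      momS (dilate s m) (flowS a (mulS (coord j) g)) +
      (Complex.I * s) • momS (dilate s (partialDeriv j m)) (flowS a g) +
      ((2 * a / s : ℝ) : ℂ) • momS (dilate s (coord j * m)) (flowS a g) := by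
  have hd := dilate_hasTemperateGrowth hm.hasTemperateGrowth s
  have hc := coord_hasTemperateGrowth (n := n) j
  have e : dilate s (coord j * m) = fun p => (s : ℂ) * (dilate s m * coord j) p := by
    ext p
    simp [dilate, coord]
    ring
  rw [e, momS_const_mul (hd.mul hc), ← momS_momS hd hc, flowS_mulS_coord, map_sub, map_smul,
    momS_dilate_mulS_coord hm.hasTemperateGrowth, smul_smul]
  have : ((2 * a / s : ℝ) : ℂ) * s = 2 * a := by
    have : (s : ℂ) ≠ 0 := by exact_mod_cast hs
    push_cast
    field_simp
  rw [this]
  module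

/-- Iterating `mulS_coord_momS_flowS`, each step gains a factor `(R + s + 2a/s) / r`. -/
theorem norm_cutS_momS_compact_le (N : ℕ) : ∀ m : Space n → ℂ, IsCompactSymbol m →
    ∃ C : ℝ, 0 ≤ C ∧ ∀ s a r R : ℝ, 0 < s → 0 ≤ a → 0 < r → 0 ≤ R → ∀ g : 𝓢(Space n, ℂ),
      (∀ x, R < ‖x‖ → g x = 0) →
      ‖cutS {x | r < ‖x‖} (measurableSet_lt_norm r) (momS (dilate s m) (flowS a g))‖ ≤
        C * ((R + s + 2 * a / s) / r) ^ N * ‖g.toLp 2 (volume : Measure (Space n))‖ := by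
  induction N with
  | zero =>
    intro m hm
    obtain ⟨C, hC0, hC⟩ := hm.bounded
    refine ⟨C, hC0, fun s a r R hs ha hr hR g hg => ?_⟩
    refine (norm_cutS_le _ _).trans ?_
    rw [pow_zero, mul_one, ← norm_toLp_flowS a g]
    exact norm_toLp_momS_le (dilate_hasTemperateGrowth hm.hasTemperateGrowth s) (fun x => hC _) _
  | succ N ih =>
    intro m hm
    obtain ⟨C, hC0, hC⟩ := ih m hm
    choose D hD0 hD using fun j => ih _ (hm.partialDeriv j)
    choose E hE0 hE using fun j => ih _ (hm.coord_mul j)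
    refine ⟨∑ j, (C + D j + E j), Finset.sum_nonneg fun j _ => by
      have := hD0 j; have := hE0 j; positivity, fun s a r R hs ha hr hR g hg => ?_⟩
    set S := cutS {x : Space n | r < ‖x‖} (measurableSet_lt_norm r)
    set G := ‖g.toLp 2 (volume : Measure (Space n))‖
    have hG : 0 ≤ G := norm_nonneg _
    set Γ := (R + s + 2 * a / s) / r with hΓ
    have hΓ0 : 0 ≤ Γ := by positivity
    have has : 0 ≤ 2 * a / s := by positivity
    have hterm : ∀ j, ‖S (mulS (coord j) (momS (dilate s m) (flowS a g)))‖ ≤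
        (C + D j + E j) * (r * Γ) * (Γ ^ N * G) := by
      intro j
      have h1 := (hC s a r R hs ha hr hR _ (mulS_coord_support hg j)).trans
        (mul_le_mul_of_nonneg_left (norm_toLp_mulS_coord_le hg j)
          (mul_nonneg hC0 (pow_nonneg hΓ0 N)))
      have h2 := mul_le_mul_of_nonneg_left (hD j s a r R hs ha hr hR _ hg) hs.le
      have h3 := mul_le_mul_of_nonneg_left (hE j s a r R hs ha hr hR _ hg) has
      rw [mulS_coord_momS_flowS hm hs.ne', map_add, map_add, map_smul, map_smul]
      refine norm_add₃_le.trans ?_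
      rw [norm_smul, norm_smul, norm_mul, Complex.norm_I, one_mul, Complex.norm_real,
        Complex.norm_real, Real.norm_of_nonneg hs.le, Real.norm_of_nonneg has]
      refine (add_le_add (add_le_add h1 h2) h3).trans ?_
      have hrΓ : r * Γ = R + s + 2 * a / s := by rw [hΓ]; field_simp
      rw [hrΓ]
      have hQ : 0 ≤ Γ ^ N * G := by positivity
      calc _ = (C * R + s * D j + 2 * a / s * E j) * (Γ ^ N * G) := by ring
        _ ≤ _ := by
          refine mul_le_mul_of_nonneg_right ?_ hQ
          have := hD0 j
          have := hE0 j
          have : 0 ≤ C * (s + 2 * a / s) + D j * (R + 2 * a / s) + E j * (R + s) := by positivity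
          linarith
    have h6 : r * ‖S (momS (dilate s m) (flowS a g))‖ ≤
        ∑ j, (C + D j + E j) * (r * Γ) * (Γ ^ N * G) :=
      (mul_norm_cutS_le_sum hr _).trans (Finset.sum_le_sum fun j _ => hterm j)
    rw [← Finset.sum_mul, ← Finset.sum_mul] at h6
    refine le_of_mul_le_mul_left ?_ hr
    refine h6.trans (le_of_eq ?_)
    ring

/-! ### Waves crossing the exterior of a ball in both directions of time -/

/-- The operator `e^{iaH₀} f(kx) m(sP) e^{ia'H₀}`. -/
def crossS (f m : Space n → ℂ) (k s a a' : ℝ) (g : 𝓢(Space n, ℂ)) : 𝓢(Space n, ℂ) :=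
  flowS (-a) (mulS (dilate k f) (momS (dilate s m) (flowS (-a') g)))

/-- The identity `(a + a') x = a' (x - 2aP) + a (x + 2a'P)` along a free wave, where `x` comes from
a factor of `f(kx)`: `x - 2aP` becomes the position at the earlier time, on the left of `crossS`,
and `x + 2a'P` the position at the later time, on its right. The other two terms are commutators. -/
theorem crossS_identity {f m : Space n → ℂ} (hf : IsSymbol f) (hm : IsSymbol m)
    (k s a a' : ℝ) (g : 𝓢(Space n, ℂ)) :
    ((a + a' : ℝ) : ℂ) • crossS f m k s a a' g = ∑ j, (k : ℂ) •
      ((a' : ℂ) • mulS (coord j) (crossS (divCoord j f) m k s a a' g) +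
        (a : ℂ) • crossS (divCoord j f) m k s a a' (mulS (coord j) g) +
        (Complex.I * (a * s)) • crossS (divCoord j f) (partialDeriv j m) k s a a' g -
        (Complex.I * (2 * a * a' * k)) •
          crossS (partialDeriv j (divCoord j f)) m k s a a' g) := by
  have hd := fun j : Fin n => dilate_hasTemperateGrowth (hf.divCoord j).hasTemperateGrowth k
  have hc := fun j : Fin n => coord_hasTemperateGrowth (n := n) j
  have hmd := dilate_hasTemperateGrowth hm.hasTemperateGrowth s
  conv_lhs => rw [crossS, hf.dilate_eq_sum,
    mulS_sum (f := fun j p => (k : ℂ) * (coord j * dilate k (divCoord j f)) p)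
    (fun j _ => (Function.HasTemperateGrowth.const (k : ℂ)).mul ((hc j).mul (hd j))),
    map_sum, Finset.smul_sum]
  refine Finset.sum_congr rfl fun j _ => ?_
  have hpd := dilate_hasTemperateGrowth
    (partialDeriv_hasTemperateGrowth (hf.divCoord j).hasTemperateGrowth j) k
  have hcomm := momS_coord_mulS (hd j) j (momS (dilate s m) (flowS (-a') g))
  rw [partialDeriv_dilate ((hf.divCoord j).contDiff.differentiable (by simp)),
    mulS_const_mul hpd] at hcomm
  have hfl := flowS_mulS_coord (-a) j
    (mulS (dilate k (divCoord j f)) (momS (dilate s m) (flowS (-a') g)))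
  have hPf : ∀ h, momS (coord j) (flowS (-a) h) = flowS (-a) (momS (coord j) h) := fun h =>
    momS_comm (hc j) (freePhase_hasTemperateGrowth _) h
  rw [hPf, hcomm, map_sub, map_smul, map_smul] at hfl
  rw [mulS_const_mul ((hc j).mul (hd j)), map_smul, ← mulS_mulS (hc j) (hd j), hfl]
  have hx : mulS (dilate k (divCoord j f))
      (momS (dilate s m) (flowS (-a') (mulS (coord j) g))) =
      mulS (coord j) (mulS (dilate k (divCoord j f)) (momS (dilate s m) (flowS (-a') g))) -
      (Complex.I * s) • mulS (dilate k (divCoord j f))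
        (momS (dilate s (partialDeriv j m)) (flowS (-a') g)) +
      (2 * a' : ℂ) • mulS (dilate k (divCoord j f))
        (momS (coord j) (momS (dilate s m) (flowS (-a') g))) := by
    rw [flowS_mulS_coord, map_sub, map_smul, momS_dilate_mulS_coord hm.hasTemperateGrowth,
      momS_comm hmd (hc j), map_sub, map_sub, map_smul, map_smul, mulS_mulS (hd j) (hc j),
      mulS_mulS (hc j) (hd j), mul_comm (coord j)]
    push_cast
    module
  simp only [crossS]
  rw [hx, map_add, map_sub, map_smul, map_smul, hfl]
  push_cast
  module

/-- Iterating `crossS_identity`, each step gains the factor in the bracket. -/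
theorem norm_cutS_crossS_le (N : ℕ) : ∀ f m : Space n → ℂ, IsSymbol f → IsSymbol m →
    ∃ C : ℝ, 0 ≤ C ∧ ∀ k s a a' r R : ℝ, 0 ≤ k → 0 ≤ s → 0 ≤ a → 0 ≤ a' → 0 < a + a' →
      0 ≤ r → 0 ≤ R → ∀ g : 𝓢(Space n, ℂ), (∀ x, R < ‖x‖ → g x = 0) →
      ‖cutS (closedBall 0 r) measurableSet_closedBall (crossS f m k s a a' g)‖ ≤
        C * (k * (a' * r + a * (R + s) + 2 * a * a' * k) / (a + a')) ^ N *
          ‖g.toLp 2 (volume : Measure (Space n))‖ := by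
  induction N with
  | zero =>
    intro f m hf hm
    obtain ⟨C, hC0, hC⟩ := hf.bounded
    obtain ⟨D, hD0, hD⟩ := hm.bounded
    refine ⟨C * D, mul_nonneg hC0 hD0, fun k s a a' r R hk hs ha ha' haa hr hR g hg => ?_⟩
    refine (norm_cutS_le _ _).trans ?_
    rw [pow_zero, mul_one, crossS, norm_toLp_flowS, mul_assoc, ← norm_toLp_flowS (-a') g]
    refine (norm_toLp_mulS_le (dilate_hasTemperateGrowth hf.hasTemperateGrowth k)
      (fun x _ => hC _)).trans (mul_le_mul_of_nonneg_left ?_ hC0)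
    exact norm_toLp_momS_le (dilate_hasTemperateGrowth hm.hasTemperateGrowth s) (fun x => hD _) _
  | succ N ih =>
    intro f m hf hm
    choose C hC0 hC using fun j => ih _ m (hf.divCoord j) hm
    choose D hD0 hD using fun j => ih _ _ (hf.divCoord j) (hm.partialDeriv j)
    choose E hE0 hE using fun j => ih _ m ((hf.divCoord j).partialDeriv j) hm
    refine ⟨∑ j, (C j + D j + E j), Finset.sum_nonneg fun j _ => by
      have := hC0 j; have := hD0 j; have := hE0 j; positivity,
      fun k s a a' r R hk hs ha ha' haa hr hR g hg => ?_⟩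
    set S := cutS (closedBall (0 : Space n) r) measurableSet_closedBall
    set G := ‖g.toLp 2 (volume : Measure (Space n))‖
    have hG : 0 ≤ G := norm_nonneg _
    set Γ := k * (a' * r + a * (R + s) + 2 * a * a' * k) / (a + a') with hΓ
    have hΓ0 : 0 ≤ Γ := by positivity
    have hterm : ∀ j, ‖S ((k : ℂ) •
      ((a' : ℂ) • mulS (coord j) (crossS (divCoord j f) m k s a a' g) +
        (a : ℂ) • crossS (divCoord j f) m k s a a' (mulS (coord j) g) +
        (Complex.I * (a * s)) • crossS (divCoord j f) (partialDeriv j m) k s a a' g -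
        (Complex.I * (2 * a * a' * k)) •
          crossS (partialDeriv j (divCoord j f)) m k s a a' g))‖ ≤
        (C j + D j + E j) * ((a + a') * Γ) * (Γ ^ N * G) := by
      intro j
      have h1 := mul_le_mul_of_nonneg_left
        ((norm_cutS_mulS_le (s := closedBall (0 : Space n) r) measurableSet_closedBall
        (coord_hasTemperateGrowth j) (R := r)
        (fun x hx => (norm_coord_le j x).trans (by simpa using hx))
        (crossS (divCoord j f) m k s a a' g)).trans
        (mul_le_mul_of_nonneg_left (hC j k s a a' r R hk hs ha ha' haa hr hR _ hg) hr)) ha'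
      have h2 := mul_le_mul_of_nonneg_left
        ((hC j k s a a' r R hk hs ha ha' haa hr hR _ (mulS_coord_support hg j)).trans
        (mul_le_mul_of_nonneg_left (norm_toLp_mulS_coord_le hg j)
          (mul_nonneg (hC0 j) (pow_nonneg hΓ0 N)))) ha
      have h3 := mul_le_mul_of_nonneg_left (hD j k s a a' r R hk hs ha ha' haa hr hR _ hg)
        (mul_nonneg ha hs)
      have h4 := mul_le_mul_of_nonneg_left (hE j k s a a' r R hk hs ha ha' haa hr hR _ hg)
        (by positivity : 0 ≤ 2 * a * a' * k)
      rw [map_smul, map_sub, map_add, map_add, map_smul, map_smul, map_smul, map_smul,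
        norm_smul, Complex.norm_real, Real.norm_of_nonneg hk]
      have h5 := (norm_sub_le ((a' : ℂ) • S (mulS (coord j) (crossS (divCoord j f) m k s a a' g)) +
        (a : ℂ) • S (crossS (divCoord j f) m k s a a' (mulS (coord j) g)) +
        (Complex.I * (a * s)) • S (crossS (divCoord j f) (partialDeriv j m) k s a a' g))
        ((Complex.I * (2 * a * a' * k)) •
          S (crossS (partialDeriv j (divCoord j f)) m k s a a' g))).trans
        (add_le_add norm_add₃_le le_rfl)
      have hn1 : ‖(a' : ℂ)‖ = a' := by simp [abs_of_nonneg ha']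
      have hn2 : ‖(a : ℂ)‖ = a := by simp [abs_of_nonneg ha]
      have hn3 : ‖Complex.I * (a * s)‖ = a * s := by simp [abs_of_nonneg ha, abs_of_nonneg hs]
      have hn4 : ‖Complex.I * (2 * a * a' * k)‖ = 2 * a * a' * k := by
        simp [abs_of_nonneg ha, abs_of_nonneg ha', abs_of_nonneg hk]
      rw [norm_smul, norm_smul, norm_smul, norm_smul, hn1, hn2, hn3, hn4] at h5
      have hΓ' : (a + a') * Γ = k * (a' * r + a * (R + s) + 2 * a * a' * k) := by
        rw [hΓ]; field_simp
      rw [hΓ']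
      have hQ : 0 ≤ Γ ^ N * G := by positivity
      refine (mul_le_mul_of_nonneg_left
        (h5.trans (add_le_add (add_le_add (add_le_add h1 h2) h3) h4)) hk).trans ?_
      calc _ = (k * (a' * r * C j + a * R * C j + a * s * D j + 2 * a * a' * k * E j)) *
            (Γ ^ N * G) := by ring
        _ ≤ _ := by
          refine mul_le_mul_of_nonneg_right ?_ hQ
          have := hC0 j
          have := hD0 j
          have := hE0 j
          have : 0 ≤ k * (C j * (a * s + 2 * a * a' * k) +
            D j * (a' * r + a * R + 2 * a * a' * k) + E j * (a' * r + a * (R + s))) := by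
            positivity
          linarith
    have key := congrArg S (crossS_identity hf hm k s a a' g)
    rw [map_smul, map_sum] at key
    have h6 : (a + a') * ‖S (crossS f m k s a a' g)‖ ≤
        ∑ j, (C j + D j + E j) * ((a + a') * Γ) * (Γ ^ N * G) := by
      have : ‖((a + a' : ℝ) : ℂ)‖ = a + a' := by
        rw [Complex.norm_real, Real.norm_of_nonneg haa.le]
      rw [← this, ← norm_smul, key, this]
      exact norm_sum_le_of_le _ fun j _ => hterm j
    rw [← Finset.sum_mul, ← Finset.sum_mul] at h6
    refine le_of_mul_le_mul_left ?_ haa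
    refine h6.trans (le_of_eq ?_)
    ring

/-! ### From Schwartz functions to `L²` -/

/-- A bound for Schwartz functions supported in the ball of radius `2R` extends by density to `L²`
functions supported in the ball of radius `R`. -/
theorem norm_apply_cutOff_le_of_schwartz (T : L2 n →L[ℂ] L2 n) {K R : ℝ} (hR : 0 < R)
    (hK : 0 ≤ K)
    (hT : ∀ g : 𝓢(Space n, ℂ), (∀ x, 2 * R < ‖x‖ → g x = 0) →
      ‖T (g.toLp 2)‖ ≤ K * ‖g.toLp 2 (volume : Measure (Space n))‖) (g : L2 n) :
    ‖T (cutOff (closedBall 0 R) g)‖ ≤ K * ‖g‖ := by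
  let θ : ContDiffBump (0 : Space n) := ⟨R, 2 * R, hR, by linarith⟩
  set Θ : Space n → ℂ := fun x => ((θ x : ℝ) : ℂ) with hΘ
  have hθ1 : ∀ x, ‖Θ x‖ ≤ 1 := fun x => by
    rw [hΘ, Complex.norm_real, Real.norm_of_nonneg θ.nonneg]
    exact θ.le_one
  have hθs : ContDiff ℝ (⊤ : ℕ∞) Θ := Complex.ofRealCLM.contDiff.comp θ.contDiff
  have hθt : Θ.HasTemperateGrowth := by
    have h : HasCompactSupport Θ := θ.hasCompactSupport.comp_left (g := Complex.ofReal) rfl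
    exact h.hasTemperateGrowth hθs
  have hθb : BddMeasurable Θ := ⟨hθs.continuous.measurable, 1, hθ1⟩
  have hdense : ∀ f : L2 n, ‖T (mulCLM Θ hθb f)‖ ≤ K * ‖f‖ := by
    intro f
    refine DenseRange.induction_on (p := fun f : L2 n => ‖T (mulCLM Θ hθb f)‖ ≤ K * ‖f‖)
      (SchwartzMap.denseRange_toLpCLM (p := 2) ENNReal.ofNat_ne_top) f ?_ ?_
    · exact isClosed_le (by fun_prop) (by fun_prop)
    · intro g
      rw [mulCLM_apply, SchwartzMap.toLpCLM_apply, mulOp_toLp hθt]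
      refine (hT _ fun x hx => ?_).trans (mul_le_mul_of_nonneg_left ?_ hK)
      · rw [mulS_apply hθt, hΘ]
        simp only
        rw [θ.zero_of_le_dist (by simpa using hx.le)]
        simp
      · simpa using norm_toLp_mulS_le hθt (R := 1) (g := g) fun x _ => hθ1 x
  have hcut : mulCLM Θ hθb (cutOff (closedBall 0 R) g) = cutOff (closedBall 0 R) g := by
    rw [mulCLM_apply, cutOff, mulOp_mulOp hθb (BddMeasurable.indicator measurableSet_closedBall)]
    congr 1
    ext x
    by_cases hx : x ∈ closedBall (0 : Space n) R
    · simp only [Pi.mul_apply, hx, Set.indicator_of_mem, hΘ]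
      rw [θ.one_of_mem_closedBall hx]
      simp
    · simp [hx]
  rw [← hcut]
  exact (hdense _).trans (mul_le_mul_of_nonneg_left (norm_cutOff_le measurableSet_closedBall g) hK)

/-- Minimal velocity: a wave of momenta at least of order `1 / s`, starting in the ball of radius
`R`, has left the ball of radius `r` after a time `u` with `u / s ≫ r + R + s`, up to an error
of arbitrarily high order. -/
theorem exists_minimal_velocity_bound (N : ℕ) {m : Space n → ℂ} (hm : IsSymbol m) :
    ∃ C : ℝ, 0 ≤ C ∧ ∀ s u r R : ℝ, 0 ≤ s → 0 < u → 0 ≤ r → 0 < R → ∀ g : L2 n,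
      ‖cutOff (closedBall 0 r) (momentumOp (dilate s m)
        (freeFlow (-u) (cutOff (closedBall 0 R) g)))‖ ≤
        C * (s * (r + 2 * R + s) / u) ^ N * ‖g‖ := by
  obtain ⟨C, hC0, hC⟩ := norm_cutS_momS_flowS_le N m hm
  refine ⟨C, hC0, fun s u r R hs hu hr hR g => ?_⟩
  refine norm_apply_cutOff_le_of_schwartz
    (cutCLM (closedBall 0 r) measurableSet_closedBall ∘L
      momCLM _ (hm.bddMeasurable.dilate s) ∘L flowCLM (-u)) hR (by positivity) (fun g hg => ?_) g
  have h := hC s u r (2 * R) hs hu hr (by positivity) g hg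
  rw [cutS_apply, ← momentumOp_toLp (dilate_hasTemperateGrowth hm.hasTemperateGrowth s),
    ← freeFlow_toLp] at h
  exact h

/-- Maximal velocity: a wave of momenta at most of order `1 / s`, starting in the ball of radius
`R`, stays in the ball of radius `r` for all times `a` with `R + s + a / s ≪ r`. -/
theorem exists_maximal_velocity_bound (N : ℕ) {m : Space n → ℂ} (hm : IsCompactSymbol m) :
    ∃ C : ℝ, 0 ≤ C ∧ ∀ s a r R : ℝ, 0 < s → 0 ≤ a → 0 < r → 0 < R → ∀ g : L2 n,
      ‖cutOff {x | r < ‖x‖} (momentumOp (dilate s m)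
        (freeFlow a (cutOff (closedBall 0 R) g)))‖ ≤
        C * ((2 * R + s + 2 * a / s) / r) ^ N * ‖g‖ := by
  obtain ⟨C, hC0, hC⟩ := norm_cutS_momS_compact_le N m hm
  have hmt := hm.hasTemperateGrowth
  have hmb : BddMeasurable m :=
    ⟨hm.contDiff.continuous.measurable, hm.bounded.imp fun _ h => h.2⟩
  refine ⟨C, hC0, fun s a r R hs ha hr hR g => ?_⟩
  refine norm_apply_cutOff_le_of_schwartz
    (cutCLM {x | r < ‖x‖} (measurableSet_lt_norm r) ∘L
      momCLM _ (hmb.dilate s) ∘L flowCLM a) hR (by positivity) (fun g hg => ?_) g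
  have h := hC s a r (2 * R) hs ha hr (by positivity) g hg
  rw [cutS_apply, ← momentumOp_toLp (dilate_hasTemperateGrowth hmt s), ← freeFlow_toLp] at h
  exact h

/-- Crossing a far region: a free wave at distance at least of order `1 / k` from the origin at some
time cannot be both in the ball of radius `r` at a time `a` earlier and in the ball of radius `R` at
a time `a'` later, when `k (r + R + s) ≪ 1` and `k² min a a' ≪ 1`, the latter by the uncertainty
principle. -/
theorem exists_crossing_bound (N : ℕ) {f m : Space n → ℂ} (hf : IsSymbol f) (hm : IsSymbol m) :
    ∃ C : ℝ, 0 ≤ C ∧ ∀ k s a a' r R : ℝ, 0 ≤ k → 0 ≤ s → 0 ≤ a → 0 ≤ a' → 0 < a + a' →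
      0 ≤ r → 0 < R → ∀ g : L2 n,
      ‖cutOff (closedBall 0 r) (freeFlow (-a) (mulOp (dilate k f) (momentumOp (dilate s m)
        (freeFlow (-a') (cutOff (closedBall 0 R) g)))))‖ ≤
        C * (k * (a' * r + a * (2 * R + s) + 2 * a * a' * k) / (a + a')) ^ N * ‖g‖ := by
  obtain ⟨C, hC0, hC⟩ := norm_cutS_crossS_le N f m hf hm
  refine ⟨C, hC0, fun k s a a' r R hk hs ha ha' haa hr hR g => ?_⟩
  refine norm_apply_cutOff_le_of_schwartz
    (cutCLM (closedBall 0 r) measurableSet_closedBall ∘L flowCLM (-a) ∘L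
      mulCLM _ (hf.bddMeasurable.dilate k) ∘L
      momCLM _ (hm.bddMeasurable.dilate s) ∘L flowCLM (-a')) hR (by positivity) (fun g hg => ?_) g
  have h := hC k s a a' r (2 * R) hk hs ha ha' haa hr (by positivity) g hg
  rw [cutS_apply, crossS, ← freeFlow_toLp,
    ← mulOp_toLp (dilate_hasTemperateGrowth hf.hasTemperateGrowth k),
    ← momentumOp_toLp (dilate_hasTemperateGrowth hm.hasTemperateGrowth s), ← freeFlow_toLp] at h
  exact h

/-! ### The interaction picture -/

/-- The interaction term `h(t) = N(·, t, |ψ(t)|) ψ(t)`. -/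
def source (N : Interaction n) (ψ : ℝ → L2 n) (t : ℝ) : L2 n := mulOp (potential N ψ t) (ψ t)

/-- The interaction picture `φ(t) = e^{itH₀} ψ(t)`. -/
def interactionPicture (ψ : ℝ → L2 n) (t : ℝ) : L2 n := freeFlow (-t) (ψ t)

/-- An integral representation of a bounded `φ : ℝ → L²` in the interaction picture, with sources
`h(t)` which are bounded in `L²` and have tails of order `R^{-δ}` outside balls of radius `R`. -/
structure IsDuhamel (φ h : ℝ → L2 n) (δ B M : ℝ) : Prop where
  nonneg : 0 ≤ B
  bound : ∀ t, ‖φ t‖ ≤ M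
  integrable : ∀ s t : ℝ, IntervalIntegrable (fun u => freeFlow (-u) (h u)) volume s t
  sub_eq : ∀ s t : ℝ, φ t - φ s = -(Complex.I • ∫ u in s..t, freeFlow (-u) (h u))
  norm_le : ∀ᵐ u : ℝ, ‖h u‖ ≤ B
  tail_le : ∀ᵐ u : ℝ, ∀ R : ℝ, 0 < R → ‖h u - cutOff (closedBall 0 R) (h u)‖ ≤ B * R ^ (-δ)

/-- The sources are bounded by `ψ`, and their tails decay because `N` does. The factor `‖ψ t‖` is
kept for the uniqueness of the zero solution. -/
theorem exists_source_bound {N : Interaction n} {ψ : ℝ → L2 n} {δ : ℝ} (hδ : 0 < δ)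
    (hN : IsLocalized N ψ δ) :
    ∃ K : ℝ, 0 ≤ K ∧ ∀ᵐ t : ℝ, ‖source N ψ t‖ ≤ K * ‖ψ t‖ ∧ ∀ R : ℝ, 0 < R →
      ‖source N ψ t - cutOff (closedBall 0 R) (source N ψ t)‖ ≤ K * R ^ (-δ) * ‖ψ t‖ := by
  set F : ℝ × Space n → ℂ := fun p =>
    ((Real.sqrt (1 + ‖p.2‖ ^ 2) ^ δ : ℝ) : ℂ) * potential N ψ p.1 p.2 with hF
  have hF' : MemLp F ⊤ ((volume : Measure ℝ).prod (volume : Measure (Space n))) := hN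
  set K : ℝ := (eLpNormEssSup F ((volume : Measure ℝ).prod (volume : Measure (Space n)))).toReal
  have hKfin : eLpNormEssSup F ((volume : Measure ℝ).prod (volume : Measure (Space n))) ≠ ⊤ := by
    have := hF'.2
    rw [eLpNorm_exponent_top] at this
    exact this.ne
  have h1 : ∀ᵐ p ∂((volume : Measure ℝ).prod (volume : Measure (Space n))), ‖F p‖ ≤ K := by
    filter_upwards [ae_le_eLpNormEssSup (f := F)
      (μ := (volume : Measure ℝ).prod (volume : Measure (Space n)))] with p hp
    have := ENNReal.toReal_mono hKfin hp
    simpa using this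
  refine ⟨K, ENNReal.toReal_nonneg, ?_⟩
  filter_upwards [Measure.ae_ae_of_ae_prod h1, hF'.1.prodMk_left] with t ht hmeas
  set w : Space n → ℝ := fun x => Real.sqrt (1 + ‖x‖ ^ 2) ^ δ with hw
  have hsq : ∀ x : Space n, 1 ≤ Real.sqrt (1 + ‖x‖ ^ 2) := fun x => by
    rw [Real.one_le_sqrt]; nlinarith [norm_nonneg x]
  have hw1 : ∀ x, 1 ≤ w x := fun x => Real.one_le_rpow (hsq x) hδ.le
  have hVw : ∀ᵐ x, ‖potential N ψ t x‖ ≤ K * (w x)⁻¹ := by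
    filter_upwards [ht] with x hx
    have hx' : w x * ‖potential N ψ t x‖ ≤ K := by
      have h0 : (0 : ℝ) ≤ w x := zero_le_one.trans (hw1 x)
      rw [hF] at hx
      simp only [norm_mul, Complex.norm_real] at hx
      rwa [Real.norm_of_nonneg h0] at hx
    rw [← div_eq_mul_inv, le_div_iff₀ (zero_lt_one.trans_le (hw1 x))]
    linarith
  have hwm : AEStronglyMeasurable (fun x => (((w x)⁻¹ : ℝ) : ℂ))
      (volume : Measure (Space n)) := by
    have : Measurable fun x : Space n => (((w x)⁻¹ : ℝ) : ℂ) := by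
      simp only [hw]
      fun_prop
    exact this.aestronglyMeasurable
  have hVm : AEStronglyMeasurable (potential N ψ t) (volume : Measure (Space n)) := by
    refine (hwm.mul hmeas).congr (ae_of_all _ fun x => ?_)
    have h0 : ((w x : ℝ) : ℂ) ≠ 0 := by exact_mod_cast (zero_lt_one.trans_le (hw1 x)).ne'
    simp only [hF, Pi.mul_apply]
    push_cast
    rw [← mul_assoc, inv_mul_cancel₀ h0, one_mul]
  have hVK : ∀ᵐ x, ‖potential N ψ t x‖ ≤ K := by
    filter_upwards [hVw] with x hx
    refine hx.trans (mul_le_of_le_one_right ENNReal.toReal_nonneg (inv_le_one_of_one_le₀ (hw1 x)))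
  have hVmem : MemLp (potential N ψ t) ⊤ (volume : Measure (Space n)) :=
    memLp_top_of_bound hVm K hVK
  refine ⟨norm_mulOp_le hVmem hVK _, fun R hR => ?_⟩
  apply Lp.norm_le_mul_norm_of_ae_le_mul
  filter_upwards [mulOp_coeFn hVmem (ψ t), cutOff_coeFn (n := n)
    (measurableSet_closedBall (x := (0 : Space n)) (ε := R)) (source N ψ t),
    Lp.coeFn_sub (source N ψ t) (cutOff (closedBall 0 R) (source N ψ t)), hVw] with x h2 h3 h4 h5
  rw [h4, Pi.sub_apply, h3]
  by_cases hx : x ∈ closedBall (0 : Space n) R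
  · simp only [hx, Set.indicator_of_mem, sub_self, norm_zero]
    have : 0 ≤ K := ENNReal.toReal_nonneg
    positivity
  · rw [Set.indicator_of_notMem hx, sub_zero, source, h2, norm_mul]
    refine mul_le_mul_of_nonneg_right (h5.trans ?_) (norm_nonneg _)
    refine mul_le_mul_of_nonneg_left ?_ ENNReal.toReal_nonneg
    rw [Real.rpow_neg hR.le]
    refine inv_anti₀ (Real.rpow_pos_of_pos hR _) ?_
    refine Real.rpow_le_rpow hR.le ?_ hδ.le
    have hx' : R < ‖x‖ := by simpa using hx
    exact Real.le_sqrt_of_sq_le (by nlinarith)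

theorem interactionPicture_integrable {N : Interaction n} {ψ : ℝ → L2 n}
    (h : IsGlobalSolution N ψ) (t : ℝ) :
    IntervalIntegrable (fun u => freeFlow (-u) (source N ψ u)) volume 0 t := by
  have h1 := h.integrable t
  have h2 : (fun u => freeFlow (-u) (source N ψ u)) = fun u =>
      flowCLM (-t) (freeFlow (t - u) (mulOp (potential N ψ u) (ψ u))) := by
    ext1 u
    rw [flowCLM_apply, freeFlow_freeFlow, source]
    congr 1
    ring
  rw [h2]
  exact ⟨(flowCLM (-t)).integrable_comp h1.1, (flowCLM (-t)).integrable_comp h1.2⟩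

theorem interactionPicture_eq {N : Interaction n} {ψ : ℝ → L2 n}
    (h : IsGlobalSolution N ψ) (t : ℝ) :
    interactionPicture ψ t =
      ψ 0 - Complex.I • ∫ u in (0 : ℝ)..t, freeFlow (-u) (source N ψ u) := by
  have h1 := congrArg (flowCLM (-t)) (h.duhamel t)
  rw [map_sub, map_smul, ← ContinuousLinearMap.intervalIntegral_comp_comm _ (h.integrable t),
    flowCLM_apply, flowCLM_apply, freeFlow_freeFlow, neg_add_cancel, freeFlow_zero] at h1
  rw [interactionPicture, h1]
  congr 3
  ext1 u
  rw [flowCLM_apply, freeFlow_freeFlow, source]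
  congr 1
  ring

theorem IsGlobalSolution.exists_isDuhamel {N : Interaction n} {ψ : ℝ → L2 n} {δ M : ℝ}
    (h : IsGlobalSolution N ψ) (hδ : 0 < δ) (hM : ∀ t, ‖ψ t‖ ≤ M) (hN : IsLocalized N ψ δ) :
    ∃ B, IsDuhamel (interactionPicture ψ) (source N ψ) δ B M := by
  obtain ⟨K, hK0, hK⟩ := exists_source_bound hδ hN
  have hM0 : 0 ≤ M := (norm_nonneg _).trans (hM 0)
  have hint : ∀ s t : ℝ, IntervalIntegrable (fun u => freeFlow (-u) (source N ψ u)) volume s t :=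
    fun s t => (interactionPicture_integrable h s).symm.trans (interactionPicture_integrable h t)
  refine ⟨K * M, mul_nonneg hK0 hM0, fun t => ?_, hint, fun s t => ?_, ?_, ?_⟩
  · rw [interactionPicture, norm_freeFlow]; exact hM t
  · rw [interactionPicture_eq h, interactionPicture_eq h,
      ← intervalIntegral.integral_interval_sub_left (hint 0 t) (hint 0 s), smul_sub]
    abel
  · filter_upwards [hK] with u hu
    exact hu.1.trans (mul_le_mul_of_nonneg_left (hM u) hK0)
  · filter_upwards [hK] with u hu R hR
    refine (hu.2 R hR).trans ?_
    rw [mul_right_comm]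
    gcongr
    exact hM u

/-! ### Weak limits -/

section Hilbert

variable {H : Type*} [NormedAddCommGroup H] [InnerProductSpace ℂ H]

/-- A bounded curve `φ`, whose increments after time `s` become small when seen through `A s`,
where the adjoints `A' s` of `A s` tend strongly to the identity, has a weak limit. -/
theorem exists_weak_limit [CompleteSpace H] {φ : ℝ → H} {M : ℝ} (hφ : ∀ t, ‖φ t‖ ≤ M)
    {A A' : ℝ → H → H} {η : ℝ → ℝ} (hadj : ∀ s x y, inner ℂ x (A s y) = inner ℂ (A' s x) y)
    (hA' : ∀ x, Tendsto (fun s => A' s x) atTop (𝓝 x))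
    (hη : Tendsto η atTop (𝓝 0))
    (hAη : ∀ᶠ s in atTop, ∀ t, s ≤ t → ‖A s (φ t - φ s)‖ ≤ η s) :
    ∃ Ω : H, ‖Ω‖ ≤ M ∧ ∀ x, Tendsto (fun t => inner ℂ x (φ t)) atTop (𝓝 (inner ℂ x Ω)) := by
  have hM : 0 ≤ M := (norm_nonneg _).trans (hφ 0)
  have hlim : ∀ x, ∃ l, Tendsto (fun t => inner ℂ (φ t) x) atTop (𝓝 l) := by
    intro x
    apply cauchy_map_iff_exists_tendsto.1
    rw [Metric.cauchy_iff]
    refine ⟨inferInstance, fun ε hε => ?_⟩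
    have h1 : Tendsto (fun s => 2 * M * ‖x - A' s x‖ + ‖x‖ * η s) atTop (𝓝 0) := by
      have h2 : Tendsto (fun s => ‖x - A' s x‖) atTop (𝓝 0) := by
        simpa using ((hA' x).const_sub x).norm
      simpa using (h2.const_mul (2 * M)).add (hη.const_mul ‖x‖)
    obtain ⟨s, hs, hsA⟩ := ((h1.eventually (gt_mem_nhds (half_pos hε))).and hAη).exists
    have hdiff : ∀ t, s ≤ t → ‖inner ℂ (φ t) x - inner ℂ (φ s) x‖ < ε / 2 := by
      intro t ht
      rw [← inner_sub_left, norm_inner_symm]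
      have h3 : inner ℂ x (φ t - φ s) =
          inner ℂ (x - A' s x) (φ t - φ s) + inner ℂ x (A s (φ t - φ s)) := by
        rw [hadj, inner_sub_left]
        ring
      rw [h3]
      refine lt_of_le_of_lt (norm_add_le _ _) (lt_of_le_of_lt (add_le_add
        (norm_inner_le_norm _ _) (norm_inner_le_norm _ _)) (lt_of_le_of_lt ?_ hs))
      have h4 : ‖φ t - φ s‖ ≤ 2 * M :=
        (norm_sub_le _ _).trans (by linarith [hφ t, hφ s])
      have h5 := hsA t ht
      have h6 := norm_nonneg (x - A' s x)
      have h7 := norm_nonneg x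
      nlinarith [mul_le_mul_of_nonneg_left h4 h6, mul_le_mul_of_nonneg_left h5 h7]
    refine ⟨(fun t => inner ℂ (φ t) x) '' Set.Ici s, image_mem_map (Ici_mem_atTop s), ?_⟩
    rintro _ ⟨t, ht, rfl⟩ _ ⟨t', ht', rfl⟩
    have h1 := hdiff t ht
    have h2 := hdiff t' ht'
    rw [← dist_eq_norm] at h1 h2
    calc dist _ _ ≤ _ := dist_triangle_right _ _ (inner ℂ (φ s) x)
      _ < ε := by linarith
  choose l hl using hlim
  let L : H →ₗ[ℂ] ℂ :=
    { toFun := l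
      map_add' := fun x y => tendsto_nhds_unique (hl (x + y)) (by
        simpa [inner_add_right] using (hl x).add (hl y))
      map_smul' := fun c x => tendsto_nhds_unique (hl (c • x)) (by
        simpa [inner_smul_right] using (hl x).const_mul c) }
  have hLb : ∀ x, ‖L x‖ ≤ M * ‖x‖ := fun x =>
    le_of_tendsto (hl x).norm (Eventually.of_forall fun t =>
      (norm_inner_le_norm _ _).trans (mul_le_mul_of_nonneg_right (hφ t) (norm_nonneg x)))
  let L' : H →L[ℂ] ℂ := L.mkContinuous M hLb
  refine ⟨(InnerProductSpace.toDual ℂ H).symm L', ?_, fun x => ?_⟩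
  · rw [LinearIsometryEquiv.norm_map]
    exact L.mkContinuous_norm_le hM hLb
  · have h1 : inner ℂ ((InnerProductSpace.toDual ℂ H).symm L') x = l x :=
      InnerProductSpace.toDual_symm_apply
    have h2 : Tendsto (fun t => starRingEnd ℂ (inner ℂ (φ t) x)) atTop
        (𝓝 (starRingEnd ℂ (l x))) := (hl x).star
    rw [← h1] at h2
    simpa only [inner_conj_symm] using h2

/-- Increments which are small through `A s` give strong convergence of `A s (φ s)` to the weak
limit of `φ`. -/
theorem tendsto_of_weak_limit {φ : ℝ → H} {A : ℝ → H →L[ℂ] H} {A' : ℝ → H → H}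
    {η : ℝ → ℝ} {Ω : H} (hadj : ∀ s x y, inner ℂ x (A s y) = inner ℂ (A' s x) y)
    (hA : Tendsto (fun s => A s Ω) atTop (𝓝 Ω))
    (hη : Tendsto η atTop (𝓝 0))
    (hAη : ∀ᶠ s in atTop, ∀ t, s ≤ t → ‖A s (φ t - φ s)‖ ≤ η s)
    (hΩ : ∀ x, Tendsto (fun t => inner ℂ x (φ t)) atTop (𝓝 (inner ℂ x Ω))) :
    Tendsto (fun s => A s (φ s)) atTop (𝓝 Ω) := by
  have h1 : ∀ᶠ s in atTop, ‖A s (Ω - φ s)‖ ≤ η s := by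
    filter_upwards [hAη] with s hs
    have hη0 : 0 ≤ η s := (norm_nonneg _).trans (hs s le_rfl)
    -- test against `z = A s (Ω - φ s)` and let `t → ∞`
    set z := A s (Ω - φ s) with hz
    have h2 : Tendsto (fun t => ‖inner ℂ z (A s (φ t - φ s))‖) atTop
        (𝓝 ‖inner ℂ z (A s (Ω - φ s))‖) := by
      simp only [hadj, inner_sub_right]
      exact ((hΩ (A' s z)).sub_const _).norm
    have h3 : ‖inner ℂ z (A s (Ω - φ s))‖ ≤ ‖z‖ * η s := by
      refine le_of_tendsto h2 ?_
      filter_upwards [eventually_ge_atTop s] with t ht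
      exact (norm_inner_le_norm _ _).trans
        (mul_le_mul_of_nonneg_left (hs t ht) (norm_nonneg _))
    rw [← hz, inner_self_eq_norm_sq_to_K, norm_pow] at h3
    simp only [Complex.coe_algebraMap, Complex.norm_real, norm_norm] at h3
    rcases (norm_nonneg z).eq_or_lt with h0 | h0
    · rw [← h0]; exact hη0
    · nlinarith
  have h4 : Tendsto (fun s => A s (Ω - φ s)) atTop (𝓝 0) :=
    squeeze_zero_norm' h1 hη
  have h5 := hA.sub h4
  simpa using h5

end Hilbert

/-! ### Integrals of powers of time -/

theorem integral_rpow_neg_le {θ s t : ℝ} (hθ : 1 < θ) (hs : 0 < s) (hst : s ≤ t) :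
    ∫ u in s..t, u ^ (-θ) ≤ s ^ (1 - θ) / (θ - 1) := by
  rw [integral_rpow (Or.inr ⟨by linarith, fun h => by
    rw [Set.uIcc_of_le hst] at h; linarith [h.1]⟩)]
  have h1 : 0 ≤ t ^ (1 - θ) := Real.rpow_nonneg (hs.le.trans hst) _
  rw [show -θ + 1 = 1 - θ by ring, show (1 - θ) = -(θ - 1) by ring, div_neg, ← neg_div]
  rw [show (1 - θ) = -(θ - 1) by ring] at h1
  gcongr
  linarith

theorem intervalIntegrable_rpow_neg {θ s t : ℝ} (hs : 0 < s) (hst : s ≤ t) :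
    IntervalIntegrable (fun u : ℝ => u ^ (-θ)) volume s t :=
  intervalIntegral.intervalIntegrable_rpow (Or.inr fun h => by
    rw [Set.uIcc_of_le hst] at h; linarith [h.1])

/-- Cook's method. -/
theorem IsDuhamel.norm_apply_sub_le {φ h : ℝ → L2 n} {δ B M : ℝ} (hd : IsDuhamel φ h δ B M)
    {E : Type*} [NormedAddCommGroup E] [NormedSpace ℂ E] [CompleteSpace E]
    (T : L2 n →L[ℂ] E) {D θ s t : ℝ} (hθ : 1 < θ) (hs : 0 < s) (hst : s ≤ t) (hD : 0 ≤ D)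
    (hT : ∀ᵐ u : ℝ, s < u → ‖T (freeFlow (-u) (h u))‖ ≤ D * u ^ (-θ)) :
    ‖T (φ t - φ s)‖ ≤ D * (s ^ (1 - θ) / (θ - 1)) := by
  rw [hd.sub_eq, map_neg, norm_neg, map_smul, norm_smul, Complex.norm_I, one_mul,
    ← ContinuousLinearMap.intervalIntegral_comp_comm _ (hd.integrable s t)]
  refine (intervalIntegral.norm_integral_le_of_norm_le hst (g := fun u => D * u ^ (-θ)) ?_
    ((intervalIntegrable_rpow_neg hs hst).const_mul D)).trans ?_
  · filter_upwards [hT] with u hu hu'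
    exact hu hu'.1
  · rw [intervalIntegral.integral_const_mul]
    exact mul_le_mul_of_nonneg_left (integral_rpow_neg_le hθ hs hst) hD

/-! ### Strong limits of multipliers -/

theorem norm_sq_eq_integral (f : L2 n) : ‖f‖ ^ 2 = ∫ x, ‖f x‖ ^ 2 := by
  have h1 : inner ℂ f f = ((‖f‖ ^ 2 : ℝ) : ℂ) := by
    rw [inner_self_eq_norm_sq_to_K]; simp
  rw [L2.inner_def] at h1
  have h2 : ∫ x, inner ℂ (f x) (f x) = ((∫ x, ‖f x‖ ^ 2 : ℝ) : ℂ) := by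
    rw [← integral_complex_ofReal]
    refine integral_congr_ae (ae_of_all _ fun x => ?_)
    simp only
    rw [inner_self_eq_norm_sq_to_K]; simp
  rw [h2] at h1
  exact_mod_cast h1.symm

theorem integrable_norm_sq (f : L2 n) : Integrable (fun x => ‖f x‖ ^ 2) volume := by
  have := (Lp.memLp f).integrable_norm_rpow (by simp) (by simp)
  simpa using this

theorem tendsto_mulOp_zero {l : Filter ℝ} [l.IsCountablyGenerated] {m : ℝ → Space n → ℂ}
    (hm : ∀ s, BddMeasurable (m s)) {C : ℝ} (hC : ∀ s x, ‖m s x‖ ≤ C)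
    (hlim : ∀ᵐ x, Tendsto (fun s => m s x) l (𝓝 0)) (f : L2 n) :
    Tendsto (fun s => mulOp (m s) f) l (𝓝 0) := by
  have h1 : Tendsto (fun s => ∫ x, ‖m s x * f x‖ ^ 2) l (𝓝 (∫ _ : Space n, (0 : ℝ))) := by
    refine tendsto_integral_filter_of_dominated_convergence (fun x => C ^ 2 * ‖f x‖ ^ 2)
      (Eventually.of_forall fun s => ?_) (Eventually.of_forall fun s => ae_of_all _ fun x => ?_)
      ((integrable_norm_sq f).const_mul _) ?_
    · exact (((hm s).measurable.aestronglyMeasurable.mul (Lp.aestronglyMeasurable f)).norm.pow 2)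
    · rw [Real.norm_of_nonneg (by positivity), norm_mul, mul_pow]
      gcongr
      exact hC s x
    · filter_upwards [hlim] with x hx
      have := ((hx.mul_const (f x)).norm).pow 2
      simpa using this
  have h2 : Tendsto (fun s => ‖mulOp (m s) f‖ ^ 2) l (𝓝 0) := by
    rw [integral_zero] at h1
    refine h1.congr fun s => ?_
    rw [norm_sq_eq_integral]
    refine integral_congr_ae ?_
    filter_upwards [mulOp_coeFn (hm s).memLp f] with x hx
    rw [hx]
  rw [tendsto_zero_iff_norm_tendsto_zero]
  have h3 := h2.sqrt
  simpa [Real.sqrt_sq] using h3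

theorem tendsto_momentumOp_zero {l : Filter ℝ} [l.IsCountablyGenerated] {m : ℝ → Space n → ℂ}
    (hn : 1 ≤ n) (hm : ∀ s, BddMeasurable (m s)) {C : ℝ} (hC : ∀ s x, ‖m s x‖ ≤ C)
    (hlim : ∀ p, p ≠ 0 → Tendsto (fun s => m s p) l (𝓝 0)) (f : L2 n) :
    Tendsto (fun s => momentumOp (m s) f) l (𝓝 0) := by
  have : Nonempty (Fin n) := ⟨⟨0, hn⟩⟩
  have hae : ∀ᵐ p : Space n, p ≠ 0 := by
    rw [ae_iff]
    simp
  have h := tendsto_mulOp_zero (l := l) (fun s => (hm s).dilate (2 * Real.pi)) (C := C)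
    (fun s x => hC s _) (by
      filter_upwards [hae] with p hp
      exact hlim _ (by simp [hp, Real.pi_ne_zero])) (𝓕 f)
  rw [tendsto_zero_iff_norm_tendsto_zero] at h ⊢
  refine h.congr fun s => ?_
  rw [← Lp.norm_fourier_eq (momentumOp _ f), fourier_momentumOp]

/-! ### The channel cutoff in the interaction picture -/

/-- The multiplier of the position cutoff. -/
def positionSymbol (Fbar : ℝ → ℝ) (r : ℝ) (x : Space n) : ℂ := ((1 - Fbar (‖x‖ / r) : ℝ) : ℂ)

/-- The multiplier of the momentum cutoff. -/
def momentumSymbol (F₁ : ℝ → ℝ) (s : ℝ) (p : Space n) : ℂ := ((F₁ (s * ‖p‖) : ℝ) : ℂ)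

theorem IsSmoothCutoff.norm_positionSymbol_le {F : ℝ → ℝ} (hF : IsSmoothCutoff F) (r : ℝ)
    (x : Space n) : ‖positionSymbol F r x‖ ≤ 1 := by
  rw [positionSymbol, Complex.norm_real, Real.norm_eq_abs, abs_le]
  constructor <;> linarith [hF.nonneg (‖x‖ / r), hF.le_one (‖x‖ / r)]

theorem IsSmoothCutoff.norm_momentumSymbol_le {F : ℝ → ℝ} (hF : IsSmoothCutoff F) (s : ℝ)
    (p : Space n) : ‖momentumSymbol F s p‖ ≤ 1 := by
  rw [momentumSymbol, Complex.norm_real, Real.norm_eq_abs, abs_le]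
  constructor <;> linarith [hF.nonneg (s * ‖p‖), hF.le_one (s * ‖p‖)]

theorem IsSmoothCutoff.positionSymbol_bddMeasurable {F : ℝ → ℝ} (hF : IsSmoothCutoff F) (r : ℝ) :
    BddMeasurable (positionSymbol F r : Space n → ℂ) :=
  ⟨Complex.measurable_ofReal.comp (measurable_const.sub
    (hF.contDiff.continuous.measurable.comp (measurable_norm.div_const r))), 1,
    hF.norm_positionSymbol_le r⟩

theorem IsSmoothCutoff.momentumSymbol_bddMeasurable {F : ℝ → ℝ} (hF : IsSmoothCutoff F) (s : ℝ) :
    BddMeasurable (momentumSymbol F s : Space n → ℂ) :=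
  ⟨Complex.measurable_ofReal.comp
    (hF.contDiff.continuous.measurable.comp (measurable_norm.const_mul s)), 1,
    hF.norm_momentumSymbol_le s⟩

theorem momentumSymbol_eq_dilate (F : ℝ → ℝ) {s : ℝ} (hs : 0 ≤ s) :
    (momentumSymbol F s : Space n → ℂ) = dilate s fun p => ((F ‖p‖ : ℝ) : ℂ) := by
  ext p
  rw [momentumSymbol, dilate, norm_smul, Real.norm_of_nonneg hs]

theorem star_positionSymbol (F : ℝ → ℝ) (r : ℝ) :
    (fun x : Space n => star (positionSymbol F r x)) = positionSymbol F r := by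
  ext x
  simp [positionSymbol]

theorem star_momentumSymbol (F : ℝ → ℝ) (s : ℝ) :
    (fun x : Space n => star (momentumSymbol F s x)) = momentumSymbol F s := by
  ext x
  simp [momentumSymbol]

theorem IsSmoothCutoff.tendsto_positionCutoff {F : ℝ → ℝ} (hF : IsSmoothCutoff F) {α : ℝ}
    (hα : 0 < α) (f : L2 n) :
    Tendsto (fun t : ℝ => mulOp (positionSymbol F (t ^ α)) f) atTop (𝓝 f) := by
  have h1 : ∀ t : ℝ, BddMeasurable ((fun _ => 1) - positionSymbol F (t ^ α) : Space n → ℂ) :=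
    fun t => BddMeasurable.sub ⟨measurable_const, 1, by simp⟩ (hF.positionSymbol_bddMeasurable _)
  have h2 := tendsto_mulOp_zero (l := atTop) h1 (C := 2) (fun t x => by
    refine (norm_sub_le _ _).trans ?_
    have := hF.norm_positionSymbol_le (t ^ α) x
    simp only [norm_one]
    linarith) (ae_of_all _ fun x => by
      refine tendsto_const_nhds.congr' ?_
      have h3 : Tendsto (fun t : ℝ => t ^ α) atTop atTop := tendsto_rpow_atTop hα
      filter_upwards [h3.eventually_ge_atTop (2 * (‖x‖ + 1))] with t ht
      have h4 : ‖x‖ / t ^ α ≤ 1 / 2 := by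
        rw [div_le_iff₀ (by linarith [norm_nonneg x])]
        linarith
      simp [positionSymbol, hF.eq_zero _ h4]) f
  have h3 := h2.const_sub f
  rw [sub_zero] at h3
  refine h3.congr fun t => ?_
  rw [mulOp_sub_left ⟨measurable_const, 1, by simp⟩ (hF.positionSymbol_bddMeasurable _),
    mulOp_one]
  abel

theorem IsSmoothCutoff.tendsto_lowMomentum {F : ℝ → ℝ} (hF : IsSmoothCutoff F) (hn : 1 ≤ n)
    {b : ℝ} (hb : 0 < b) (f : L2 n) :
    Tendsto (fun t : ℝ => momentumOp ((fun _ => 1) - momentumSymbol F (t ^ b)) f)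
      atTop (𝓝 0) := by
  have h1 : ∀ t : ℝ, BddMeasurable ((fun _ => 1) - momentumSymbol F (t ^ b) : Space n → ℂ) :=
    fun t => BddMeasurable.sub ⟨measurable_const, 1, by simp⟩ (hF.momentumSymbol_bddMeasurable _)
  refine tendsto_momentumOp_zero (l := atTop) hn h1 (C := 2) (fun t x => by
    refine (norm_sub_le _ _).trans ?_
    have := hF.norm_momentumSymbol_le (t ^ b) x
    simp only [norm_one]
    linarith) (fun p hp => by
      refine tendsto_const_nhds.congr' ?_
      have hp' : 0 < ‖p‖ := norm_pos_iff.2 hp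
      have h3 : Tendsto (fun t : ℝ => t ^ b) atTop atTop := tendsto_rpow_atTop hb
      filter_upwards [h3.eventually_ge_atTop (1 / ‖p‖)] with t ht
      have h4 : 1 ≤ t ^ b * ‖p‖ := by
        rwa [div_le_iff₀ hp'] at ht
      simp [momentumSymbol, hF.eq_one _ h4]) f

theorem IsSmoothCutoff.momentumOp_low {F : ℝ → ℝ} (hF : IsSmoothCutoff F) (s : ℝ) (f : L2 n) :
    momentumOp ((fun _ => 1) - momentumSymbol F s) f = f - momentumOp (momentumSymbol F s) f := by
  rw [momentumOp_sub_left ⟨measurable_const, 1, by simp⟩ (hF.momentumSymbol_bddMeasurable _),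
    momentumOp_one]

theorem IsSmoothCutoff.tendsto_momentumCutoff {F : ℝ → ℝ} (hF : IsSmoothCutoff F) (hn : 1 ≤ n)
    {b : ℝ} (hb : 0 < b) (f : L2 n) :
    Tendsto (fun t : ℝ => momentumOp (momentumSymbol F (t ^ b)) f) atTop (𝓝 f) := by
  have h3 := (hF.tendsto_lowMomentum hn hb f).const_sub f
  rw [sub_zero] at h3
  refine h3.congr fun t => ?_
  rw [hF.momentumOp_low]
  abel

/-- The operator `F_c(|x| / t^α ≤ 1) F₁(t^b |P| > 1)`, which is the channel cutoff in the
interaction picture. -/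
def channelCLM {Fbar F₁ : ℝ → ℝ} (hFbar : IsSmoothCutoff Fbar) (hF₁ : IsSmoothCutoff F₁)
    (α b t : ℝ) : L2 n →L[ℂ] L2 n :=
  mulCLM (positionSymbol Fbar (t ^ α)) (hFbar.positionSymbol_bddMeasurable _) ∘L
    momCLM (momentumSymbol F₁ (t ^ b)) (hF₁.momentumSymbol_bddMeasurable _)

theorem channelCLM_apply {Fbar F₁ : ℝ → ℝ} (hFbar : IsSmoothCutoff Fbar)
    (hF₁ : IsSmoothCutoff F₁) (α b t : ℝ) (f : L2 n) :
    channelCLM hFbar hF₁ α b t f =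
      mulOp (positionSymbol Fbar (t ^ α)) (momentumOp (momentumSymbol F₁ (t ^ b)) f) := rfl

theorem freeFlow_channelCutoff {Fbar F₁ : ℝ → ℝ} (hFbar : IsSmoothCutoff Fbar)
    (hF₁ : IsSmoothCutoff F₁) (α b t : ℝ) (f : L2 n) :
    freeFlow (-t) (channelCutoff Fbar F₁ α b t f) =
      channelCLM hFbar hF₁ α b t (freeFlow (-t) f) := by
  rw [channelCutoff, propagationCutoff, freeFlow_freeFlow, neg_add_cancel, freeFlow_zero,
    channelCLM_apply, momentumOp_freeFlow_comm (hF₁.momentumSymbol_bddMeasurable _)]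
  rfl

theorem inner_channelCLM {Fbar F₁ : ℝ → ℝ} (hFbar : IsSmoothCutoff Fbar)
    (hF₁ : IsSmoothCutoff F₁) (α b t : ℝ) (f g : L2 n) :
    inner ℂ f (channelCLM hFbar hF₁ α b t g) =
      inner ℂ (momentumOp (momentumSymbol F₁ (t ^ b)) (mulOp (positionSymbol Fbar (t ^ α)) f))
        g := by
  have h1 := hFbar.positionSymbol_bddMeasurable (n := n) (t ^ α)
  have h2 := hF₁.momentumSymbol_bddMeasurable (n := n) (t ^ b)
  rw [channelCLM_apply, inner_mulOp h1 (by rwa [star_positionSymbol]), star_positionSymbol,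
    inner_momentumOp h2 (by rwa [star_momentumSymbol]), star_momentumSymbol]

theorem tendsto_channelCLM {Fbar F₁ : ℝ → ℝ} (hFbar : IsSmoothCutoff Fbar)
    (hF₁ : IsSmoothCutoff F₁) (hn : 1 ≤ n) {α b : ℝ} (hα : 0 < α) (hb : 0 < b) (f : L2 n) :
    Tendsto (fun t => channelCLM hFbar hF₁ α b t f) atTop (𝓝 f) := by
  have h1 := hFbar.tendsto_positionCutoff hα f
  have h2 := hF₁.tendsto_momentumCutoff hn hb f
  have h3 : Tendsto (fun t : ℝ => mulOp (positionSymbol Fbar (t ^ α))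
      (momentumOp (momentumSymbol F₁ (t ^ b)) f - f)) atTop (𝓝 0) := by
    refine squeeze_zero_norm (fun t => ?_)
      (tendsto_iff_norm_sub_tendsto_zero.1 h2)
    simpa using norm_mulOp_le (hFbar.positionSymbol_bddMeasurable (n := n) (t ^ α)).memLp
      (ae_of_all _ (hFbar.norm_positionSymbol_le (t ^ α)))
      (momentumOp (momentumSymbol F₁ (t ^ b)) f - f)
  have h4 := h1.add h3
  rw [add_zero] at h4
  refine h4.congr fun t => ?_
  have := map_sub (mulCLM (positionSymbol Fbar (t ^ α))
    (hFbar.positionSymbol_bddMeasurable (n := n) _))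
    (momentumOp (momentumSymbol F₁ (t ^ b)) f) f
  simp only [mulCLM_apply] at this
  rw [this, channelCLM_apply]
  abel

theorem tendsto_channel_adjoint {Fbar F₁ : ℝ → ℝ} (hFbar : IsSmoothCutoff Fbar)
    (hF₁ : IsSmoothCutoff F₁) (hn : 1 ≤ n) {α b : ℝ} (hα : 0 < α) (hb : 0 < b) (f : L2 n) :
    Tendsto (fun t : ℝ => momentumOp (momentumSymbol F₁ (t ^ b))
      (mulOp (positionSymbol Fbar (t ^ α)) f)) atTop (𝓝 f) := by
  have h1 := hFbar.tendsto_positionCutoff hα f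
  have h2 := hF₁.tendsto_momentumCutoff hn hb f
  have h3 : Tendsto (fun t : ℝ => momentumOp (momentumSymbol F₁ (t ^ b))
      (mulOp (positionSymbol Fbar (t ^ α)) f - f)) atTop (𝓝 0) := by
    refine squeeze_zero_norm (fun t => ?_)
      (tendsto_iff_norm_sub_tendsto_zero.1 h1)
    simpa using norm_momentumOp_le (hF₁.momentumSymbol_bddMeasurable (n := n) (t ^ b))
      (hF₁.norm_momentumSymbol_le (t ^ b)) (mulOp (positionSymbol Fbar (t ^ α)) f - f)
  have h4 := h2.add h3
  rw [add_zero] at h4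
  refine h4.congr fun t => ?_
  have := map_sub (momCLM (momentumSymbol F₁ (t ^ b))
    (hF₁.momentumSymbol_bddMeasurable (n := n) _))
    (mulOp (positionSymbol Fbar (t ^ α)) f) f
  simp only [momCLM_apply] at this
  rw [this]
  abel

/-- Seen through the channel cutoff of time `s`, the later increments of the interaction picture
are small. -/
theorem IsDuhamel.exists_channel_bound {φ h : ℝ → L2 n} {δ B M : ℝ} (hd : IsDuhamel φ h δ B M)
    (hδ : 1 < δ) {Fbar F₁ : ℝ → ℝ} (hFbar : IsSmoothCutoff Fbar) (hF₁ : IsSmoothCutoff F₁)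
    {α b : ℝ} (hb : 0 < b) (hbδ : b < 1 - (1 + 1 / δ) / 2) (hbα : b < α) (hα : α < 1 - b) :
    ∃ η : ℝ → ℝ, Tendsto η atTop (𝓝 0) ∧ ∀ᶠ s in atTop, ∀ t, s ≤ t →
      ‖channelCLM hFbar hF₁ α b s (φ t - φ s)‖ ≤ η s := by
  -- the sources at time `u` are cut off at radius `u ^ ρ`; the tails decay like `u ^ (-ρ δ)`
  set ρ : ℝ := (1 + 1 / δ) / 2 with hρ
  have hδ0 : 0 < δ := by linarith
  have hρδ : 1 < ρ * δ := by
    rw [hρ]; field_simp; linarith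
  set γ : ℝ := max α ρ with hγ
  have hβ : 0 < 1 - b - γ := by
    have : γ < 1 - b := max_lt hα (by linarith)
    linarith
  set β := 1 - b - γ with hβdef
  obtain ⟨N, hN⟩ := exists_nat_ge (2 / β)
  have hN2 : 2 ≤ β * N := by
    rw [div_le_iff₀ hβ] at hN; linarith
  obtain ⟨C, hC0, hC⟩ := exists_minimal_velocity_bound N (hF₁.isSymbol (n := n))
  set θ : ℝ := min 2 (ρ * δ) with hθ
  have hθ1 : 1 < θ := lt_min (by norm_num) hρδ
  set D : ℝ := (C * 4 ^ N + 1) * B with hD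
  have hB := hd.nonneg
  refine ⟨fun s => D * (s ^ (1 - θ) / (θ - 1)), ?_, ?_⟩
  · have h1 : Tendsto (fun s : ℝ => s ^ (1 - θ)) atTop (𝓝 0) := by
      have := tendsto_rpow_neg_atTop (y := θ - 1) (by linarith)
      simpa using this
    simpa using (h1.div_const (θ - 1)).const_mul D
  filter_upwards [eventually_ge_atTop 1] with s hs t hst
  refine hd.norm_apply_sub_le _ hθ1 (by linarith) hst (by positivity) ?_
  filter_upwards [hd.norm_le, hd.tail_le] with u hu1 hu2 hsu
  have hu : 1 ≤ u := by linarith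
  have hu0 : 0 < u := by linarith
  have hs0 : 0 < s := by linarith
  have hR : 0 < u ^ ρ := Real.rpow_pos_of_pos hu0 _
  set A := channelCLM (n := n) hFbar hF₁ α b s with hA
  have hAnorm : ∀ f, ‖A f‖ ≤ ‖momentumOp (momentumSymbol F₁ (s ^ b)) f‖ := fun f => by
    simpa [hA, channelCLM_apply] using
      norm_mulOp_le (hFbar.positionSymbol_bddMeasurable (n := n) (s ^ α)).memLp
      (ae_of_all _ (hFbar.norm_positionSymbol_le (s ^ α)))
      (momentumOp (momentumSymbol F₁ (s ^ b)) f)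
  have hAcut : ∀ f, ‖A f‖ ≤
      ‖cutOff (closedBall 0 (s ^ α)) (momentumOp (momentumSymbol F₁ (s ^ b)) f)‖ := fun f => by
    rw [hA, channelCLM_apply, ← mulOp_eq_cutOff (hFbar.positionSymbol_bddMeasurable _)
      (measurableSet_closedBall (x := (0 : Space n)) (ε := s ^ α)) (fun x hx => ?_)]
    · simpa using norm_mulOp_le (hFbar.positionSymbol_bddMeasurable (n := n) (s ^ α)).memLp
        (ae_of_all _ (hFbar.norm_positionSymbol_le (s ^ α)))
        (cutOff (closedBall 0 (s ^ α)) (momentumOp (momentumSymbol F₁ (s ^ b)) f))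
    · have hx' : s ^ α < ‖x‖ := by simpa using hx
      have : 1 ≤ ‖x‖ / s ^ α := by
        rw [le_div_iff₀ (Real.rpow_pos_of_pos hs0 _)]
        linarith
      simp [positionSymbol, hFbar.eq_one _ this]
  have hsplit : h u = cutOff (closedBall 0 (u ^ ρ)) (h u) +
      (h u - cutOff (closedBall 0 (u ^ ρ)) (h u)) := by abel
  have hmain : ‖A (freeFlow (-u) (cutOff (closedBall 0 (u ^ ρ)) (h u)))‖ ≤
      C * 4 ^ N * B * u ^ (-θ) := by
    refine (hAcut _).trans ?_
    rw [momentumSymbol_eq_dilate F₁ (Real.rpow_nonneg hs0.le b)]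
    refine (hC (s ^ b) u (s ^ α) (u ^ ρ) (by positivity) hu0 (by positivity) hR _).trans ?_
    have hsb : s ^ b ≤ u ^ b := Real.rpow_le_rpow hs0.le hsu.le hb.le
    have hsb' : s ^ b ≤ u ^ γ := hsb.trans
      (Real.rpow_le_rpow_of_exponent_le hu (hbα.le.trans (le_max_left _ _)))
    have hsα : s ^ α ≤ u ^ γ := (Real.rpow_le_rpow hs0.le hsu.le (hb.trans hbα).le).trans
      (Real.rpow_le_rpow_of_exponent_le hu (le_max_left _ _))
    have huρ : u ^ ρ ≤ u ^ γ := Real.rpow_le_rpow_of_exponent_le hu (le_max_right _ _)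
    have h1 : s ^ b * (s ^ α + 2 * u ^ ρ + s ^ b) / u ≤ 4 * u ^ (-β) := by
      have h2 : u ^ (-β) = u ^ b * u ^ γ / u := by
        rw [← Real.rpow_add hu0, ← Real.rpow_sub_one hu0.ne']
        congr 1
        rw [hβdef]; ring
      rw [h2, ← mul_div_assoc]
      refine div_le_div_of_nonneg_right ?_ hu0.le
      calc s ^ b * (s ^ α + 2 * u ^ ρ + s ^ b) ≤ u ^ b * (u ^ γ + 2 * u ^ γ + u ^ γ) := by gcongr
        _ = _ := by ring
    have h3 : (s ^ b * (s ^ α + 2 * u ^ ρ + s ^ b) / u) ^ N ≤ 4 ^ N * u ^ (-θ) := by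
      calc _ ≤ (4 * u ^ (-β)) ^ N := pow_le_pow_left₀ (by positivity) h1 N
        _ = 4 ^ N * u ^ (-β * N) := by
          rw [mul_pow, ← Real.rpow_natCast (u ^ (-β)), ← Real.rpow_mul hu0.le]
        _ ≤ _ := by
          gcongr
          have : θ ≤ 2 := min_le_left _ _
          linarith
    calc _ ≤ C * (4 ^ N * u ^ (-θ)) * B := by gcongr
      _ = _ := by ring
  have htail : ‖A (freeFlow (-u) (h u - cutOff (closedBall 0 (u ^ ρ)) (h u)))‖ ≤
      B * u ^ (-θ) := by
    refine (hAnorm _).trans ?_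
    refine (norm_momentumOp_le (hF₁.momentumSymbol_bddMeasurable (n := n) (s ^ b))
      (hF₁.norm_momentumSymbol_le (s ^ b)) _).trans ?_
    rw [one_mul, norm_freeFlow]
    refine (hu2 _ hR).trans ?_
    rw [← Real.rpow_mul hu0.le]
    gcongr
    have : θ ≤ ρ * δ := min_le_right _ _
    linarith
  have hsum : A (freeFlow (-u) (h u)) = A (freeFlow (-u) (cutOff (closedBall 0 (u ^ ρ)) (h u))) +
      A (freeFlow (-u) (h u - cutOff (closedBall 0 (u ^ ρ)) (h u))) := by
    rw [← map_add, ← flowCLM_apply, ← flowCLM_apply (-u) (cutOff _ _), ← flowCLM_apply, ← map_add,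
      ← hsplit]
  rw [hsum]
  refine (norm_add_le _ _).trans ((add_le_add hmain htail).trans (le_of_eq ?_))
  rw [hD]
  ring

/-! ### Channel wave operators -/

/-- The limits of the channel cutoffs are all equal to the weak limit of the interaction picture. -/
theorem IsDuhamel.exists_channel_limit {φ h : ℝ → L2 n} {δ B M : ℝ} (hd : IsDuhamel φ h δ B M)
    (hn : 1 ≤ n) (hδ : 1 < δ) {Fbar F₁ : ℝ → ℝ} (hFbar : IsSmoothCutoff Fbar)
    (hF₁ : IsSmoothCutoff F₁) {α b : ℝ} (hb : 0 < b) (hbδ : b < 1 - (1 + 1 / δ) / 2)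
    (hbα : b < α) (hα : α < 1 - b) :
    ∃ Ω : L2 n, ‖Ω‖ ≤ M ∧
      (∀ x, Tendsto (fun t => inner ℂ x (φ t)) atTop (𝓝 (inner ℂ x Ω))) ∧
      Tendsto (fun t => channelCLM hFbar hF₁ α b t (φ t)) atTop (𝓝 Ω) := by
  obtain ⟨η, hη, hA⟩ := hd.exists_channel_bound hδ hFbar hF₁ hb hbδ hbα hα
  have hα0 : 0 < α := hb.trans hbα
  obtain ⟨Ω, hΩM, hΩ⟩ := exists_weak_limit (A := fun t => channelCLM hFbar hF₁ α b t) hd.bound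
    (inner_channelCLM hFbar hF₁ α b) (tendsto_channel_adjoint hFbar hF₁ hn hα0 hb) hη hA
  exact ⟨Ω, hΩM, hΩ, tendsto_of_weak_limit (inner_channelCLM hFbar hF₁ α b)
    (tendsto_channelCLM hFbar hF₁ hn hα0 hb Ω) hη hA hΩ⟩

/-! ### Crossing the region `|x| > t^{1/2+ε}` -/

/-- The gain per step of the crossing bound with `1 / k = p y` and `p = t^{1/2}`, at times `a, a'`
with radii `R ≤ t^{1/2}` and `R' ≤ (t + a')^{1/2}`. -/
theorem crossing_ratio_le {a a' t p y R R' : ℝ} (ha : 0 ≤ a) (hat : a ≤ t) (ha' : 0 < a')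
    (hp : 0 < p) (hpt : p ^ 2 = t) (hy : 1 ≤ y) (hR : R ≤ p) (hR' : 0 ≤ R')
    (htR' : t * R' ≤ p * (t + a')) :
    (p * y)⁻¹ * (a' * R + a * (2 * R' + p) + 2 * a * a' * (p * y)⁻¹) / (a + a') ≤ 6 / y := by
  have hy0 : 0 < y := by linarith
  have haa : 0 < a + a' := by linarith
  have ht : 0 < t := by rw [← hpt]; positivity
  have h1 : a * R' ≤ p * (a + a') := by
    have h2 : a * (t + a') ≤ t * (a + a') := by nlinarith
    have h3 : a * R' * (t + a') ≤ p * (a + a') * (t + a') := by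
      calc a * R' * (t + a') = a * (t + a') * R' := by ring
        _ ≤ t * (a + a') * R' := mul_le_mul_of_nonneg_right h2 hR'
        _ = (t * R') * (a + a') := by ring
        _ ≤ p * (t + a') * (a + a') := mul_le_mul_of_nonneg_right htR' haa.le
        _ = _ := by ring
    exact le_of_mul_le_mul_right h3 (by linarith)
  have h4 : 2 * a * a' * (p * y)⁻¹ ≤ 2 * p * a' := by
    rw [← div_eq_mul_inv, div_le_iff₀ (by positivity)]
    have : a ≤ p ^ 2 * y := by nlinarith
    nlinarith [mul_le_mul_of_nonneg_right this ha'.le]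
  rw [div_le_div_iff₀ haa hy0, mul_inv]
  have h5 : a' * R + a * (2 * R' + p) + 2 * a * a' * (p * y)⁻¹ ≤ 6 * p * (a + a') := by
    nlinarith [mul_le_mul_of_nonneg_left hR ha'.le]
  calc p⁻¹ * y⁻¹ * (a' * R + a * (2 * R' + p) + 2 * a * a' * (p⁻¹ * y⁻¹)) * y
      = p⁻¹ * (a' * R + a * (2 * R' + p) + 2 * a * a' * (p * y)⁻¹) := by
        rw [mul_inv]; field_simp
    _ ≤ p⁻¹ * (6 * p * (a + a')) := by gcongr
    _ = 6 * (a + a') := by field_simp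

/-- The gain per step of the crossing bound for `a' ≥ t²`, with `1 / k = a'^{1/2}`. -/
theorem crossing_ratio_le_of_late {a a' t p z R R' : ℝ} (ha : 0 ≤ a) (hat : a ≤ t)
    (hz : 1 ≤ z) (ha' : a' = z ^ 4) (htz : t ≤ z ^ 2) (hp : p ≤ z) (hR : R ≤ p)
    (hR' : R' ≤ 2 * z ^ 2) :
    (z ^ 2)⁻¹ * (a' * R + a * (2 * R' + p) + 2 * a * a' * (z ^ 2)⁻¹) / (a + a') ≤ 8 / z := by
  have hz0 : 0 < z := by linarith
  have haa : 0 < a + a' := by rw [ha']; positivity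
  have h1 : 2 * a * a' * (z ^ 2)⁻¹ = 2 * a * z ^ 2 := by
    rw [ha']; field_simp
  have hz2 : z ≤ z ^ 2 := by nlinarith
  have h2 : a * (2 * R' + p) ≤ z ^ 2 * (5 * z ^ 2) := by
    calc a * (2 * R' + p) ≤ a * (5 * z ^ 2) := mul_le_mul_of_nonneg_left (by linarith) ha
      _ ≤ _ := mul_le_mul_of_nonneg_right (by linarith) (by positivity)
  rw [h1, div_le_div_iff₀ haa hz0]
  have h3 : a' * R ≤ z ^ 4 * z := by
    rw [ha']; gcongr; linarith
  have h4 : 2 * a * z ^ 2 ≤ 2 * z ^ 4 := by nlinarith [sq_nonneg z]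
  have h5 : z ^ 4 ≤ z ^ 5 := pow_le_pow_right₀ hz (by norm_num)
  calc (z ^ 2)⁻¹ * (a' * R + a * (2 * R' + p) + 2 * a * z ^ 2) * z
      ≤ (z ^ 2)⁻¹ * (8 * z ^ 5) * z := by
        gcongr
        nlinarith
    _ = 8 * z ^ 4 := by field_simp
    _ ≤ 8 * (a + a') := by rw [ha']; linarith

/-- The gain per step of the minimal velocity bound for `a' ≥ t²`, in the ball of radius
`a'^{1/2}`. -/
theorem velocity_ratio_le_of_late {a' p z R' : ℝ} (hz : 1 ≤ z) (ha' : a' = z ^ 4) (hp0 : 0 ≤ p)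
    (hp : p ≤ z) (hR' : R' ≤ 2 * z ^ 2) : p * (z ^ 2 + 2 * R' + p) / a' ≤ 8 / z := by
  have hz0 : 0 < z := by linarith
  have h1 : z ≤ z ^ 2 := by nlinarith
  rw [ha', div_le_div_iff₀ (by positivity) hz0]
  calc p * (z ^ 2 + 2 * R' + p) * z ≤ p * (8 * z ^ 2) * z := by
        gcongr
        linarith
    _ ≤ z * (8 * z ^ 2) * z := by gcongr
    _ = 8 * z ^ 4 := by ring

theorem norm_mulOp_dilate_cutoff_le {F : ℝ → ℝ} (hF : IsSmoothCutoff F) {k : ℝ} (g : L2 n) :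
    ‖mulOp (dilate k fun x => ((F ‖x‖ : ℝ) : ℂ)) g‖ ≤ ‖g‖ := by
  have h := norm_mulOp_le ((hF.isSymbol (n := n)).bddMeasurable.dilate k).memLp (C := 1)
    (ae_of_all _ fun x => by
      rw [dilate, Complex.norm_real, Real.norm_of_nonneg (hF.nonneg _)]
      exact hF.le_one _) g
  simpa using h

set_option maxHeartbeats 1000000 in
/-- The double Duhamel kernel: a free wave emitted near the origin at a time before `t`, found in
the region `|x| > t^{1/2+ε}` with momentum at least of order `t^{-1/2}` at time `t`, is not found
near the origin at a later time `u`. -/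
theorem exists_double_duhamel_bound {F : ℝ → ℝ} (hF : IsSmoothCutoff F) {ε ν : ℝ} (hε : 0 < ε)
    (hε2 : ε ≤ 1 / 2) (hν2 : ν ≤ 1 / 2) :
    ∃ C : ℝ, 0 ≤ C ∧ ∀ t u a : ℝ, 1 ≤ t → t < u → 0 ≤ a → a ≤ t → ∀ g : L2 n,
      ‖cutOff (closedBall 0 (t ^ ν)) (freeFlow (-a)
        (mulOp (dilate (t ^ (1 / 2 + ε))⁻¹ fun x => ((F ‖x‖ : ℝ) : ℂ))
          (momentumOp (dilate (t ^ (1 / 2 : ℝ)) fun x => ((F ‖x‖ : ℝ) : ℂ))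
            (freeFlow (-(u - t)) (cutOff (closedBall 0 (u ^ ν)) g)))))‖ ≤
        C * u ^ (-4 : ℝ) * ‖g‖ := by
  -- `N` is chosen so that `t^{εN} ≥ t^8`, which dominates `u^4` as long as `u - t ≤ t²`
  obtain ⟨N, hN⟩ := exists_nat_ge (8 / ε)
  have hεN : 8 ≤ ε * N := by
    rw [div_le_iff₀ hε] at hN; linarith
  have hN16 : 16 ≤ N := by
    have : (16 : ℝ) ≤ N := by nlinarith [Nat.cast_nonneg (α := ℝ) N]
    exact_mod_cast this
  have hsym := hF.isSymbol (n := n)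
  obtain ⟨C₁, hC₁0, hC₁⟩ := exists_crossing_bound N hsym hsym
  obtain ⟨C₂, hC₂0, hC₂⟩ := exists_minimal_velocity_bound N hsym
  set f : Space n → ℂ := fun x => ((F ‖x‖ : ℝ) : ℂ) with hf
  refine ⟨16 * 8 ^ N * (C₁ + 2 * C₂), by positivity, fun t u a ht htu ha hat g => ?_⟩
  have ht0 : 0 < t := by linarith
  have hu0 : 0 < u := by linarith
  have hu1 : 1 ≤ u := by linarith
  set a' := u - t with ha'def
  have ha' : 0 < a' := by rw [ha'def]; linarith
  have htν : 0 ≤ t ^ ν := (Real.rpow_pos_of_pos ht0 _).le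
  have huν : 0 < u ^ ν := Real.rpow_pos_of_pos hu0 _
  set p := t ^ (1 / 2 : ℝ) with hp
  have hp0 : 0 < p := Real.rpow_pos_of_pos ht0 _
  have hpt : p ^ 2 = t := by
    rw [hp, ← Real.rpow_natCast, ← Real.rpow_mul ht0.le]; norm_num
  have hRp : t ^ ν ≤ p := Real.rpow_le_rpow_of_exponent_le ht hν2
  have hG : 0 ≤ ‖g‖ := norm_nonneg g
  have hu4 : u ^ (-4 : ℝ) = (u ^ 4)⁻¹ := by
    rw [Real.rpow_neg hu0.le]; norm_cast
  rw [hu4]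
  rcases le_or_gt a' (t ^ 2) with hcase | hcase
  · -- moderately late times: the far region is far enough by itself
    set y := t ^ ε with hy
    have hy1 : 1 ≤ y := Real.one_le_rpow ht hε.le
    have hr : t ^ (1 / 2 + ε) = p * y := by rw [Real.rpow_add ht0]
    rw [hr]
    refine (hC₁ (p * y)⁻¹ p a a' (t ^ ν) (u ^ ν) (by positivity) hp0.le ha ha'.le (by linarith)
      htν huν g).trans ?_
    have htR' : t * u ^ ν ≤ p * (t + a') := by
      have h1 : u ^ ν ≤ u ^ (1 / 2 : ℝ) := Real.rpow_le_rpow_of_exponent_le hu1 hν2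
      have h2 : p ≤ u ^ (1 / 2 : ℝ) := Real.rpow_le_rpow ht0.le htu.le (by norm_num)
      have h3 : (u ^ (1 / 2 : ℝ)) ^ 2 = u := by
        rw [← Real.rpow_natCast, ← Real.rpow_mul hu0.le]; norm_num
      rw [show t + a' = u by rw [ha'def]; ring, ← hpt]
      calc p ^ 2 * u ^ ν ≤ p ^ 2 * u ^ (1 / 2 : ℝ) := by gcongr
        _ = p * (p * u ^ (1 / 2 : ℝ)) := by ring
        _ ≤ p * (u ^ (1 / 2 : ℝ) * u ^ (1 / 2 : ℝ)) := by gcongr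
        _ = p * u := by rw [← sq, h3]
    have hΓ := crossing_ratio_le ha hat ha' hp0 hpt hy1 hRp huν.le htR'
    have hΓN : ((p * y)⁻¹ * (a' * t ^ ν + a * (2 * u ^ ν + p) + 2 * a * a' * (p * y)⁻¹) /
        (a + a')) ^ N ≤ 16 * 8 ^ N * (u ^ 4)⁻¹ := by
      refine (pow_le_pow_left₀ (by positivity) hΓ N).trans ?_
      rw [div_pow]
      have h1 : t ^ 8 ≤ y ^ N := by
        have h2 : y ^ N = t ^ (ε * N) := by
          rw [hy, ← Real.rpow_natCast, ← Real.rpow_mul ht0.le]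
        have h3 : t ^ 8 = t ^ (8 : ℝ) := by norm_cast
        rw [h2, h3]
        exact Real.rpow_le_rpow_of_exponent_le ht hεN
      have h2 : u ≤ 2 * t ^ 2 := by
        have : t ≤ t ^ 2 := by nlinarith
        have : u = t + a' := by rw [ha'def]; ring
        linarith
      have h3 : u ^ 4 ≤ 16 * t ^ 8 := by
        calc u ^ 4 ≤ (2 * t ^ 2) ^ 4 := by gcongr
          _ = _ := by ring
      rw [← div_eq_mul_inv, div_le_div_iff₀ (by positivity) (by positivity)]
      calc (6 : ℝ) ^ N * u ^ 4 ≤ 8 ^ N * (16 * y ^ N) := by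
            gcongr
            · norm_num
            · linarith
        _ = _ := by ring
    calc _ ≤ C₁ * (16 * 8 ^ N * (u ^ 4)⁻¹) * ‖g‖ := by gcongr
      _ = 16 * 8 ^ N * C₁ * (u ^ 4)⁻¹ * ‖g‖ := by ring
      _ ≤ _ := by
        gcongr
        linarith
  · -- very late times: waves within distance `√a'` have momentum too small
    set z := a' ^ (1 / 4 : ℝ) with hz
    have hz0 : 0 < z := Real.rpow_pos_of_pos ha' _
    have hz4 : a' = z ^ 4 := by
      rw [hz, ← Real.rpow_natCast, ← Real.rpow_mul ha'.le]; norm_num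
    have htz : t ≤ z ^ 2 := by
      refine le_of_lt (lt_of_pow_lt_pow_left₀ 2 (by positivity) ?_)
      rw [← pow_mul, ← hz4]; exact hcase
    have hpz : p ≤ z := by
      refine le_of_pow_le_pow_left₀ two_ne_zero hz0.le ?_
      rw [hpt]; exact htz
    have hz1 : 1 ≤ z := by
      refine le_of_pow_le_pow_left₀ two_ne_zero hz0.le ?_
      linarith
    have huz : u ≤ 2 * z ^ 4 := by
      have h1 : t ≤ t ^ 2 := by nlinarith
      have h2 : u = t + a' := by rw [ha'def]; ring
      linarith
    have hR' : u ^ ν ≤ 2 * z ^ 2 := by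
      refine (Real.rpow_le_rpow_of_exponent_le hu1 hν2).trans ?_
      rw [← Real.sqrt_eq_rpow]
      refine Real.sqrt_le_iff.2 ⟨by positivity, ?_⟩
      nlinarith [pow_pos hz0 4]
    have hrz : t ^ (1 / 2 + ε) ≤ z ^ 2 := by
      refine le_trans ?_ htz
      calc t ^ (1 / 2 + ε) ≤ t ^ (1 : ℝ) := Real.rpow_le_rpow_of_exponent_le ht (by linarith)
        _ = t := Real.rpow_one t
    set r := t ^ (1 / 2 + ε) with hr
    have hr0 : 0 < r := Real.rpow_pos_of_pos ht0 _
    have hfr := hsym.bddMeasurable.dilate r⁻¹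
    have hfz := hsym.bddMeasurable.dilate (z ^ 2)⁻¹
    set v := momentumOp (dilate p f) (freeFlow (-a') (cutOff (closedBall 0 (u ^ ν)) g)) with hv
    have hpow : ∀ Γ : ℝ, 0 ≤ Γ → Γ ≤ 8 / z → Γ ^ N ≤ 16 * 8 ^ N * (u ^ 4)⁻¹ := by
      intro Γ h0 h1
      refine (pow_le_pow_left₀ h0 h1 N).trans ?_
      rw [div_pow, ← div_eq_mul_inv, div_le_div_iff₀ (by positivity) (by positivity)]
      have h2 : u ^ 4 ≤ 16 * z ^ 16 := by
        calc u ^ 4 ≤ (2 * z ^ 4) ^ 4 := by gcongr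
          _ = _ := by ring
      have h3 : z ^ 16 ≤ z ^ N := pow_le_pow_right₀ hz1 hN16
      calc (8 : ℝ) ^ N * u ^ 4 ≤ 8 ^ N * (16 * z ^ N) := by
            gcongr
            linarith
        _ = _ := by ring
    have hfar : ‖cutOff (closedBall 0 (t ^ ν)) (freeFlow (-a) (mulOp (dilate (z ^ 2)⁻¹ f) v))‖ ≤
        C₁ * (16 * 8 ^ N * (u ^ 4)⁻¹) * ‖g‖ := by
      refine (hC₁ (z ^ 2)⁻¹ p a a' (t ^ ν) (u ^ ν) (by positivity) hp0.le ha ha'.le (by linarith)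
        htν huν g).trans ?_
      gcongr
      exact hpow _ (by positivity)
        (crossing_ratio_le_of_late ha hat hz1 hz4 htz hpz hRp hR')
    have hnear : ‖mulOp (dilate r⁻¹ f - dilate (z ^ 2)⁻¹ f) v‖ ≤
        2 * (C₂ * (16 * 8 ^ N * (u ^ 4)⁻¹) * ‖g‖) := by
      rw [← mulOp_eq_cutOff (hfr.sub hfz) (measurableSet_closedBall (x := (0 : Space n))
        (ε := z ^ 2)) (fun x hx => ?_)]
      · refine (norm_mulOp_le (hfr.sub hfz).memLp (C := 2) (ae_of_all _ fun x => ?_) _).trans ?_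
        · have hle : ∀ k : ℝ, ‖dilate k f x‖ ≤ 1 := fun k => by
            rw [dilate, hf, Complex.norm_real, Real.norm_of_nonneg (hF.nonneg _)]
            exact hF.le_one _
          refine (norm_sub_le _ _).trans ?_
          linarith [hle r⁻¹, hle (z ^ 2)⁻¹]
        · refine mul_le_mul_of_nonneg_left ?_ (by norm_num)
          refine (hC₂ p a' (z ^ 2) (u ^ ν) hp0.le ha' (by positivity) huν g).trans ?_
          gcongr
          refine hpow _ (by positivity) ?_
          exact velocity_ratio_le_of_late hz1 hz4 hp0.le hpz hR'
      · have hx' : z ^ 2 < ‖x‖ := by simpa using hx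
        have hone : ∀ k : ℝ, 0 < k → k ≤ z ^ 2 → dilate k⁻¹ f x = 1 := fun k hk hkz => by
          have : 1 ≤ ‖k⁻¹ • x‖ := by
            rw [norm_smul, norm_inv, Real.norm_of_nonneg hk.le, ← div_eq_inv_mul,
              le_div_iff₀ hk]
            linarith
          simp [dilate, hf, hF.eq_one _ this]
        rw [Pi.sub_apply, hone r hr0 hrz, hone (z ^ 2) (by positivity) le_rfl, sub_self]
    have hsplit : mulOp (dilate r⁻¹ f) v =
        mulOp (dilate (z ^ 2)⁻¹ f) v + mulOp (dilate r⁻¹ f - dilate (z ^ 2)⁻¹ f) v := by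
      rw [mulOp_sub_left hfr hfz]
      abel
    have hlin := map_add (cutCLM (closedBall (0 : Space n) (t ^ ν)) measurableSet_closedBall ∘L
      flowCLM (-a)) (mulOp (dilate (z ^ 2)⁻¹ f) v) (mulOp (dilate r⁻¹ f - dilate (z ^ 2)⁻¹ f) v)
    rw [← hsplit] at hlin
    simp only [ContinuousLinearMap.comp_apply, cutCLM_apply, flowCLM_apply] at hlin
    rw [hlin]
    refine (norm_add_le _ _).trans ((add_le_add hfar
      (((norm_cutOff_le measurableSet_closedBall _).trans (norm_freeFlow _ _).le).trans
        hnear)).trans (le_of_eq ?_))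
    ring

/-! ### Strong continuity of the free flow -/

theorem continuous_freeFlow (hn : 1 ≤ n) (f : L2 n) : Continuous fun t : ℝ => freeFlow t f := by
  rw [continuous_iff_continuousAt]
  intro t₀
  have hb : ∀ t : ℝ, BddMeasurable (freePhase t - freePhase t₀ : Space n → ℂ) := fun t =>
    (freePhase_bddMeasurable t).sub (freePhase_bddMeasurable t₀)
  have h := tendsto_momentumOp_zero (l := 𝓝 t₀) hn hb (C := 2) (fun t p =>
    (norm_sub_le _ _).trans (by rw [norm_freePhase, norm_freePhase]; norm_num)) (fun p _ => by
      have hc : Continuous fun t : ℝ => (freePhase t - freePhase t₀ : Space n → ℂ) p := by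
        simp only [freePhase, Pi.sub_apply]
        fun_prop
      simpa using hc.tendsto t₀) f
  rw [ContinuousAt, tendsto_iff_norm_sub_tendsto_zero]
  rw [tendsto_zero_iff_norm_tendsto_zero] at h
  refine h.congr fun t => ?_
  rw [momentumOp_sub_left (freePhase_bddMeasurable t) (freePhase_bddMeasurable t₀)]
  rfl

theorem continuous_freeFlow_uncurry (hn : 1 ≤ n) :
    Continuous fun p : ℝ × L2 n => freeFlow p.1 p.2 := by
  refine continuous_prod_of_continuous_lipschitzWith' _ 1 (fun t => ?_)
    (fun f => continuous_freeFlow hn f)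
  refine LipschitzWith.of_dist_le_mul fun f g => ?_
  rw [dist_eq_norm, dist_eq_norm, ← flowCLM_apply, ← flowCLM_apply, ← map_sub, flowCLM_apply,
    norm_freeFlow, NNReal.coe_one, one_mul]

theorem aestronglyMeasurable_freeFlow (hn : 1 ≤ n) {μ : Measure ℝ} {a : ℝ → ℝ}
    (ha : Continuous a) {f : ℝ → L2 n} (hf : AEStronglyMeasurable f μ) :
    AEStronglyMeasurable (fun u => freeFlow (a u) (f u)) μ := by
  have h : AEStronglyMeasurable (fun u => ((a u, f u) : ℝ × L2 n)) μ :=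
    ha.aestronglyMeasurable.prodMk hf
  obtain ⟨G, hG⟩ : ∃ G : ℝ × L2 n → L2 n, ∀ p, freeFlow p.1 p.2 = G p := ⟨_, fun _ => rfl⟩
  have hc : Continuous G := by
    simpa only [hG] using continuous_freeFlow_uncurry hn
  have h2 := hc.comp_aestronglyMeasurable h
  simpa only [← hG] using h2

/-! ### Near and far sources -/

theorem IsDuhamel.nonneg_bound {φ h : ℝ → L2 n} {δ B M : ℝ} (hd : IsDuhamel φ h δ B M) : 0 ≤ M :=
  (norm_nonneg _).trans (hd.bound 0)

theorem IsDuhamel.integrable_cutOff {φ h : ℝ → L2 n} {δ B M : ℝ} (hd : IsDuhamel φ h δ B M)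
    (hn : 1 ≤ n) (R s t : ℝ) :
    IntervalIntegrable (fun u => freeFlow (-u) (cutOff (closedBall 0 R) (h u))) volume s t := by
  have hm : ∀ μ : Measure ℝ, AEStronglyMeasurable (fun u => freeFlow (-u) (h u)) μ →
      AEStronglyMeasurable (fun u => freeFlow (-u) (cutOff (closedBall 0 R) (h u))) μ := by
    intro μ hμ
    have h1 := aestronglyMeasurable_freeFlow hn continuous_id hμ
    have h2 : AEStronglyMeasurable (fun u : ℝ => cutCLM (closedBall 0 R) measurableSet_closedBall
        (freeFlow (id u) (freeFlow (-u) (h u)))) μ :=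
      Continuous.comp_aestronglyMeasurable (ContinuousLinearMap.continuous _) h1
    have h3 := aestronglyMeasurable_freeFlow hn continuous_neg h2
    refine h3.congr (ae_of_all _ fun u => ?_)
    simp only [freeFlow_freeFlow, id, add_neg_cancel, freeFlow_zero, cutCLM_apply]
  have hle : ∀ u, ‖freeFlow (-u) (cutOff (closedBall 0 R) (h u))‖ ≤ ‖freeFlow (-u) (h u)‖ :=
    fun u => by
      rw [norm_freeFlow, norm_freeFlow]
      exact norm_cutOff_le measurableSet_closedBall _
  have hi := hd.integrable s t
  exact ⟨Integrable.mono hi.1 (hm _ hi.1.1) (ae_of_all _ hle),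
    Integrable.mono hi.2 (hm _ hi.2.1) (ae_of_all _ hle)⟩

/-- Integrating a bound over a finite time interval. -/
theorem IsDuhamel.norm_apply_sub_le_mul {φ h : ℝ → L2 n} {δ B M : ℝ} (hd : IsDuhamel φ h δ B M)
    {E : Type*} [NormedAddCommGroup E] [NormedSpace ℂ E] [CompleteSpace E]
    (T : L2 n →L[ℂ] E) {S t : ℝ} (ht : 0 ≤ t)
    (hT : ∀ᵐ u : ℝ, 0 < u → u ≤ t → ‖T (freeFlow (-u) (h u))‖ ≤ S) :
    ‖T (φ t - φ 0)‖ ≤ S * t := by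
  rw [hd.sub_eq, map_neg, norm_neg, map_smul, norm_smul, Complex.norm_I, one_mul,
    ← ContinuousLinearMap.intervalIntegral_comp_comm _ (hd.integrable 0 t)]
  have := intervalIntegral.norm_integral_le_of_norm_le_const_ae (a := 0) (b := t) (C := S)
    (f := fun u => T (freeFlow (-u) (h u))) (by
      filter_upwards [hT] with u hu hu'
      rw [Set.uIoc_of_le ht] at hu'
      exact hu hu'.1 hu'.2)
  simpa [abs_of_nonneg ht] using this

/-- Up to a small remainder, `φ t - Ω` is generated by initial data and sources in the ball of
radius `R`. -/
theorem IsDuhamel.exists_near_part {φ h : ℝ → L2 n} {δ B M : ℝ} (hd : IsDuhamel φ h δ B M)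
    (hn : 1 ≤ n) {Ω : L2 n} (hΩ : ‖Ω‖ ≤ M) {t R : ℝ} (ht : 0 ≤ t) (hR : 0 < R) :
    ∃ ζ : L2 n, ‖φ t - Ω - ζ‖ ≤ ‖(φ 0 - Ω) - cutOff (closedBall 0 R) (φ 0 - Ω)‖ +
        B * R ^ (-δ) * t ∧
      ∀ (k : L2 n) (S : ℝ), 0 ≤ S →
        (∀ u, 0 ≤ u → u ≤ t → ‖cutOff (closedBall 0 R) (freeFlow u k)‖ ≤ S) →
        ‖inner ℂ ζ k‖ ≤ (2 * M + B * t) * S := by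
  set x := φ 0 - Ω with hx
  have hx2 : ‖x‖ ≤ 2 * M := (norm_sub_le _ _).trans (by linarith [hd.bound 0])
  have hI := hd.integrable_cutOff hn R 0 t
  refine ⟨cutOff (closedBall 0 R) x -
    Complex.I • ∫ u in (0 : ℝ)..t, freeFlow (-u) (cutOff (closedBall 0 R) (h u)), ?_, ?_⟩
  · have h1 : φ t - Ω - (cutOff (closedBall 0 R) x -
        Complex.I • ∫ u in (0 : ℝ)..t, freeFlow (-u) (cutOff (closedBall 0 R) (h u))) =
        (x - cutOff (closedBall 0 R) x) - Complex.I • ∫ u in (0 : ℝ)..t,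
          (freeFlow (-u) (h u) - freeFlow (-u) (cutOff (closedBall 0 R) (h u))) := by
      rw [intervalIntegral.integral_sub (hd.integrable 0 t) hI, smul_sub]
      have h2 : φ t = φ 0 - Complex.I • ∫ u in (0 : ℝ)..t, freeFlow (-u) (h u) := by
        have := hd.sub_eq 0 t
        rw [sub_eq_iff_eq_add] at this
        rw [this]
        abel
      rw [h2, hx]
      abel
    rw [h1]
    refine (norm_sub_le _ _).trans (add_le_add le_rfl ?_)
    rw [norm_smul, Complex.norm_I, one_mul]
    have := intervalIntegral.norm_integral_le_of_norm_le_const_ae (a := 0) (b := t)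
      (C := B * R ^ (-δ))
      (f := fun u => freeFlow (-u) (h u) - freeFlow (-u) (cutOff (closedBall 0 R) (h u))) (by
        filter_upwards [hd.tail_le] with u hu _
        rw [← flowCLM_apply, ← flowCLM_apply, ← map_sub, flowCLM_apply, norm_freeFlow]
        exact hu R hR)
    simpa [abs_of_nonneg ht] using this
  · intro k S hS0 hS
    have hind := BddMeasurable.indicator (measurableSet_closedBall (x := (0 : Space n)) (ε := R))
    have hstar : (fun x : Space n => star ((closedBall (0 : Space n) R).indicator
        (fun _ => (1 : ℂ)) x)) = (closedBall (0 : Space n) R).indicator fun _ => (1 : ℂ) := by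
      ext x
      by_cases hx : x ∈ closedBall (0 : Space n) R <;> simp [hx]
    have hcut : ∀ f g : L2 n, inner ℂ (cutOff (closedBall 0 R) f) g =
        inner ℂ f (cutOff (closedBall 0 R) g) := fun f g => by
      rw [cutOff, cutOff, inner_mulOp hind (by rwa [hstar]), hstar]
    have hpair : ∀ u, inner ℂ (freeFlow (-u) (cutOff (closedBall 0 R) (h u))) k =
        inner ℂ (h u) (cutOff (closedBall 0 R) (freeFlow u k)) := fun u => by
      rw [← inner_freeFlow, hcut]
    rw [inner_sub_left, inner_smul_left]
    have h1 : ‖inner ℂ (cutOff (closedBall 0 R) x) k‖ ≤ 2 * M * S := by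
      rw [hcut]
      have h2 := hS 0 le_rfl ht
      rw [freeFlow_zero] at h2
      exact (norm_inner_le_norm _ _).trans (mul_le_mul hx2 h2 (norm_nonneg _)
        (by linarith [hd.nonneg_bound]))
    have h2 : ‖inner ℂ (∫ u in (0 : ℝ)..t, freeFlow (-u) (cutOff (closedBall 0 R) (h u))) k‖ ≤
        B * S * t := by
      rw [norm_inner_symm]
      have h3 := (innerSL ℂ k).intervalIntegral_comp_comm hI
      simp only [innerSL_apply_apply] at h3
      rw [← h3]
      have := intervalIntegral.norm_integral_le_of_norm_le_const_ae (a := 0) (b := t)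
        (C := B * S)
        (f := fun u => inner ℂ k (freeFlow (-u) (cutOff (closedBall 0 R) (h u)))) (by
          filter_upwards [hd.norm_le] with u hu hu'
          rw [Set.uIoc_of_le ht] at hu'
          rw [norm_inner_symm, hpair]
          exact (norm_inner_le_norm _ _).trans (mul_le_mul hu (hS u hu'.1.le hu'.2)
            (norm_nonneg _) hd.nonneg))
      simpa [abs_of_nonneg ht] using this
    refine (norm_sub_le _ _).trans ?_
    rw [norm_mul]
    simp only [Complex.conj_I, norm_neg, Complex.norm_I, one_mul]
    calc _ ≤ 2 * M * S + B * S * t := add_le_add h1 h2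
      _ = _ := by ring

theorem tendsto_sub_cutOff_closedBall {ν : ℝ} (hν : 0 < ν) (f : L2 n) :
    Tendsto (fun t : ℝ => ‖f - cutOff (closedBall 0 (t ^ ν)) f‖) atTop (𝓝 0) := by
  have h0 : BddMeasurable (fun _ : Space n => (1 : ℂ)) := ⟨measurable_const, 1, by simp⟩
  have hi : ∀ t : ℝ, BddMeasurable ((closedBall (0 : Space n) (t ^ ν)).indicator
      fun _ => (1 : ℂ)) := fun t => BddMeasurable.indicator measurableSet_closedBall
  have h1 := tendsto_mulOp_zero (l := atTop) (fun t : ℝ => h0.sub (hi t)) (C := 2) (fun t x => by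
    by_cases hx : x ∈ closedBall (0 : Space n) (t ^ ν) <;>
      simp only [Pi.sub_apply, hx, Set.indicator_of_mem, Set.indicator_of_notMem,
        not_false_eq_true] <;> norm_num) (ae_of_all _ fun x => by
      refine tendsto_const_nhds.congr' ?_
      have h3 : Tendsto (fun t : ℝ => t ^ ν) atTop atTop := tendsto_rpow_atTop hν
      filter_upwards [h3.eventually_ge_atTop ‖x‖] with t ht
      have : x ∈ closedBall (0 : Space n) (t ^ ν) := by simpa using ht
      simp [this]) f
  rw [tendsto_zero_iff_norm_tendsto_zero] at h1
  refine h1.congr fun t => ?_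
  rw [mulOp_sub_left h0 (hi t), mulOp_one]
  rfl

/-! ### The far region at low momenta -/

theorem IsSmoothCutoff.isCompactSymbol {F : ℝ → ℝ} (hF : IsSmoothCutoff F) :
    IsCompactSymbol (fun p : Space n => 1 - ((F ‖p‖ : ℝ) : ℂ)) := by
  refine ⟨contDiff_const.sub hF.isSymbol.contDiff, ?_⟩
  refine HasCompactSupport.intro (isCompact_closedBall (0 : Space n) 1) fun x hx => ?_
  have hx' : 1 < ‖x‖ := by simpa using hx
  rw [hF.eq_one _ hx'.le]
  simp

theorem lowSymbol_eq_dilate {F : ℝ → ℝ} {s : ℝ} (hs : 0 ≤ s) :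
    ((fun _ => 1) - momentumSymbol F s : Space n → ℂ) =
      dilate s fun p => 1 - ((F ‖p‖ : ℝ) : ℂ) := by
  rw [momentumSymbol_eq_dilate F hs]
  rfl

theorem tendsto_const_mul_rpow_neg (A : ℝ) {θ : ℝ} (hθ : 0 < θ) :
    Tendsto (fun t : ℝ => A * t ^ (-θ)) atTop (𝓝 0) := by
  simpa using (tendsto_rpow_neg_atTop hθ).const_mul A

/-- The low-momentum part of `φ t - Ω`, evolved freely to time `t`, does not reach the region
`|x| > t^{1/2+ε}`. -/
theorem IsDuhamel.exists_low_bound {φ h : ℝ → L2 n} {δ B M : ℝ} (hd : IsDuhamel φ h δ B M)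
    (hn : 1 ≤ n) {F : ℝ → ℝ} (hF : IsSmoothCutoff F) {ε ν : ℝ} (hε : 0 < ε) (hν2 : ν ≤ 1 / 2)
    (hνδ : 1 < ν * δ) (Ω : L2 n) :
    ∃ η : ℝ → ℝ, Tendsto η atTop (𝓝 0) ∧ ∀ᶠ t in atTop,
      ‖cutOff {x | t ^ (1 / 2 + ε) / 2 < ‖x‖} (momentumOp
        ((fun _ => 1) - momentumSymbol F (t ^ (1 / 2 : ℝ))) (freeFlow t (φ t - Ω)))‖ ≤ η t := by
  obtain ⟨N, hN⟩ := exists_nat_ge (2 / ε)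
  have hN2 : 2 ≤ ε * N := by
    rw [div_le_iff₀ hε] at hN; linarith
  obtain ⟨C, hC0, hC⟩ := exists_maximal_velocity_bound N (hF.isCompactSymbol (n := n))
  have hB := hd.nonneg
  refine ⟨fun t => ‖momentumOp ((fun _ => 1) - momentumSymbol F (t ^ (1 / 2 : ℝ))) (φ 0 - Ω)‖ +
    (C * 10 ^ N * B * t ^ (-1 : ℝ) + 2 * B * t ^ (-(ν * δ - 1))), ?_, ?_⟩
  · have h1 := tendsto_zero_iff_norm_tendsto_zero.1
      (hF.tendsto_lowMomentum hn (b := 1 / 2) (by norm_num) (φ 0 - Ω))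
    simpa using h1.add ((tendsto_const_mul_rpow_neg (C * 10 ^ N * B) one_pos).add
      (tendsto_const_mul_rpow_neg (2 * B) (sub_pos.2 hνδ)))
  filter_upwards [eventually_ge_atTop 1] with t ht
  have ht0 : 0 < t := by linarith
  set p := t ^ (1 / 2 : ℝ) with hp
  have hp0 : 0 < p := Real.rpow_pos_of_pos ht0 _
  have hpt : p * p = t := by
    rw [hp, ← Real.rpow_add ht0]; norm_num
  set y := t ^ ε with hy
  have hy0 : 0 < y := Real.rpow_pos_of_pos ht0 _
  have hr : t ^ (1 / 2 + ε) = p * y := by rw [Real.rpow_add ht0]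
  rw [hr]
  have hlow : BddMeasurable ((fun _ => 1) - momentumSymbol F p : Space n → ℂ) :=
    BddMeasurable.sub ⟨measurable_const, 1, by simp⟩ (hF.momentumSymbol_bddMeasurable _)
  have hlow2 : ∀ f, ‖momentumOp ((fun _ => 1) - momentumSymbol F p : Space n → ℂ) f‖ ≤ 2 * ‖f‖ :=
    norm_momentumOp_le hlow fun x => by
      refine (norm_sub_le _ _).trans ?_
      have := hF.norm_momentumSymbol_le p x
      simp only [norm_one]
      linarith
  set T : L2 n →L[ℂ] L2 n := cutCLM {x | p * y / 2 < ‖x‖} (measurableSet_lt_norm _) ∘L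
    momCLM _ hlow ∘L flowCLM t with hT
  have hTapp : ∀ f, T f = cutOff {x | p * y / 2 < ‖x‖} (momentumOp
        ((fun _ => 1) - momentumSymbol F p) (freeFlow t f)) := fun f => rfl
  rw [← hTapp]
  have hT2 : ∀ f, ‖T f‖ ≤ ‖momentumOp ((fun _ => 1) - momentumSymbol F p) f‖ := fun f => by
    rw [hTapp, momentumOp_freeFlow_comm hlow]
    exact (norm_cutOff_le (measurableSet_lt_norm _) _).trans (norm_freeFlow _ _).le
  have hsplit : T (φ t - Ω) = T (φ 0 - Ω) + T (φ t - φ 0) := by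
    rw [← map_add]
    congr 1
    abel
  rw [hsplit]
  refine (norm_add_le _ _).trans (add_le_add (hT2 _) ?_)
  set R := t ^ ν with hR
  have hR0 : 0 < R := Real.rpow_pos_of_pos ht0 _
  have hRp : R ≤ p := Real.rpow_le_rpow_of_exponent_le ht hν2
  have hpowN : (10 / y) ^ N ≤ 10 ^ N * t ^ (-2 : ℝ) := by
    have h2 : y ^ N = t ^ (ε * N) := by
      rw [hy, ← Real.rpow_natCast, ← Real.rpow_mul ht0.le]
    rw [div_pow, div_eq_mul_inv, h2, ← Real.rpow_neg ht0.le]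
    gcongr
  have hbound := hd.norm_apply_sub_le_mul T (S := C * (10 ^ N * t ^ (-2 : ℝ)) * B +
    2 * (B * R ^ (-δ))) ht0.le (by
      filter_upwards [hd.norm_le, hd.tail_le] with u hu1 hu2 hu0 hut
      have hsum : T (freeFlow (-u) (h u)) = T (freeFlow (-u) (cutOff (closedBall 0 R) (h u))) +
          T (freeFlow (-u) (h u - cutOff (closedBall 0 R) (h u))) := by
        rw [← map_add, ← flowCLM_apply, ← flowCLM_apply (-u) (cutOff _ _), ← flowCLM_apply,
          ← map_add]
        congr 2
        abel
      rw [hsum]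
      refine (norm_add_le _ _).trans (add_le_add ?_ ?_)
      · rw [hTapp, lowSymbol_eq_dilate hp0.le, freeFlow_freeFlow]
        refine (hC p (t + -u) (p * y / 2) R hp0 (by linarith) (by positivity) hR0 _).trans ?_
        have hratio : (2 * R + p + 2 * (t + -u) / p) / (p * y / 2) ≤ 10 / y := by
          have h3 : 2 * (t + -u) / p ≤ 2 * p := by
            rw [div_le_iff₀ hp0]; nlinarith
          rw [div_le_div_iff₀ (by positivity) hy0]
          calc (2 * R + p + 2 * (t + -u) / p) * y ≤ (5 * p) * y := by
                gcongr
                linarith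
            _ = 10 * (p * y / 2) := by ring
        have h4 : 0 ≤ (2 * R + p + 2 * (t + -u) / p) / (p * y / 2) := by
          have : 0 ≤ t + -u := by linarith
          positivity
        have h5 := (pow_le_pow_left₀ h4 hratio N).trans hpowN
        gcongr
      · refine (hT2 _).trans ((hlow2 _).trans ?_)
        rw [norm_freeFlow]
        exact mul_le_mul_of_nonneg_left (hu2 R hR0) (by norm_num))
  refine hbound.trans (le_of_eq ?_)
  have e1 : t ^ (-2 : ℝ) * t = t ^ (-1 : ℝ) := by
    rw [← Real.rpow_add_one ht0.ne']; norm_num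
  have e2 : R ^ (-δ) * t = t ^ (-(ν * δ - 1)) := by
    rw [hR, ← Real.rpow_mul ht0.le, ← Real.rpow_add_one ht0.ne']
    congr 1
    ring
  rw [← e1, ← e2]
  ring

/-! ### The far region at high momenta -/

/-- The high-momentum part of `φ t - Ω`, evolved freely to time `t`, has asymptotically no overlap
with `φ t - Ω` in the region `|x| > t^{1/2+ε}`: one factor is written as generated before `t`, the
other one as generated after `t`. -/
theorem IsDuhamel.exists_high_bound {φ h : ℝ → L2 n} {δ B M : ℝ} (hd : IsDuhamel φ h δ B M)
    (hn : 1 ≤ n) {F : ℝ → ℝ} (hF : IsSmoothCutoff F) {ε ν : ℝ} (hε : 0 < ε) (hε2 : ε ≤ 1 / 2)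
    (hν0 : 0 < ν) (hν2 : ν ≤ 1 / 2) (hνδ : 1 < ν * δ) {Ω : L2 n} (hΩM : ‖Ω‖ ≤ M)
    (hΩ : ∀ x, Tendsto (fun t => inner ℂ x (φ t)) atTop (𝓝 (inner ℂ x Ω))) :
    ∃ η : ℝ → ℝ, Tendsto η atTop (𝓝 0) ∧ ∀ᶠ t in atTop,
      ‖inner ℂ (freeFlow t (φ t - Ω))
        (mulOp (dilate (t ^ (1 / 2 + ε))⁻¹ fun x => ((F ‖x‖ : ℝ) : ℂ))
          (momentumOp (momentumSymbol F (t ^ (1 / 2 : ℝ))) (freeFlow t (φ t - Ω))))‖ ≤ η t := by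
  obtain ⟨C, hC0, hC⟩ := exists_double_duhamel_bound (n := n) hF hε hε2 hν2
  have hB := hd.nonneg
  have hM := hd.nonneg_bound
  have hθ1 : 1 < min 2 (ν * δ) := lt_min (by norm_num) hνδ
  set θ := min 2 (ν * δ) with hθ
  set D : ℝ := (2 * M + B) * C * B + (4 * M + B) * B with hD
  have hD0 : 0 ≤ D := by positivity
  set x₀ := φ 0 - Ω with hx₀
  have hx2 : ‖x₀‖ ≤ 2 * M := (norm_sub_le _ _).trans (by linarith [hd.bound 0])
  refine ⟨fun t => (‖x₀ - cutOff (closedBall 0 (t ^ ν)) x₀‖ + B * t ^ (-(ν * δ - 1))) * (2 * M) +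
    D * (t ^ (1 - θ) / (θ - 1)), ?_, ?_⟩
  · have h1 := ((tendsto_sub_cutOff_closedBall hν0 x₀).add
      (tendsto_const_mul_rpow_neg B (sub_pos.2 hνδ))).mul_const (2 * M)
    have h2 : Tendsto (fun t : ℝ => t ^ (1 - θ)) atTop (𝓝 0) := by
      have := tendsto_rpow_neg_atTop (y := θ - 1) (by linarith)
      simpa using this
    simpa using h1.add ((h2.div_const (θ - 1)).const_mul D)
  filter_upwards [eventually_ge_atTop 1] with t ht
  have ht0 : 0 < t := by linarith
  set R := t ^ ν with hR
  have hR0 : 0 < R := Real.rpow_pos_of_pos ht0 _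
  obtain ⟨ζ, hζ1, hζ2⟩ := hd.exists_near_part hn hΩM ht0.le hR0
  set τ := ‖x₀ - cutOff (closedBall 0 R) x₀‖ + B * t ^ (-(ν * δ - 1)) with hτ
  have e2 : B * R ^ (-δ) * t = B * t ^ (-(ν * δ - 1)) := by
    rw [hR, ← Real.rpow_mul ht0.le, mul_assoc, ← Real.rpow_add_one ht0.ne']
    congr 2
    ring
  rw [e2] at hζ1
  have hζ1' : ‖φ t - Ω - ζ‖ ≤ τ := hζ1
  have hφΩ : ‖φ t - Ω‖ ≤ 2 * M := (norm_sub_le _ _).trans (by linarith [hd.bound t])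
  have hmb := hF.momentumSymbol_bddMeasurable (n := n) (t ^ (1 / 2 : ℝ))
  have hfb := (hF.isSymbol (n := n)).bddMeasurable.dilate (t ^ (1 / 2 + ε))⁻¹
  -- the operator in the interaction picture; `ζ` below carries the sources before time `t`, and the
  -- weak limit expresses the other factor through the sources after time `t`
  set K : L2 n →L[ℂ] L2 n := flowCLM (-t) ∘L mulCLM _ hfb ∘L momCLM _ hmb ∘L flowCLM t with hK
  have hKapp : ∀ f, K f = freeFlow (-t)
      (mulOp (dilate (t ^ (1 / 2 + ε))⁻¹ fun x => ((F ‖x‖ : ℝ) : ℂ))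
        (momentumOp (momentumSymbol F (t ^ (1 / 2 : ℝ))) (freeFlow t f))) := fun f => rfl
  have hK1 : ∀ f, ‖K f‖ ≤ ‖f‖ := fun f => by
    rw [hKapp, norm_freeFlow]
    refine (norm_mulOp_dilate_cutoff_le hF _).trans ?_
    have := norm_momentumOp_le hmb (hF.norm_momentumSymbol_le _) (freeFlow t f)
    rwa [one_mul, norm_freeFlow] at this
  have hstart : inner ℂ (freeFlow t (φ t - Ω))
      (mulOp (dilate (t ^ (1 / 2 + ε))⁻¹ fun x => ((F ‖x‖ : ℝ) : ℂ))
        (momentumOp (momentumSymbol F (t ^ (1 / 2 : ℝ))) (freeFlow t (φ t - Ω)))) =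
      inner ℂ (φ t - Ω) (K (φ t - Ω)) := by
    rw [hKapp, inner_freeFlow, neg_neg]
  rw [hstart]
  have hsplit : inner ℂ (φ t - Ω) (K (φ t - Ω)) =
      inner ℂ (φ t - Ω - ζ) (K (φ t - Ω)) + inner ℂ ζ (K (φ t - Ω)) := by
    rw [← inner_add_left, sub_add_cancel]
  rw [hsplit]
  refine (norm_add_le _ _).trans (add_le_add ?_ ?_)
  · exact (norm_inner_le_norm _ _).trans (mul_le_mul hζ1' ((hK1 _).trans hφΩ) (norm_nonneg _)
      ((norm_nonneg _).trans hζ1'))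
  have hζn : ‖ζ‖ ≤ 4 * M + B := by
    have h1 : ‖x₀ - cutOff (closedBall 0 R) x₀‖ ≤ 2 * M := by
      have hind := BddMeasurable.indicator (measurableSet_closedBall (x := (0 : Space n)) (ε := R))
      have h0 : BddMeasurable (fun _ : Space n => (1 : ℂ)) := ⟨measurable_const, 1, by simp⟩
      have h2 := norm_mulOp_le (h0.sub hind).memLp (C := 1) (ae_of_all _ fun x => by
        by_cases hx : x ∈ closedBall (0 : Space n) R <;>
          simp only [Pi.sub_apply, hx, Set.indicator_of_mem, Set.indicator_of_notMem,
            not_false_eq_true] <;> norm_num) x₀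
      rw [mulOp_sub_left h0 hind, mulOp_one, one_mul] at h2
      exact h2.trans hx2
    have h2 : B * t ^ (-(ν * δ - 1)) ≤ B :=
      mul_le_of_le_one_right hB (Real.rpow_le_one_of_one_le_of_nonpos ht (by linarith))
    have h3 : ζ = (φ t - Ω) - (φ t - Ω - ζ) := by abel
    have h4 : ‖ζ‖ ≤ ‖φ t - Ω‖ + ‖φ t - Ω - ζ‖ := by
      conv_lhs => rw [h3]
      exact norm_sub_le _ _
    linarith
  set T : L2 n →L[ℂ] ℂ := innerSL ℂ ζ ∘L K with hT
  have hTapp : ∀ f, T f = inner ℂ ζ (K f) := fun f => rfl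
  have hlim : Tendsto (fun s => ‖T (φ s - φ t)‖) atTop (𝓝 ‖T (Ω - φ t)‖) := by
    simp only [hTapp, ← ContinuousLinearMap.adjoint_inner_left, inner_sub_right]
    exact ((hΩ _).sub_const _).norm
  have hneg : ‖inner ℂ ζ (K (φ t - Ω))‖ = ‖T (Ω - φ t)‖ := by
    rw [← hTapp, ← norm_neg, ← map_neg, neg_sub]
  rw [hneg]
  refine le_of_tendsto hlim ?_
  filter_upwards [eventually_ge_atTop t] with s hs
  refine hd.norm_apply_sub_le T hθ1 ht0 hs hD0 ?_
  filter_upwards [hd.norm_le, hd.tail_le] with u hu1 hu2 htu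
  have hu : 1 ≤ u := by linarith
  have hu0 : 0 < u := by linarith
  have hRu : 0 < u ^ ν := Real.rpow_pos_of_pos hu0 _
  have hsum : T (freeFlow (-u) (h u)) = T (freeFlow (-u) (cutOff (closedBall 0 (u ^ ν)) (h u))) +
      T (freeFlow (-u) (h u - cutOff (closedBall 0 (u ^ ν)) (h u))) := by
    rw [← map_add, ← flowCLM_apply, ← flowCLM_apply (-u) (cutOff _ _), ← flowCLM_apply,
      ← map_add]
    congr 2
    abel
  have hmain : ‖T (freeFlow (-u) (cutOff (closedBall 0 (u ^ ν)) (h u)))‖ ≤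
      (2 * M + B) * C * B * u ^ (-θ) := by
    rw [hTapp]
    refine (hζ2 _ (C * u ^ (-4 : ℝ) * B) (by positivity) fun a ha hat => ?_).trans ?_
    · rw [hKapp, freeFlow_freeFlow, freeFlow_freeFlow,
        momentumSymbol_eq_dilate F (Real.rpow_nonneg ht0.le _), show a + -t = -(t - a) by ring,
        show t + -u = -(u - t) by ring]
      refine (hC t u (t - a) ht htu (by linarith) (by linarith) _).trans ?_
      gcongr
    · have h1 : 2 * M + B * t ≤ (2 * M + B) * u := by nlinarith
      have h2 : u * u ^ (-4 : ℝ) ≤ u ^ (-θ) := by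
        rw [mul_comm, ← Real.rpow_add_one hu0.ne']
        refine Real.rpow_le_rpow_of_exponent_le hu ?_
        have : θ ≤ 2 := min_le_left _ _
        linarith
      calc (2 * M + B * t) * (C * u ^ (-4 : ℝ) * B)
          ≤ (2 * M + B) * u * (C * u ^ (-4 : ℝ) * B) := by gcongr
        _ = (2 * M + B) * C * B * (u * u ^ (-4 : ℝ)) := by ring
        _ ≤ _ := by gcongr
  have htail : ‖T (freeFlow (-u) (h u - cutOff (closedBall 0 (u ^ ν)) (h u)))‖ ≤
      (4 * M + B) * B * u ^ (-θ) := by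
    rw [hTapp]
    refine (norm_inner_le_norm _ _).trans ?_
    have h1 := hK1 (freeFlow (-u) (h u - cutOff (closedBall 0 (u ^ ν)) (h u)))
    rw [norm_freeFlow] at h1
    have h2 : (u ^ ν) ^ (-δ) ≤ u ^ (-θ) := by
      rw [← Real.rpow_mul hu0.le]
      refine Real.rpow_le_rpow_of_exponent_le hu ?_
      have : θ ≤ ν * δ := min_le_right _ _
      linarith
    have h3 := h1.trans ((hu2 _ hRu).trans (mul_le_mul_of_nonneg_left h2 hB))
    calc _ ≤ (4 * M + B) * (B * u ^ (-θ)) :=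
          mul_le_mul hζn h3 (norm_nonneg _) (by positivity)
      _ = _ := by ring
  rw [hsum]
  refine (norm_add_le _ _).trans ((add_le_add hmain htail).trans (le_of_eq ?_))
  rw [hD]
  ring

/-! ### The weakly localized part -/

/-- A sharp cutoff is dominated by a smooth one. -/
theorem IsSmoothCutoff.sq_norm_cutOff_le {F : ℝ → ℝ} (hF : IsSmoothCutoff F) {r : ℝ} (hr : 0 < r)
    (w : L2 n) :
    ‖cutOff {x | r < ‖x‖} w‖ ^ 2 ≤
      ‖inner ℂ w (mulOp (dilate r⁻¹ fun x => ((F ‖x‖ : ℝ) : ℂ)) w)‖ := by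
  have hfb := (hF.isSymbol (n := n)).bddMeasurable.dilate r⁻¹
  have hFb : ∀ x : Space n, ‖F ‖r⁻¹ • x‖‖ ≤ 1 := fun x => by
    rw [Real.norm_of_nonneg (hF.nonneg _)]; exact hF.le_one _
  have h1 : inner ℂ w (mulOp (dilate r⁻¹ fun x => ((F ‖x‖ : ℝ) : ℂ)) w) =
      ((∫ x, F ‖r⁻¹ • x‖ * ‖w x‖ ^ 2 : ℝ) : ℂ) := by
    rw [L2.inner_def, ← integral_complex_ofReal]
    refine integral_congr_ae ?_
    filter_upwards [mulOp_coeFn hfb.memLp w] with x hx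
    rw [hx, dilate, ← smul_eq_mul, inner_smul_right, inner_self_eq_norm_sq_to_K]
    simp
  have hint : Integrable (fun x => F ‖r⁻¹ • x‖ * ‖w x‖ ^ 2) volume := by
    refine (integrable_norm_sq w).bdd_mul (c := 1) ?_ (ae_of_all _ hFb)
    exact (hF.contDiff.continuous.comp (by fun_prop)).aestronglyMeasurable
  rw [h1, norm_sq_eq_integral, Complex.norm_real]
  refine le_trans (integral_mono_ae (integrable_norm_sq _) hint ?_) (le_abs_self _)
  filter_upwards [cutOff_coeFn (measurableSet_lt_norm r) w] with x hx
  rw [hx]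
  by_cases hxr : x ∈ {x : Space n | r < ‖x‖}
  · have h3 : 1 ≤ ‖r⁻¹ • x‖ := by
      rw [norm_smul, norm_inv, Real.norm_of_nonneg hr.le, ← div_eq_inv_mul, le_div_iff₀ hr,
        one_mul]
      exact le_of_lt hxr
    simp [hxr, hF.eq_one _ h3]
  · simp only [hxr, Set.indicator_of_notMem, not_false_eq_true, norm_zero]
    simpa using mul_nonneg (hF.nonneg ‖r⁻¹ • x‖) (sq_nonneg ‖w x‖)

/-- The solution minus its free channel is asymptotically supported in `|x| ≤ t^{1/2+ε}`. -/
theorem IsDuhamel.tendsto_norm_cutOff {φ h : ℝ → L2 n} {δ B M : ℝ} (hd : IsDuhamel φ h δ B M)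
    (hn : 1 ≤ n) (hδ : 2 < δ) {ε : ℝ} (hε : 0 < ε) (hε2 : ε ≤ 1 / 2) {Ω : L2 n} (hΩM : ‖Ω‖ ≤ M)
    (hΩ : ∀ x, Tendsto (fun t => inner ℂ x (φ t)) atTop (𝓝 (inner ℂ x Ω))) :
    Tendsto (fun t : ℝ => ‖cutOff {x | t ^ (1 / 2 + ε) < ‖x‖} (freeFlow t (φ t - Ω))‖)
      atTop (𝓝 0) := by
  obtain ⟨F, hF⟩ := exists_isSmoothCutoff
  have hδ0 : 0 < δ := by linarith
  -- sources are cut off at radius `t ^ ν` with `1 / δ < ν < 1 / 2`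
  set ν : ℝ := (1 / δ + 1 / 2) / 2 with hν
  have hν0 : 0 < ν := by positivity
  have hν2 : ν ≤ 1 / 2 := by
    have : 1 / δ ≤ 1 / 2 := one_div_le_one_div_of_le (by norm_num) hδ.le
    rw [hν]; linarith
  have hνδ : 1 < ν * δ := by
    rw [hν]; field_simp; linarith
  have hM := hd.nonneg_bound
  obtain ⟨η₁, hη₁, h₁⟩ := hd.exists_low_bound hn hF hε hν2 hνδ Ω
  obtain ⟨η₂, hη₂, h₂⟩ := hd.exists_high_bound hn hF hε hε2 hν0 hν2 hνδ hΩM hΩ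
  have hsq : Tendsto (fun t : ℝ => ‖cutOff {x | t ^ (1 / 2 + ε) < ‖x‖}
      (freeFlow t (φ t - Ω))‖ ^ 2) atTop (𝓝 0) := by
    have hlim : Tendsto (fun t => 2 * M * η₁ t + η₂ t) atTop (𝓝 0) := by
      simpa using (hη₁.const_mul (2 * M)).add hη₂
    refine squeeze_zero' (Eventually.of_forall fun t => by positivity) ?_ hlim
    filter_upwards [h₁, h₂, eventually_ge_atTop 1] with t ht₁ ht₂ ht
    have ht0 : 0 < t := by linarith
    set r := t ^ (1 / 2 + ε) with hr
    have hr0 : 0 < r := Real.rpow_pos_of_pos ht0 _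
    set w := freeFlow t (φ t - Ω) with hw
    have hwM : ‖w‖ ≤ 2 * M := by
      rw [hw, norm_freeFlow]
      exact (norm_sub_le _ _).trans (by linarith [hd.bound t])
    set f : Space n → ℂ := dilate r⁻¹ fun x => ((F ‖x‖ : ℝ) : ℂ) with hf
    have hfb : BddMeasurable f := (hF.isSymbol (n := n)).bddMeasurable.dilate r⁻¹
    refine (hF.sq_norm_cutOff_le hr0 w).trans ?_
    set s := t ^ (1 / 2 : ℝ) with hs
    have hsplit : mulOp f w = mulOp f (momentumOp ((fun _ => 1) - momentumSymbol F s) w) +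
        mulOp f (momentumOp (momentumSymbol F s) w) := by
      rw [hF.momentumOp_low, ← mulCLM_apply hfb, ← mulCLM_apply hfb, ← mulCLM_apply hfb,
        ← map_add, sub_add_cancel]
    rw [hsplit, inner_add_right]
    refine (norm_add_le _ _).trans (add_le_add ?_ ht₂)
    refine (norm_inner_le_norm _ _).trans (mul_le_mul hwM ?_ (norm_nonneg _) (by linarith))
    rw [← mulOp_eq_cutOff hfb (measurableSet_lt_norm (r / 2)) (fun x hx => ?_)]
    · exact (norm_mulOp_dilate_cutoff_le hF _).trans ht₁
    · have hx' : ‖x‖ ≤ r / 2 := by simpa using hx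
      have h3 : ‖r⁻¹ • x‖ ≤ 1 / 2 := by
        rw [norm_smul, norm_inv, Real.norm_of_nonneg hr0.le, ← div_eq_inv_mul, div_le_iff₀ hr0]
        linarith
      simp [hf, dilate, hF.eq_zero _ h3]
  have h3 := hsq.sqrt
  simpa [Real.sqrt_sq] using h3

/-! ### Vanishing initial data -/

/-- Grönwall, for the integral `G(t) = ∫₀ᵗ ‖ψ‖`. -/
theorem IsGlobalSolution.eq_zero_of_initial_eq_zero {N : Interaction n} {ψ : ℝ → L2 n} {δ : ℝ}
    (h : IsGlobalSolution N ψ) (hδ : 0 < δ) (hN : IsLocalized N ψ δ) (h0 : ψ 0 = 0) {t : ℝ}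
    (ht : 0 ≤ t) : ψ t = 0 := by
  obtain ⟨K, hK0, hK⟩ := exists_source_bound hδ hN
  have hc : Continuous fun u => ‖ψ u‖ := h.continuous.norm
  have hle : ∀ s, 0 ≤ s → ‖ψ s‖ ≤ K * ∫ u in (0 : ℝ)..s, ‖ψ u‖ := fun s hs => by
    have h1 : ‖ψ s‖ = ‖∫ u in (0 : ℝ)..s, freeFlow (-u) (source N ψ u)‖ := by
      rw [← norm_freeFlow (-s) (ψ s)]
      change ‖interactionPicture ψ s‖ = _
      rw [interactionPicture_eq h, h0, zero_sub, norm_neg, norm_smul, Complex.norm_I, one_mul]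
    rw [h1, ← intervalIntegral.integral_const_mul]
    refine intervalIntegral.norm_integral_le_of_norm_le hs ?_
      ((hc.const_mul K).intervalIntegrable 0 s)
    filter_upwards [hK] with u hu _
    rw [norm_freeFlow]
    exact hu.1
  set G : ℝ → ℝ := fun s => ∫ u in (0 : ℝ)..s, ‖ψ u‖ with hG
  have hGd : ∀ s, HasDerivAt G ‖ψ s‖ s := fun s =>
    intervalIntegral.integral_hasDerivAt_right (hc.intervalIntegrable 0 s)
      hc.stronglyMeasurable.stronglyMeasurableAtFilter hc.continuousAt
  have hG0 : ∀ s, 0 ≤ s → 0 ≤ G s := fun s hs =>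
    intervalIntegral.integral_nonneg hs fun u _ => norm_nonneg _
  have hgr := norm_le_gronwallBound_of_norm_deriv_right_le (f := G) (f' := fun s => ‖ψ s‖)
    (δ := 0) (K := K) (ε := 0) (a := 0) (b := t)
    (fun s _ => (hGd s).continuousAt.continuousWithinAt)
    (fun s _ => (hGd s).hasDerivWithinAt) (by simp [hG]) (fun s hs => by
      rw [norm_norm, add_zero, Real.norm_of_nonneg (hG0 s hs.1)]
      exact hle s hs.1) t ⟨ht, le_rfl⟩
  rw [gronwallBound_ε0_δ0, Real.norm_of_nonneg (hG0 t ht)] at hgr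
  have h2 := hle t ht
  have h3 : G t = 0 := le_antisymm hgr (hG0 t ht)
  have h4 : ‖ψ t‖ ≤ K * G t := h2
  rw [h3, mul_zero] at h4
  exact norm_le_zero_iff.1 h4

/-! ### Restriction to a ball -/

theorem positionMoment_cutOff_le {r : ℝ} (hr : 0 ≤ r) (f : L2 n) :
    positionMoment (cutOff (closedBall 0 r) f) ≤ ENNReal.ofReal (r * ‖f‖ ^ 2) := by
  have h1 : positionMoment (cutOff (closedBall 0 r) f) ≤
      ∫⁻ x, ENNReal.ofReal (r * ‖f x‖ ^ 2) := by
    refine lintegral_mono_ae ?_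
    filter_upwards [cutOff_coeFn (measurableSet_closedBall (x := (0 : Space n)) (ε := r)) f]
      with x hx
    rw [hx]
    refine ENNReal.ofReal_le_ofReal ?_
    by_cases hxr : x ∈ closedBall (0 : Space n) r
    · have h2 : ‖x‖ ≤ r := by simpa using hxr
      rw [Set.indicator_of_mem hxr]
      gcongr
    · rw [Set.indicator_of_notMem hxr]
      simpa using mul_nonneg hr (sq_nonneg ‖f x‖)
  refine h1.trans (le_of_eq ?_)
  rw [← ofReal_integral_eq_lintegral_ofReal ((integrable_norm_sq f).const_mul r)
    (ae_of_all _ fun x => mul_nonneg hr (sq_nonneg _)), integral_const_mul, norm_sq_eq_integral]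

theorem sub_cutOff_closedBall (r : ℝ) (f : L2 n) :
    f - cutOff (closedBall 0 r) f = cutOff {x | r < ‖x‖} f := by
  apply Lp.ext
  filter_upwards [Lp.coeFn_sub f (cutOff (closedBall 0 r) f),
    cutOff_coeFn (measurableSet_closedBall (x := (0 : Space n)) (ε := r)) f,
    cutOff_coeFn (measurableSet_lt_norm r) f] with x h1 h2 h3
  rw [h1, Pi.sub_apply, h2, h3]
  by_cases hx : ‖x‖ ≤ r
  · have h4 : x ∈ closedBall (0 : Space n) r := by simpa using hx
    have h5 : x ∉ {x : Space n | r < ‖x‖} := by simpa using hx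
    rw [Set.indicator_of_mem h4, Set.indicator_of_notMem h5, sub_self]
  · have h4 : x ∉ closedBall (0 : Space n) r := by simpa using hx
    have h5 : x ∈ {x : Space n | r < ‖x‖} := by simpa using hx
    rw [Set.indicator_of_notMem h4, Set.indicator_of_mem h5, sub_zero]

/-! ### The two parts of the theorem -/

/-- The channel wave operators exist, and the rest of the solution tends weakly to zero. -/
theorem IsGlobalSolution.channel_limits {N : Interaction n} {ψ : ℝ → L2 n} {δ M : ℝ}
    (h : IsGlobalSolution N ψ) (hn : 1 ≤ n) (hδ : 1 < δ) (hM : ∀ t, ‖ψ t‖ ≤ M)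
    (hN : IsLocalized N ψ δ) {Fbar F₁ : ℝ → ℝ} (hFbar : IsSmoothCutoff Fbar)
    (hF₁ : IsSmoothCutoff F₁) {b α : ℝ} (hb : 0 < b) (hbδ : b < 1 - (1 + 1 / δ) / 2)
    (hbα : b < α) (hα : α < 1 - b) :
    (∃ Ω : L2 n, Tendsto (fun t : ℝ => freeFlow (-t) (channelCutoff Fbar F₁ α b t (ψ t)))
      atTop (𝓝 Ω)) ∧
    ∀ x : L2 n, Tendsto (fun t : ℝ =>
      inner ℂ x (freeFlow (-t) (ψ t - channelCutoff Fbar F₁ α b t (ψ t)))) atTop (𝓝 0) := by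
  obtain ⟨B, hd⟩ := h.exists_isDuhamel (by linarith) hM hN
  obtain ⟨Ω, -, hweak, hstrong⟩ := hd.exists_channel_limit hn hδ hFbar hF₁ hb hbδ hbα hα
  have hs : Tendsto (fun t : ℝ => freeFlow (-t) (channelCutoff Fbar F₁ α b t (ψ t)))
      atTop (𝓝 Ω) := by
    simpa only [freeFlow_channelCutoff hFbar hF₁, interactionPicture] using hstrong
  refine ⟨⟨Ω, hs⟩, fun x => ?_⟩
  have h1 := (hweak x).sub (Filter.Tendsto.inner (𝕜 := ℂ) (tendsto_const_nhds (x := x)) hs)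
  rw [sub_self] at h1
  refine h1.congr fun t => ?_
  rw [← inner_sub_right, interactionPicture, ← flowCLM_apply, ← flowCLM_apply, ← map_sub,
    flowCLM_apply]

/-- For `δ > 2`, the solution is the sum of a free wave and a part restricted to `|x| ≤ t^{1/2+ε}`,
asymptotically. Since the localized part has norm at most `2M`, the moment bound follows. -/
theorem IsGlobalSolution.exists_localized_part {N : Interaction n} {ψ : ℝ → L2 n} {δ M : ℝ}
    (h : IsGlobalSolution N ψ) (hn : 1 ≤ n) (hδ : 2 < δ) (hM : ∀ t, ‖ψ t‖ ≤ M)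
    (hN : IsLocalized N ψ δ) :
    ∃ ψplus : L2 n, ∀ ε : ℝ, 0 < ε → ∃ ψw : ℝ → L2 n,
      Tendsto (fun t : ℝ => ‖ψ t - freeFlow t ψplus - ψw t‖) atTop (𝓝 0) ∧
      ∀ t : ℝ, 1 ≤ t → positionMoment (ψw t) ≤
        ENNReal.ofReal (4 * M ^ 2 * t ^ (1 / 2 + ε)) := by
  obtain ⟨B, hd⟩ := h.exists_isDuhamel (by linarith) hM hN
  obtain ⟨F, hF⟩ := exists_isSmoothCutoff
  have hδ2 : 1 / δ < 1 / 2 := one_div_lt_one_div_of_lt (by norm_num) hδ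
  have hδ0 : 0 < 1 / δ := by positivity
  obtain ⟨Ω, hΩM, hweak, -⟩ := hd.exists_channel_limit hn (by linarith) hF hF
    (b := (1 - (1 + 1 / δ) / 2) / 2) (α := 1 / 2) (by linarith) (by linarith) (by linarith)
    (by linarith)
  refine ⟨Ω, fun ε hε => ?_⟩
  have hε0 : 0 < min ε (1 / 2) := lt_min hε (by norm_num)
  have hw : ∀ t, ψ t - freeFlow t Ω = freeFlow t (interactionPicture ψ t - Ω) := fun t => by
    rw [← flowCLM_apply t (_ - _), map_sub, flowCLM_apply, flowCLM_apply, interactionPicture,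
      freeFlow_freeFlow, add_neg_cancel, freeFlow_zero]
  refine ⟨fun t => cutOff (closedBall 0 (t ^ (1 / 2 + min ε (1 / 2)))) (ψ t - freeFlow t Ω),
    ?_, fun t ht => ?_⟩
  · simp only [sub_cutOff_closedBall, hw]
    exact hd.tendsto_norm_cutOff hn hδ hε0 (min_le_right _ _) hΩM hweak
  · have ht0 : 0 < t := by linarith
    refine (positionMoment_cutOff_le (Real.rpow_nonneg ht0.le _) _).trans
      (ENNReal.ofReal_le_ofReal ?_)
    have h1 : ‖ψ t - freeFlow t Ω‖ ≤ 2 * M := by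
      refine (norm_sub_le _ _).trans ?_
      rw [norm_freeFlow]
      linarith [hM t]
    have h2 : t ^ (1 / 2 + min ε (1 / 2)) ≤ t ^ (1 / 2 + ε) :=
      Real.rpow_le_rpow_of_exponent_le ht (by linarith [min_le_left ε (1 / 2)])
    calc t ^ (1 / 2 + min ε (1 / 2)) * ‖ψ t - freeFlow t Ω‖ ^ 2
        ≤ t ^ (1 / 2 + ε) * (2 * M) ^ 2 := by gcongr
      _ = _ := by ring

end FreeChannel

end

open FreeChannel in
theorem theorem2 (n : ℕ) (hn : 1 ≤ n) :
    ∃ C : ℝ → ℝ → ℝ,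
      ∀ (N : Interaction n) (ψ : ℝ → L2 n) (δ M : ℝ),
        1 < δ → IsGlobalSolution N ψ → (∀ t : ℝ, ‖ψ t‖ ≤ M) → IsLocalized N ψ δ →
        -- part (a)
        (∀ Fbar F₁ : ℝ → ℝ, IsSmoothCutoff Fbar → IsSmoothCutoff F₁ →
          ∀ b α : ℝ, 0 < b → b < 1 - (1 + 1 / δ) / 2 → b < α → α < 1 - b →
            (∃ Ω : L2 n,
              Tendsto (fun t : ℝ => freeFlow (-t) (channelCutoff Fbar F₁ α b t (ψ t)))
                atTop (𝓝 Ω)) ∧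
            (∀ φ : L2 n,
              Tendsto (fun t : ℝ =>
                inner ℂ φ (freeFlow (-t) (ψ t - channelCutoff Fbar F₁ α b t (ψ t))))
                atTop (𝓝 0))) ∧
        -- part (b)
        (2 < δ →
          ∃ ψplus : L2 n, ∀ ε : ℝ, 0 < ε →
            ∃ ψw : ℝ → L2 n,
              Tendsto (fun t : ℝ => ‖ψ t - freeFlow t ψplus - ψw t‖) atTop (𝓝 0) ∧
              ∀ t : ℝ, 1 ≤ t →
                positionMoment (ψw t) ≤
                  ENNReal.ofReal
                    (C ε (M / ‖ψ 0‖) * t ^ (1 / 2 + ε) * ‖ψ 0‖ ^ 2)) := by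
  refine ⟨fun _ q => 4 * q ^ 2, fun N ψ δ M hδ hψ hM hN => ⟨?_, fun hδ2 => ?_⟩⟩
  · intro Fbar F₁ hFbar hF₁ b α hb hbδ hbα hα
    exact hψ.channel_limits hn hδ hM hN hFbar hF₁ hb hbδ hbα hα
  · rcases eq_or_ne (ψ 0) 0 with h0 | h0
    · -- vanishing data: the solution vanishes for positive times
      refine ⟨0, fun ε _ => ⟨fun _ => 0, ?_, fun t _ => ?_⟩⟩
      · refine tendsto_const_nhds.congr' ?_
        filter_upwards [eventually_ge_atTop 0] with t ht
        rw [hψ.eq_zero_of_initial_eq_zero (by linarith) hN h0 ht, ← flowCLM_apply, map_zero]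
        simp
      · have h1 : positionMoment (0 : L2 n) = 0 := by
          rw [positionMoment, ← lintegral_zero (μ := (volume : Measure (Space n)))]
          refine lintegral_congr_ae ?_
          filter_upwards [Lp.coeFn_zero ℂ 2 (volume : Measure (Space n))] with x hx
          rw [hx]
          simp
        simp [h1]
    · obtain ⟨ψplus, h1⟩ := hψ.exists_localized_part hn hδ2 hM hN
      refine ⟨ψplus, fun ε hε => ?_⟩
      obtain ⟨ψw, h2, h3⟩ := h1 ε hε
      refine ⟨ψw, h2, fun t ht => (h3 t ht).trans (le_of_eq ?_)⟩
      have h4 : ‖ψ 0‖ ≠ 0 := norm_ne_zero_iff.2 h0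
      congr 1
      field_simp
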